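/- Conventions. $G$ is a finitely generated, virtually free group which is not virtually cyclic. Trees are simplicial. A \emph{marking} $(\alpha,T)$ of $G$ is an action $\alpha$ of $G$ on a locally finite tree $X$, by automorphisms, without edge inversions, cocompact and with finite stabilizers, together with a connected fundamental domain $T\subset X$: a connected union of vertices and open edges containing exactly one vertex, respectively one open edge, of every orbit of vertices, respectively of edges (an edge of $T$ may have only one endpoint in $T$). Let $\overline X=X/G=(V,E)$ ($E$ is the set of oriented edges, $o(e)$ is the origin of $e$ and $\overline e$ is the reversed edge), identify $V$ with the set of vertices of $T$, let $E_T\subset E$ be the set of oriented edges of the spanning tree given by the edges of $T$ with both endpoints in $T$, and put $S=E\setminus E_T$. Let $G_v$ be the stabilizer of $v\in V\subset X$. For every edge $(x,y)$ of $T$ with $x\in T$ and $y\notin T$, fix a stable letter, i.e. an element $s\in G$ such that $s^{-1}y\in T$; the oriented edge of $\overline X$ defined by $(x,y)$, which is lifted to $(x,y)$, acts as $s$, and the reversed edge $\overline s$, which is lifted to $(s^{-1}y,s^{-1}x)$, acts as $s^{-1}$. Every $e\in E$ has thus a lift with origin $o(e)\in T$; let $\alpha_e(A_e)\subset G_{o(e)}$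 be the stabilizer of this lift. For $e\in E_T$ write $v\in C(e,T)$ if $e$ lies on the oriented geodesic of the spanning tree from $o(e)$ to $v$. The \emph{preferred generators} are the elements of $\mathcal G=\bigcup_v G_v\cup\bigcup_{s\in S}\alpha_s(A_s)s$. Given $\rho:G\to \mathsf{Homeo}_+(\mathbb S^1)$, a \emph{ping-pong partition} is a family $\Theta=\{U_v^e,V_s\}$ ($v\in V$, $e\in E$ with $o(e)=v$, $s\in S$) of open subsets of $\mathbb S^1$, each with finitely many connected components, such that, with $U_v=\bigcup_{o(e)=v}U_v^e$ and with elements of $G$ acting through $\rho$: \begin{itemize} \item the sets $U_v$ ($v\in V$), $V_s$ ($s\in S$) are pairwise disjoint, for each $v$ the sets $U_v^e$ are pairwise disjoint, $V_s\neq\emptyset$, $U_v\ne\emptyset$ if $G_v\neq\alpha_e(A_e)$ for some $e\in E$ with $o(e)=v$, and $U_{o(e)}^e\neq\emptyset$ if $e\in E_T$ and $G_{o(e)}\ne\alpha_e(A_e)$; \item for $s\in S$: $s(U_v)\subset V_s$ for all $v$ and $s(V_{s'})\subset V_s$ for all $s'\neq\overline s$; $\alpha_s(A_s)(V_s)\subset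 V_s$; $(G_{o(s)}\setminus\alpha_s(A_s))(V_s)\subset U_{o(s)}^s$; $\alpha_s(A_s)(U_{o(s)}^s)=U_{o(s)}^s$; \item for $e\in E_T$: $\alpha_e(A_e)(U_{o(e)}^e)\subset U_{o(e)}^e$; if $v\in C(e,T)$ then $(G_{o(e)}\setminus\alpha_e(A_e))(U_v)\subset U_{o(e)}^e$; if $o(s)\in C(e,T)$ then $(G_{o(e)}\setminus\alpha_e(A_e))(V_s)\subset U_{o(e)}^e$; \item let $\mathcal I$ be the set of connected components of the members of $\Theta$, and let the \emph{gaps} be the connected components of $\mathbb S^1\setminus\bigcup_{I\in\mathcal I} I$; for every $g\in\mathcal G$ and $I\in\mathcal I$, either $g(I)$ is contained in a member of $\Theta$, or $g(I)$ is \emph{$\mathcal I$-Markovian}, i.e. it is the union of $m+1$ elements of $\mathcal I$ and $m$ gaps for some $m\geq1$. \end{itemize} It is \emph{proper} if moreover: $\alpha_s(A_s)$ acts faithfully on $V_s$ for $s\in S$, and $\alpha_e(A_e)$ acts faithfully on $U^e_{o(e)}$ for $e\in E_T$ with $G_{o(e)}\neq\alpha_e(A_e)$; if some $U_v$ is non-empty,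 then there is $w\in V$ such that the union of the sets $(G_w\setminus\alpha_s(A_s))(V_s)$ ($s\in S$, $o(s)=w$), $(G_w\setminus\alpha_e(A_e))(U_v)$ and $(G_w\setminus\alpha_e(A_e))(V_s)$ ($e\in E_T$, $o(e)=w$, $v\in C(e,T)$, respectively $o(s)\in C(e,T)$) misses a point of $U_w$; and if $S=\{s,\overline s\}$ and all $U_v$ are empty, then there is a point $p\notin V_s\cup V_{\overline s}$ with $s(p)\in V_s$ and $\overline s(p)\in V_{\overline s}$. Two ping-pong partitions $\Theta_1,\Theta_2$ of representations $\rho_1,\rho_2$ of the same marked group, with sets of components $\mathcal I_1,\mathcal I_2$, are \emph{equivalent} if there is a bijection $\theta:\mathcal I_1\to\mathcal I_2$ preserving the cyclic order such that, for $g\in\mathcal G$ and $I,I'\in\mathcal I_1$: $\rho_1(g)(I)\subset I'$ implies $\rho_2(g)(\theta(I))\subset\theta(I')$; $\rho_1(g)(I)=I'$ implies $\rho_2(g)(\theta(I))=\theta(I')$; and if $\rho_1(g)(I)$ is $\mathcal I_1$-Markovian, union of intervals $I_0,\dots,I_m$ and gaps $J_1,\dots,J_m$, then $\rho_2(g)(\theta(I))$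 is $\mathcal I_2$-Markovian, union of $\theta(I_0),\dots,\theta(I_m)$ and $\theta(J_1),\dots,\theta(J_m)$, where $\theta$ maps the gap following an interval $K$ (in the positive direction) to the gap following $\theta(K)$. \textbf{Theorem B.} Let $G$ be a finitely generated, virtually free, not virtually cyclic group with a marking $(\alpha,T)$ (and stable letters), and let $\rho_1,\rho_2:G\to\mathsf{Homeo}_+(\mathbb S^1)$ be two representations having equivalent proper ping-pong partitions with respect to $(G,\alpha,T)$. Then $\rho_1$ and $\rho_2$ are semi-conjugate: there are a central extension $0\to\mathbb Z\to\widehat G\to G\to1$, lifts $\widehat\rho_1,\widehat\rho_2:\widehat G\to\mathsf{Homeo}_{\mathbb Z}(\mathbb R)$ of $\rho_1,\rho_2$ to homeomorphisms of $\mathbb R$ commuting with integer translations, both sending $n\in\mathbb Z$ to the translation by $n$, and a monotone non-decreasing map $h:\mathbb R\to\mathbb R$ commuting with integer translations, such that $h\,\widehat\rho_1(\widehat g)=\widehat\rho_2(\widehat g)\,h$ for all $\widehat g\in\widehat G$. -/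

import Mathlib

namespace PingPong

universe u

/-! ### Groups and circle homeomorphisms -/

/-- `G` has a free subgroup of finite index. -/
def VirtuallyFree (G : Type*) [Group G] : Prop :=
  ∃ H : Subgroup G, H.FiniteIndex ∧ IsFreeGroup H

/-- `G` has a cyclic subgroup of finite index (this includes the finite groups). -/
def VirtuallyCyclic (G : Type*) [Group G] : Prop :=
  ∃ H : Subgroup G, H.FiniteIndex ∧ IsCyclic H

/-- The circle `ℝ / ℤ`. -/
abbrev S1 : Type := AddCircle (1 : ℝ)

/-- `F`, an invertible increasing map of `ℝ` commuting with `x ↦ x + 1` (that is, an element of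
`Homeo_ℤ(ℝ)`), is a lift of the circle map `f`. -/
def IsLift (F : CircleDeg1Liftˣ) (f : S1 → S1) : Prop :=
  ∀ x : ℝ, f (x : S1) = (((F : CircleDeg1Lift) x : ℝ) : S1)

/-- The group `Homeo₊(S¹)` of orientation-preserving homeomorphisms of the circle, i.e. of the
homeomorphisms that lift to an increasing homeomorphism of `ℝ` commuting with `x ↦ x + 1`. -/
def HomeoPlus : Subgroup (S1 ≃ₜ S1) where
  carrier := {f | ∃ F : CircleDeg1Liftˣ, IsLift F f}
  one_mem' := ⟨1, fun _ => rfl⟩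
  mul_mem' := by
    rintro f g ⟨F, hF⟩ ⟨K, hK⟩
    refine ⟨F * K, fun x => ?_⟩
    have h1 : (f * g) (x : S1) = f (g (x : S1)) := rfl
    rw [h1, hK, hF]
    rfl
  inv_mem' := by
    rintro f ⟨F, hF⟩
    refine ⟨F⁻¹, fun x => ?_⟩
    have h1 : f⁻¹ (x : S1) = f.symm (x : S1) := rfl
    rw [h1, Homeomorph.symm_apply_eq, hF]
    have h2 : (F : CircleDeg1Lift) ((F⁻¹ : CircleDeg1Liftˣ) x) = x :=
      CircleDeg1Lift.units_apply_inv_apply F x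
    rw [h2]

/-- The image `ρ(g)(A)` of a subset of the circle. -/
def img {G : Type*} [Group G] (ρ : G →* HomeoPlus) (g : G) (A : Set S1) : Set S1 :=
  (fun x => (ρ g : S1 ≃ₜ S1) x) '' A

/-! ### Semi-conjugacy -/

/-- `ρ₁` and `ρ₂` are semi-conjugate: there are a central extension `0 → ℤ → K → G → 1`, lifts
`R₁, R₂ : K → Homeo_ℤ(ℝ)` of `ρ₁, ρ₂` sending `n ∈ ℤ` to the translation by `n`, and a monotone
map `h : ℝ → ℝ` commuting with integer translations, such that `h R₁(k) = R₂(k) h` for all `k`. -/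
def SemiConjugate {G : Type u} [Group G] (ρ₁ ρ₂ : G →* HomeoPlus) : Prop :=
  ∃ (K : Type u) (_ : Group K) (ι : Multiplicative ℤ →* K) (π : K →* G)
    (R₁ R₂ : K →* CircleDeg1Liftˣ) (h : CircleDeg1Lift),
    (Function.Injective ι ∧ Function.Surjective π ∧ ι.range = π.ker ∧
      ι.range ≤ Subgroup.center K) ∧
    (∀ n : ℤ, R₁ (ι (Multiplicative.ofAdd n)) =
      CircleDeg1Lift.translate (Multiplicative.ofAdd (n : ℝ))) ∧
    (∀ n : ℤ, R₂ (ι (Multiplicative.ofAdd n)) =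
      CircleDeg1Lift.translate (Multiplicative.ofAdd (n : ℝ))) ∧
    (∀ k, IsLift (R₁ k) (ρ₁ (π k) : S1 ≃ₜ S1)) ∧
    (∀ k, IsLift (R₂ k) (ρ₂ (π k) : S1 ≃ₜ S1)) ∧
    ∀ (k : K) (x : ℝ), h ((R₁ k : CircleDeg1Lift) x) = (R₂ k : CircleDeg1Lift) (h x)

/-! ### Markings -/

/-- A marking of `G`: an action of `G` on (the vertex set `X` of) a locally finite tree, by
automorphisms without edge inversions, cocompact and with finite stabilizers, together with a
connected fundamental domain `T`. The set `T` consists of the vertices in `verts` and of the open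
edges in `edges`; it contains exactly one vertex of every orbit of vertices and one open edge of
every orbit of edges. An edge of `T` may have only one of its endpoints in `T`. -/
structure TreeMarking (G : Type*) [Group G] (X : Type*) [MulAction G X] where
  tree : SimpleGraph X
  isTree : tree.IsTree
  locallyFinite : ∀ x, (tree.neighborSet x).Finite
  adj_smul : ∀ (g : G) (x y : X), tree.Adj x y → tree.Adj (g • x) (g • y)
  no_inversion : ∀ (g : G) (x y : X), tree.Adj x y → ¬ (g • x = y ∧ g • y = x)
  finite_stabilizer : ∀ x : X, Finite (MulAction.stabilizer G x)
  verts : Set X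
  edges : Set (Sym2 X)
  edges_subset : edges ⊆ tree.edgeSet
  cocompact : verts.Finite
  existsUnique_vert : ∀ x : X, ∃! v, v ∈ verts ∧ ∃ g : G, g • x = v
  existsUnique_edge : ∀ e ∈ tree.edgeSet,
    ∃! e', e' ∈ edges ∧ ∃ g : G, Sym2.map (fun x => g • x) e = e'
  edge_meets : ∀ e ∈ edges, ∃ v ∈ verts, v ∈ e
  connected : ∀ x ∈ verts, ∀ y ∈ verts,
    (SimpleGraph.fromRel (fun a b : X => a ∈ verts ∧ b ∈ verts ∧ s(a, b) ∈ edges)).Reachable x y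

namespace TreeMarking

variable {G : Type*} [Group G] {X : Type*} [MulAction G X] (M : TreeMarking G X)

/-- The tree formed by the vertices of `T` and the edges of `T` with both endpoints in `T`; it
projects isomorphically onto a spanning tree of the quotient graph. -/
def span : SimpleGraph X :=
  SimpleGraph.fromRel (fun a b : X => a ∈ M.verts ∧ b ∈ M.verts ∧ s(a, b) ∈ M.edges)

/-- The oriented edges of the spanning tree, as pairs (origin, target). -/
def TreeEdge : Type _ := {p : X × X // M.span.Adj p.1 p.2}

/-- The edges of `T` with only one endpoint in `T`, oriented so that the origin is in `T`. -/
def HalfEdge : Type _ :=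
  {p : X × X // p.1 ∈ M.verts ∧ p.2 ∉ M.verts ∧ s(p.1, p.2) ∈ M.edges}

/-- `v ∈ C(e, T)`: the oriented edge `e` belongs to the geodesic of the spanning tree from the
origin of `e` to `v`. -/
def Beyond (e : M.TreeEdge) (v : X) : Prop :=
  ∃ p : M.span.Walk e.1.1 v, p.IsPath ∧ ∃ d ∈ p.darts, d.toProd = e.1

/-- A choice of stable letters: for every edge of `T` leaving `T`, an element of `G` sending the
vertex of `T` in the orbit of its target to its target. -/
structure StableLetters where
  letter : M.HalfEdge → G
  inv_smul_mem : ∀ s : M.HalfEdge, (letter s)⁻¹ • s.1.2 ∈ M.verts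

end TreeMarking

namespace TreeMarking.StableLetters

variable {G : Type*} [Group G] {X : Type*} [MulAction G X] {M : TreeMarking G X}
  (t : M.StableLetters)

/-- The set `S` of oriented edges of the quotient graph outside the spanning tree: `(s, true)` is
the projection of `s`, and `(s, false)` is the same edge with the reversed orientation. -/
def SEdge (_t : M.StableLetters) : Type _ := M.HalfEdge × Bool

/-- All the oriented edges of the quotient graph. -/
def Edge : Type _ := M.TreeEdge ⊕ t.SEdge

variable {t}

/-- The reversed edge `s̄`. -/
def SEdge.bar (s : t.SEdge) : t.SEdge := (s.1, !s.2)

/-- The element of `G` defined by `s ∈ S`; one has `s̄ = s⁻¹`. -/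
def SEdge.elem : t.SEdge → G
  | (s, true) => t.letter s
  | (s, false) => (t.letter s)⁻¹

/-- The lift to `X` (origin, target) of an edge `s ∈ S`, with origin in `T`. -/
def SEdge.lift : t.SEdge → X × X
  | (s, true) => s.1
  | (s, false) => ((t.letter s)⁻¹ • s.1.2, (t.letter s)⁻¹ • s.1.1)

/-- The lift to `X` (origin, target) of an oriented edge of the quotient, with origin in `T`. -/
def Edge.lift : t.Edge → X × X
  | Sum.inl e => e.1
  | Sum.inr s => s.lift

/-- The origin `o(e)`, as a vertex of `T`. -/
def Edge.origin (e : t.Edge) : X := e.lift.1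

/-- The edge of the quotient graph given by an edge of the spanning tree. -/
def ofTree (t : M.StableLetters) (e : M.TreeEdge) : t.Edge := Sum.inl e

/-- The edge of the quotient graph given by `s ∈ S`. -/
def SEdge.toEdge (s : t.SEdge) : t.Edge := Sum.inr s

/-- The origin `o(s)`, as a vertex of `T`. -/
def SEdge.origin (s : t.SEdge) : X := s.lift.1

/-- The subgroup `α_e(A_e)` of the vertex group `G_{o(e)}`. -/
def Edge.group (e : t.Edge) : Subgroup G :=
  MulAction.stabilizer G e.lift.1 ⊓ MulAction.stabilizer G e.lift.2

/-- The subgroup `α_s(A_s)` of the vertex group `G_{o(s)}`. -/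
def SEdge.group (s : t.SEdge) : Subgroup G := s.toEdge.group

/-- `g ∈ G_{o(e)} \ α_e(A_e)`. -/
def Edge.Outer (e : t.Edge) (g : G) : Prop :=
  g ∈ MulAction.stabilizer G e.origin ∧ g ∉ e.group

variable (t)

/-- The preferred generators: the vertex groups `G_v` and the sets `α_s(A_s) s`. -/
def gens : Set G :=
  {g | (∃ v ∈ M.verts, g ∈ MulAction.stabilizer G v) ∨
    ∃ s : t.SEdge, ∃ a ∈ s.group, g = a * s.elem}

/-! ### Interactive families -/

/-- The sets `P v = X_v`, `Z s = Z_s` form an interactive family for the action `ρ`, with the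
auxiliary subsets `Q e = X_{o(e)}^e` for `e` in the spanning tree. -/
structure IsInteractive (ρ : G →* HomeoPlus) (P : X → Set S1) (Q : M.TreeEdge → Set S1)
    (Z : t.SEdge → Set S1) : Prop where
  disjoint_PP : ∀ v ∈ M.verts, ∀ w ∈ M.verts, v ≠ w → Disjoint (P v) (P w)
  disjoint_ZZ : ∀ s s' : t.SEdge, s ≠ s' → Disjoint (Z s) (Z s')
  disjoint_PZ : ∀ v ∈ M.verts, ∀ s : t.SEdge, Disjoint (P v) (Z s)
  nonempty_Z : ∀ s : t.SEdge, (Z s).Nonempty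
  nonempty_P : ∀ v ∈ M.verts,
    (∃ e : t.Edge, e.origin = v ∧ MulAction.stabilizer G v ≠ e.group) → (P v).Nonempty
  letter_P : ∀ s : t.SEdge, ∀ v ∈ M.verts, img ρ s.elem (P v) ⊆ Z s
  letter_Z : ∀ s s' : t.SEdge, s' ≠ s.bar → img ρ s.elem (Z s') ⊆ Z s
  edgeGroup_Z : ∀ s : t.SEdge, ∀ a ∈ s.group, img ρ a (Z s) ⊆ Z s
  outer_Z : ∀ (s : t.SEdge) (g : G), s.toEdge.Outer g → img ρ g (Z s) ⊆ P s.origin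
  Q_subset : ∀ e : M.TreeEdge,
    MulAction.stabilizer G (t.ofTree e).origin ≠ (t.ofTree e).group →
      (Q e).Nonempty ∧ Q e ⊆ P (t.ofTree e).origin
  edgeGroup_Q : ∀ e : M.TreeEdge, ∀ a ∈ (t.ofTree e).group, img ρ a (Q e) ⊆ Q e
  outer_tree_P : ∀ (e : M.TreeEdge) (g : G), (t.ofTree e).Outer g →
    ∀ v ∈ M.verts, M.Beyond e v → img ρ g (P v) ⊆ Q e
  outer_tree_Z : ∀ (e : M.TreeEdge) (g : G), (t.ofTree e).Outer g →
    ∀ s : t.SEdge, M.Beyond e s.origin → img ρ g (Z s) ⊆ Q e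

/-- The additional conditions for an interactive family to be proper. The faithfulness on `Q e` is
asked only where the set `Q e` is prescribed, i.e. if `G_{o(e)} ≠ α_e(A_e)`. -/
structure IsProperFamily (ρ : G →* HomeoPlus) (P : X → Set S1) (Q : M.TreeEdge → Set S1)
    (Z : t.SEdge → Set S1) : Prop where
  faithful_Z : ∀ s : t.SEdge, ∀ a ∈ s.group,
    (∀ x ∈ Z s, (ρ a : S1 ≃ₜ S1) x = x) → a = 1
  faithful_Q : ∀ e : M.TreeEdge,
    MulAction.stabilizer G (t.ofTree e).origin ≠ (t.ofTree e).group →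
      ∀ a ∈ (t.ofTree e).group, (∀ x ∈ Q e, (ρ a : S1 ≃ₜ S1) x = x) → a = 1
  misses_point : (∃ v ∈ M.verts, (P v).Nonempty) → ∃ w ∈ M.verts, ∃ x ∈ P w,
    (∀ (s : t.SEdge) (g : G), s.origin = w → s.toEdge.Outer g → x ∉ img ρ g (Z s)) ∧
    (∀ (e : M.TreeEdge) (g : G), (t.ofTree e).origin = w → (t.ofTree e).Outer g →
      (∀ v ∈ M.verts, M.Beyond e v → x ∉ img ρ g (P v)) ∧
      (∀ s : t.SEdge, M.Beyond e s.origin → x ∉ img ρ g (Z s)))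
  degenerate : ∀ s : t.SEdge, (∀ s' : t.SEdge, s' = s ∨ s' = s.bar) →
    (∀ v ∈ M.verts, P v = ∅) →
      ∃ x : S1, x ∉ Z s ∧ x ∉ Z s.bar ∧
        (ρ s.elem : S1 ≃ₜ S1) x ∈ Z s ∧ (ρ s.bar.elem : S1 ≃ₜ S1) x ∈ Z s.bar

end TreeMarking.StableLetters

/-! ### Intervals and gaps -/

/-- The set of connected components of a subset of the circle. -/
def comps (A : Set S1) : Set (Set S1) := {I | ∃ x ∈ A, I = connectedComponentIn A x}

/-- The gaps of a collection of intervals. -/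
def gaps (𝓘 : Set (Set S1)) : Set (Set S1) := comps (⋃₀ 𝓘)ᶜ

/-- `K` is the union of the `m + 1` intervals in `A ⊆ 𝓘` and of the `m` gaps in `B`, for some
`m ≥ 1`. -/
def MarkovUnion (𝓘 : Set (Set S1)) (K : Set S1) (A B : Set (Set S1)) : Prop :=
  A ⊆ 𝓘 ∧ B ⊆ gaps 𝓘 ∧ (∃ m : ℕ, 1 ≤ m ∧ A.encard = (m : ℕ∞) + 1 ∧ B.encard = (m : ℕ∞)) ∧
    K = ⋃₀ A ∪ ⋃₀ B

/-- `K` is `𝓘`-Markovian. -/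
def Markovian (𝓘 : Set (Set S1)) (K : Set S1) : Prop := ∃ A B, MarkovUnion 𝓘 K A B

/-- The intervals `I₁, I₂, I₃` of the circle are in this (strict) cyclic order. -/
def CyclicallyOrdered (I₁ I₂ I₃ : Set S1) : Prop :=
  ∀ x ∈ I₁, ∀ y ∈ I₂, ∀ z ∈ I₃, sbtw x y z

/-- The closed arc `J` starts, in the positive direction, at the right endpoint of the open arc
`I`. -/
def FollowedBy (I J : Set S1) : Prop :=
  ∃ a b c : ℝ, a < b ∧ b ≤ c ∧ I = (fun x : ℝ => (x : S1)) '' Set.Ioo a b ∧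
    J = (fun x : ℝ => (x : S1)) '' Set.Icc b c

/-- The images `θ(J)`, `J ∈ B`, of gaps under a map `θ` of intervals: if `J` is the gap following
the interval `I` then `θ(J)` is the gap following `θ(I)`. -/
def gapImage (𝓘 𝓘' : Set (Set S1)) (θ : Set S1 → Set S1) (B : Set (Set S1)) : Set (Set S1) :=
  {J' | J' ∈ gaps 𝓘' ∧ ∃ J ∈ B, ∃ I ∈ 𝓘, FollowedBy I J ∧ FollowedBy (θ I) J'}

/-! ### Ping-pong partitions -/

/-- A family `Θ = {U_v^e, V_s}` of subsets of the circle; `U e` is `U_{o(e)}^e`. -/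
structure Family {G : Type*} [Group G] {X : Type*} [MulAction G X] {M : TreeMarking G X}
    (t : M.StableLetters) where
  U : t.Edge → Set S1
  V : t.SEdge → Set S1

namespace Family

variable {G : Type*} [Group G] {X : Type*} [MulAction G X] {M : TreeMarking G X}
  {t : M.StableLetters} (Θ : Family t)

/-- The atoms of `Θ`. -/
def atoms : Set (Set S1) := Set.range Θ.U ∪ Set.range Θ.V

/-- The set `U_v`, union of the `U_v^e` over the star of `v` in the quotient graph. -/
def UV (v : X) : Set S1 := ⋃ e : {e : t.Edge // e.origin = v}, Θ.U e.1

/-- The collection `𝓘` of connected components of the atoms of `Θ`. -/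
def intervals : Set (Set S1) := {I | ∃ O ∈ Θ.atoms, I ∈ comps O}

/-- `Θ` is a ping-pong partition for the action `ρ`. -/
structure IsPingPong (ρ : G →* HomeoPlus) : Prop where
  isOpen : ∀ O ∈ Θ.atoms, IsOpen O
  interactive : t.IsInteractive ρ Θ.UV (fun e => Θ.U (t.ofTree e)) Θ.V
  outer_V : ∀ (s : t.SEdge) (g : G), s.toEdge.Outer g → img ρ g (Θ.V s) ⊆ Θ.U s.toEdge
  edgeGroup_U : ∀ s : t.SEdge, ∀ a ∈ s.group, img ρ a (Θ.U s.toEdge) = Θ.U s.toEdge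
  disjoint_U : ∀ e e' : t.Edge, e.origin = e'.origin → e ≠ e' → Disjoint (Θ.U e) (Θ.U e')
  finite_comps : ∀ O ∈ Θ.atoms, (comps O).Finite
  markov : ∀ g ∈ t.gens, ∀ I ∈ Θ.intervals,
    (∃ O ∈ Θ.atoms, img ρ g I ⊆ O) ∨ Markovian Θ.intervals (img ρ g I)

/-- `Θ` is a proper ping-pong partition for the action `ρ`. -/
structure IsProperPingPong (ρ : G →* HomeoPlus) : Prop where
  isPingPong : Θ.IsPingPong ρ
  isProper : t.IsProperFamily ρ Θ.UV (fun e => Θ.U (t.ofTree e)) Θ.V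

/-- `θ : 𝓘 → 𝓘'` is a ping-pong equivalence. -/
structure IsEquivalence (ρ ρ' : G →* HomeoPlus) (Θ Θ' : Family t) (θ : Set S1 → Set S1) :
    Prop where
  bijOn : Set.BijOn θ Θ.intervals Θ'.intervals
  cyclic : ∀ I₁ ∈ Θ.intervals, ∀ I₂ ∈ Θ.intervals, ∀ I₃ ∈ Θ.intervals,
    CyclicallyOrdered I₁ I₂ I₃ → CyclicallyOrdered (θ I₁) (θ I₂) (θ I₃)
  inclusion : ∀ g ∈ t.gens, ∀ I₁ ∈ Θ.intervals, ∀ I₂ ∈ Θ.intervals,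
    img ρ g I₁ ⊆ I₂ → img ρ' g (θ I₁) ⊆ θ I₂
  equality : ∀ g ∈ t.gens, ∀ I₁ ∈ Θ.intervals, ∀ I₂ ∈ Θ.intervals,
    img ρ g I₁ = I₂ → img ρ' g (θ I₁) = θ I₂
  markov : ∀ g ∈ t.gens, ∀ I ∈ Θ.intervals, ∀ A B : Set (Set S1),
    MarkovUnion Θ.intervals (img ρ g I) A B →
      MarkovUnion Θ'.intervals (img ρ' g (θ I)) (θ '' A)
        (gapImage Θ.intervals Θ'.intervals θ B)

end Family

end PingPong

namespace PingPong

/-! ### The cyclic order of the circle -/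

/-! It is enough to match one orbit of `ρ₁` with one orbit of `ρ₂` by a well defined bijection
preserving the cyclic order: its lift to the line extends by a supremum to a semi-conjugacy
(`semiConjugate_of_orbit`). The partition has to provide the orbits and to determine their order.

The orbits come from a contracted arc. Some `w` maps an arc `I₀` of the first partition into itself
through a chain of inclusions between arcs, each made by a preferred generator, and for every `g`
such a chain leads from `I₀`, by `g * w ^ n` with `n` large, into one arc `c g`. The equivalence `θ`
transports chains, so the same holds for `ρ₂` with `θ I₀` and `θ (c g)`. The arcs `wⁿ(I₀)` are
nested, and `p` is the limit of their left endpoints (`exists_limit_point`). The itinerary `k ↦ c (k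
* g)` determines the point `g p`: elements with the itinerary of the identity fix both limit points,
all others move both.

Itineraries also determine the cyclic order (`eventually_sbtw`). Points in three distinct arcs are
ordered as these arcs are. For two points in the same arc, generators are applied until the images
fall in different arcs. Until then the order is transported (`before_act_iff`). At the separation
the image of the arc is Markovian, and the order of the arcs in a Markovian union is known from the
cyclic order and the gaps: the last arc is the only one whose following gap is not in the union
(`before_of_markovUnion`).

The element `w` comes from ping-pong on the tree (`exists_contracts_of_path`): reading `k` along the
path from `T` to `k • p` writes it as a chain of contractions. If some edge of the quotient is
outside the spanning tree, a power of a stable letter serves as `w`. Otherwise, either two vertices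
of `T` facing each other have groups larger than the groups of the edges between them at their ends,
and a power of a product `h * k` serves, or a largest vertex group is all of `G`, which is then
finite (`exists_vertexPair`). -/

theorem coe_eq_coe_iff {x y : ℝ} : (x : S1) = (y : S1) ↔ ∃ n : ℤ, y = x + n := by
  rw [← sub_eq_zero, ← AddCircle.coe_sub, AddCircle.coe_eq_zero_iff]
  constructor
  · rintro ⟨n, hn⟩
    refine ⟨-n, ?_⟩
    push_cast
    simp only [zsmul_eq_mul, mul_one] at hn
    linarith
  · rintro ⟨n, rfl⟩
    exact ⟨-n, by simp⟩

theorem coe_add_int (x : ℝ) (n : ℤ) : ((x + n : ℝ) : S1) = (x : S1) :=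
  (coe_eq_coe_iff.2 ⟨n, rfl⟩).symm

theorem exists_coe_Ico (a : ℝ) (x : S1) : ∃ t : ℝ, a ≤ t ∧ t < a + 1 ∧ (t : S1) = x := by
  have h : x ∈ ((↑) : ℝ → S1) '' Set.Ico a (a + 1) := by
    rw [AddCircle.coe_image_Ico_eq]; trivial
  obtain ⟨t, ht, rfl⟩ := h
  exact ⟨t, ht.1, ht.2, rfl⟩

theorem coe_injOn_Ico {a x y : ℝ} (hx : a ≤ x) (hx' : x < a + 1) (hy : a ≤ y) (hy' : y < a + 1)
    (h : (x : S1) = (y : S1)) : x = y := by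
  obtain ⟨n, rfl⟩ := coe_eq_coe_iff.1 h
  have h1 : (n : ℝ) < 1 := by linarith
  have h2 : (-1 : ℝ) < n := by linarith
  have h3 : n < 1 := by exact_mod_cast h1
  have h4 : -1 < n := by exact_mod_cast h2
  have : n = 0 := by omega
  simp [this]

theorem btw_coe_of_mem {a x y : ℝ} (hx : a ≤ x) (hx' : x < a + 1) (hy : a < y) (hy' : y ≤ a + 1) :
    btw (a : S1) (x : S1) (y : S1) ↔ x ≤ y := by
  have h := QuotientAddGroup.btw_coe_iff (p := (1 : ℝ)) (x₁ := a) (x₂ := x) (x₃ := y)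
  have e1 : toIcoMod (zero_lt_one : (0 : ℝ) < 1) a x = x :=
    (toIcoMod_eq_self _).2 ⟨hx, hx'⟩
  have e2 : toIocMod (zero_lt_one : (0 : ℝ) < 1) a y = y :=
    (toIocMod_eq_self _).2 ⟨hy, hy'⟩
  rw [e1, e2] at h
  exact h

theorem sbtw_coe_of_lt {x y z : ℝ} (h1 : x < y) (h2 : y < z) (h3 : z < x + 1) :
    sbtw (x : S1) (y : S1) (z : S1) := by
  rw [sbtw_iff_not_btw, btw_cyclic, btw_cyclic, btw_cyclic]
  intro h
  have h := h.cyclic_left.cyclic_left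
  rw [btw_coe_of_mem (by linarith) (by linarith) (by linarith) (by linarith)] at h
  linarith

theorem sbtw_coe_iff {a x y : ℝ} (hx : a ≤ x) (hx' : x < a + 1) (hy : a ≤ y) (hy' : y < a + 1) :
    sbtw (a : S1) (x : S1) (y : S1) ↔ a < x ∧ x < y := by
  constructor
  · intro h
    rcases hx.eq_or_lt with rfl | hx
    · exact absurd h sbtw_irrefl_left
    refine ⟨hx, ?_⟩
    by_contra hlt
    rcases (not_lt.1 hlt).eq_or_lt with rfl | h2
    · exact sbtw_irrefl_right h
    rcases hy.eq_or_lt with rfl | hy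
    · exact sbtw_irrefl_left_right h
    exact sbtw_asymm h (sbtw_coe_of_lt hy h2 hx').cyclic_left
  · rintro ⟨h1, h2⟩
    exact sbtw_coe_of_lt h1 h2 hy'

theorem sbtw_iff_exists {x y z : S1} :
    sbtw x y z ↔ ∃ a b c : ℝ, a < b ∧ b < c ∧ c < a + 1 ∧
      (a : S1) = x ∧ (b : S1) = y ∧ (c : S1) = z := by
  constructor
  · intro h
    obtain ⟨a, -, -, rfl⟩ := exists_coe_Ico 0 x
    obtain ⟨b, hb, hb', rfl⟩ := exists_coe_Ico a y
    obtain ⟨c, hc, hc', rfl⟩ := exists_coe_Ico a z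
    rw [sbtw_coe_iff hb hb' hc hc'] at h
    exact ⟨a, b, c, h.1, h.2, hc', rfl, rfl, rfl⟩
  · rintro ⟨a, b, c, h1, h2, h3, rfl, rfl, rfl⟩
    exact sbtw_coe_of_lt h1 h2 h3

theorem exists_lifts_of_sbtw {a : ℝ} {y z : S1} (h : sbtw (a : S1) y z) :
    ∃ b c : ℝ, a < b ∧ b < c ∧ c < a + 1 ∧ (b : S1) = y ∧ (c : S1) = z := by
  obtain ⟨b, hb, hb', rfl⟩ := exists_coe_Ico a y
  obtain ⟨c, hc, hc', rfl⟩ := exists_coe_Ico a z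
  rw [sbtw_coe_iff hb hb' hc hc'] at h
  exact ⟨b, c, h.1, h.2, hc', rfl, rfl⟩

theorem sbtw_ne {x y z : S1} (h : sbtw x y z) : x ≠ y ∧ y ≠ z ∧ x ≠ z := by
  refine ⟨?_, ?_, ?_⟩ <;> rintro rfl
  · exact sbtw_irrefl_left h
  · exact sbtw_irrefl_right h
  · exact sbtw_irrefl_left_right h

theorem sbtw_or_of_ne {x y z : S1} (h1 : x ≠ y) (h2 : y ≠ z) (h3 : x ≠ z) :
    sbtw x y z ∨ sbtw x z y := by
  by_contra h
  push Not at h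
  obtain ⟨h4, h5⟩ := h
  rw [← btw_iff_not_sbtw] at h4 h5
  rcases h4.antisymm h5.cyclic_right with h | h | h
  · exact h2 h.symm
  · exact h1 h.symm
  · exact h3 h

theorem isOpenMap_coe : IsOpenMap ((↑) : ℝ → S1) := QuotientAddGroup.isOpenMap_coe

theorem continuous_coe : Continuous ((↑) : ℝ → S1) := AddCircle.continuous_mk' 1

/-- The set is the image of an open subset of `ℝ³` under the open quotient map. -/
theorem isOpen_sbtw : IsOpen {p : S1 × S1 × S1 | sbtw p.1 p.2.1 p.2.2} := by
  have h : {p : S1 × S1 × S1 | sbtw p.1 p.2.1 p.2.2} =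
      (Prod.map ((↑) : ℝ → S1) (Prod.map ((↑) : ℝ → S1) ((↑) : ℝ → S1))) ''
        {q : ℝ × ℝ × ℝ | q.1 < q.2.1 ∧ q.2.1 < q.2.2 ∧ q.2.2 < q.1 + 1} := by
    ext ⟨x, y, z⟩
    simp only [Set.mem_ofPred_eq, Set.mem_image, Prod.exists, sbtw_iff_exists]
    constructor
    · rintro ⟨a, b, c, h1, h2, h3, rfl, rfl, rfl⟩
      exact ⟨a, b, c, ⟨h1, h2, h3⟩, rfl⟩
    · rintro ⟨a, b, c, ⟨h1, h2, h3⟩, h⟩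
      simp only [Prod.map_apply, Prod.mk.injEq] at h
      exact ⟨a, b, c, h1, h2, h3, h.1, h.2.1, h.2.2⟩
  rw [h]
  refine (isOpenMap_coe.prodMap (isOpenMap_coe.prodMap isOpenMap_coe)) _ ?_
  have c1 : Continuous fun q : ℝ × ℝ × ℝ => q.1 := continuous_fst
  have c2 : Continuous fun q : ℝ × ℝ × ℝ => q.2.1 := continuous_fst.comp continuous_snd
  have c3 : Continuous fun q : ℝ × ℝ × ℝ => q.2.2 := continuous_snd.comp continuous_snd
  exact (isOpen_lt c1 c2).inter ((isOpen_lt c2 c3).inter (isOpen_lt c3 (c1.add_const 1)))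

theorem isOpen_cIoo (a b : S1) : IsOpen (Set.cIoo a b) :=
  isOpen_sbtw.preimage (f := fun x : S1 => (a, x, b)) (by fun_prop)

/-- Points of the closures of three sets realise a triple that is also realised in the sets. -/
theorem exists_sbtw_of_mem_closure {A B C : Set S1} {a b c : S1} (ha : a ∈ closure A)
    (hb : b ∈ closure B) (hc : c ∈ closure C) (h : sbtw a b c) :
    ∃ x ∈ A, ∃ y ∈ B, ∃ z ∈ C, sbtw x y z := by
  have hmem : ((a, b, c) : S1 × S1 × S1) ∈ closure (A ×ˢ B ×ˢ C) := by
    rw [closure_prod_eq, closure_prod_eq]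
    exact ⟨ha, hb, hc⟩
  obtain ⟨⟨x, y, z⟩, h1, h2⟩ := mem_closure_iff.1 hmem _ isOpen_sbtw h
  exact ⟨x, h2.1, y, h2.2.1, z, h2.2.2, h1⟩

/-! ### Connected subsets of the circle -/

/-- The two open arcs between `a` and `b` are disjoint and cover the circle minus these points, so a
connected set avoiding both points lies in one of them. -/
theorem _root_.IsPreconnected.subset_cIoo {P : Set S1} (hP : IsPreconnected P) {a b x : S1}
    (ha : a ∉ P) (hb : b ∉ P) (hx : x ∈ P) (h : sbtw a x b) : ∀ y ∈ P, sbtw a y b := by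
  have hab := (sbtw_ne h).2.2
  have := hP.subset_left_of_subset_union (isOpen_cIoo a b) (isOpen_cIoo b a) ?_ ?_ ⟨x, hx, h⟩
  · exact fun y hy => this hy
  · rw [Set.disjoint_left]
    exact fun y h1 h2 => sbtw_asymm (a := a) (b := y) (c := b) h1 h2
  · intro y hy
    rcases sbtw_or_of_ne (x := a) (y := y) (z := b) (fun h => ha (h ▸ hy)) (fun h => hb (h ▸ hy))
      hab with h | h
    · exact Or.inl h
    · exact Or.inr h.cyclic_left

theorem sbtw_of_sbtw_right {P Q : Set S1} (hP : IsPreconnected P) (hQ : IsPreconnected Q)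
    (hPQ : Disjoint P Q) {z : S1} (hzP : z ∉ P) (hzQ : z ∉ Q) {x x' y y' : S1} (hx : x ∈ P)
    (hx' : x' ∈ P) (hy : y ∈ Q) (hy' : y' ∈ Q) (h : sbtw z x y) : sbtw z x' y' := by
  have h1 : sbtw z x' y := hP.subset_cIoo hzP (fun h => Set.disjoint_left.1 hPQ h hy) hx h x' hx'
  exact (hQ.subset_cIoo (fun h => Set.disjoint_left.1 hPQ hx' h) hzQ hy h1.cyclic_left y'
    hy').cyclic_right

theorem cyclicallyOrdered_of_sbtw {P Q R : Set S1} (hP : IsPreconnected P) (hQ : IsPreconnected Q)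
    (hR : IsPreconnected R) (hPQ : Disjoint P Q) (hQR : Disjoint Q R) (hPR : Disjoint P R)
    {x y z : S1} (hx : x ∈ P) (hy : y ∈ Q) (hz : z ∈ R) (h : sbtw x y z) :
    CyclicallyOrdered P Q R := by
  intro x' hx' y' hy' z' hz'
  have h1 : sbtw z x' y' := sbtw_of_sbtw_right hP hQ hPQ
    (fun h => Set.disjoint_left.1 hPR h hz) (fun h => Set.disjoint_left.1 hQR h hz)
    hx hx' hy hy' h.cyclic_right
  exact (hR.subset_cIoo (fun h => Set.disjoint_left.1 hQR hy' h)
    (fun h => Set.disjoint_left.1 hPR hx' h) hz h1.cyclic_right z'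
    hz').cyclic_right

/-- The linear order of a proper connected subset of the circle: `x` comes before `y` in `K`. -/
def Before (K : Set S1) (x y : S1) : Prop := ∃ z, z ∉ K ∧ sbtw z x y

/-- The order does not depend on the cut point: two cut points giving opposite answers would have
`x` and `y` on different sides, against the connectedness of `K`. -/
theorem before_iff {K : Set S1} (hK : IsPreconnected K) {x y z : S1} (hx : x ∈ K) (hy : y ∈ K)
    (hz : z ∉ K) : Before K x y ↔ sbtw z x y := by
  refine ⟨?_, fun h => ⟨z, hz, h⟩⟩
  rintro ⟨z', hz', h⟩
  rcases sbtw_or_of_ne (x := z) (y := x) (z := y) (fun h => hz (h ▸ hx)) (sbtw_ne h).2.1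
    (fun h => hz (h ▸ hy)) with h1 | h1
  · exact h1
  exfalso
  by_cases hzz : z = z'
  · subst hzz
    exact sbtw_asymm h h1.cyclic_left
  -- `x` and `y` are on different sides of `z, z'`
  have h2 : sbtw z y z' := by
    have : sbtw y z' x := h.cyclic_right
    have h3 : sbtw y x z := h1.cyclic_left
    exact (sbtw_trans_right this h3).cyclic_right
  have h4 := hK.subset_cIoo hz hz' hy h2 x hx
  have h5 : sbtw z' x z := by
    have a1 : sbtw x y z' := h.cyclic_left
    have a2 : sbtw x z y := h1.cyclic_right
    exact (sbtw_trans_right a2 a1).cyclic_right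
  exact sbtw_asymm h4 h5

theorem Before.mono {P K : Set S1} (hP : IsPreconnected P) (hK : IsPreconnected K) (hKu : K ≠ Set.univ)
    (hPK : P ⊆ K) {x y : S1} (hx : x ∈ P) (hy : y ∈ P) : Before P x y ↔ Before K x y := by
  obtain ⟨z, hz⟩ := (Set.ne_univ_iff_exists_notMem _).1 hKu
  rw [before_iff hP hx hy (fun h => hz (hPK h)), before_iff hK (hPK hx) (hPK hy) hz]

theorem Before.asymm {K : Set S1} (hK : IsPreconnected K) {x y : S1} (hx : x ∈ K) (hy : y ∈ K)
    (h : Before K x y) : ¬ Before K y x := by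
  intro h'
  obtain ⟨z, hz, h⟩ := h
  rw [before_iff hK hy hx hz] at h'
  exact sbtw_asymm h h'.cyclic_left

/-- The cyclic order of three points in terms of the linear order of the complement of `z`. -/
theorem sbtw_iff_of_ne {z x y t : S1} (hx : z ≠ x) (hy : z ≠ y) (ht : z ≠ t) :
    sbtw x y t ↔ (sbtw z x y ∧ sbtw z y t) ∨ (sbtw z y t ∧ sbtw z t x) ∨
      (sbtw z t x ∧ sbtw z x y) := by
  have key : ∀ {x y t : S1}, sbtw z x y → sbtw z y t → sbtw x y t := fun h1 h2 =>
    (sbtw_trans_right h2.cyclic_left h1.cyclic_right).cyclic_right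
  constructor
  · intro h
    obtain ⟨n1, n2, n3⟩ := sbtw_ne h
    rcases sbtw_or_of_ne hx n1 hy with h1 | h1 <;> rcases sbtw_or_of_ne hy n2 ht with h2 | h2 <;>
      rcases sbtw_or_of_ne ht n3.symm hx with h3 | h3
    · exact Or.inl ⟨h1, h2⟩
    · exact Or.inl ⟨h1, h2⟩
    · exact Or.inr (Or.inr ⟨h3, h1⟩)
    · exact absurd (key h3 h2) fun h' => sbtw_asymm h h'.cyclic_left
    · exact Or.inr (Or.inl ⟨h2, h3⟩)
    · exact absurd (key h1 h3) fun h' => sbtw_asymm h h'.cyclic_right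
    · exact absurd (key h2 h1) fun h' => sbtw_asymm h h'
    · exact absurd (key h2 h1) fun h' => sbtw_asymm h h'
  · rintro (⟨h1, h2⟩ | ⟨h1, h2⟩ | ⟨h1, h2⟩)
    · exact key h1 h2
    · exact (key h1 h2).cyclic_right
    · exact (key h1 h2).cyclic_left

/-! ### Arcs as images of real intervals -/

/-- If `t` were outside `K`, then `t` and `z` would separate `x` from `y`. -/
theorem arc_subset_of_lt {K : Set S1} (hK : IsPreconnected K) {x y z : ℝ} (hxy : x < y) (hyz : y < z)
    (hz1 : z < x + 1) (hx : (x : S1) ∈ K) (hy : (y : S1) ∈ K) (hz : (z : S1) ∉ K) {t : ℝ}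
    (ht : x ≤ t) (ht' : t ≤ y) : (t : S1) ∈ K := by
  rcases ht.eq_or_lt with rfl | ht
  · exact hx
  rcases ht'.eq_or_lt with rfl | ht'
  · exact hy
  by_contra hn
  have h1 : sbtw (t : S1) (y : S1) (z : S1) := sbtw_coe_of_lt ht' hyz (by linarith)
  have h2 := hK.subset_cIoo hn hz hy h1 _ hx
  exact sbtw_asymm h2 (sbtw_coe_of_lt ht (by linarith) hz1).cyclic_right

theorem sbtw_of_arc_subset {K : Set S1} {x y : ℝ} (hxy : x < y)
    (h : ∀ t, x ≤ t → t ≤ y → (t : S1) ∈ K) {z : S1} (hz : z ∉ K) :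
    sbtw (x : S1) (y : S1) z := by
  obtain ⟨t, ht, ht', rfl⟩ := exists_coe_Ico x z
  refine sbtw_coe_of_lt hxy ?_ ht'
  by_contra hn
  exact hz (h t ht (not_lt.1 hn))

/-- The set of lifts of `K` between two consecutive lifts of a point outside of `K`. -/
theorem exists_lift_set {K : Set S1} (hK : IsPreconnected K) (hKn : K.Nonempty) {z : ℝ}
    (hz : (z : S1) ∉ K) :
    ∃ D : Set ℝ, D = Set.Ioo z (z + 1) ∩ ((↑) : ℝ → S1) ⁻¹' K ∧ D.OrdConnected ∧ D.Nonempty ∧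
      ((↑) : ℝ → S1) '' D = K := by
  have himg : ∀ x ∈ K, ∃ t ∈ Set.Ioo z (z + 1), (t : S1) = x := by
    intro x hx
    obtain ⟨t, ht, ht', rfl⟩ := exists_coe_Ico z x
    refine ⟨t, ⟨lt_of_le_of_ne ht ?_, ht'⟩, rfl⟩
    rintro rfl
    exact hz hx
  refine ⟨_, rfl, ⟨?_⟩, ?_, ?_⟩
  · rintro x ⟨hx, hxK⟩ y ⟨hy, hyK⟩ t ⟨h1, h2⟩
    refine ⟨⟨hx.1.trans_le h1, h2.trans_lt hy.2⟩, ?_⟩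
    rcases (h1.trans h2).eq_or_lt with h | h
    · have : t = x := le_antisymm (h ▸ h2) h1
      rw [this]; exact hxK
    · refine arc_subset_of_lt hK h hy.2 (by linarith [hx.1]) hxK hyK ?_ h1 h2
      have := coe_add_int z 1
      rw [Int.cast_one] at this
      rwa [this]
  · obtain ⟨x, hx⟩ := hKn
    obtain ⟨t, ht, rfl⟩ := himg x hx
    exact ⟨t, ht, hx⟩
  · ext x
    constructor
    · rintro ⟨t, ht, rfl⟩
      exact ht.2
    · intro hx
      obtain ⟨t, ht, rfl⟩ := himg x hx
      exact ⟨t, ⟨ht, hx⟩, rfl⟩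

theorem exists_coe_eq (x : S1) : ∃ t : ℝ, (t : S1) = x := by
  obtain ⟨t, -, -, h⟩ := exists_coe_Ico 0 x
  exact ⟨t, h⟩

/-- The arc is lifted between two consecutive lifts of a point outside it, hence the length at most
1. Length exactly 1 is allowed: it is the complement of a point. -/
theorem exists_eq_image_Ioo {I : Set S1} (hI : IsPreconnected I) (hIo : IsOpen I)
    (hIn : I.Nonempty) (hIu : I ≠ Set.univ) :
    ∃ a b : ℝ, a < b ∧ b ≤ a + 1 ∧ I = ((↑) : ℝ → S1) '' Set.Ioo a b := by
  obtain ⟨z, hz⟩ := (Set.ne_univ_iff_exists_notMem _).1 hIu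
  obtain ⟨z, rfl⟩ := exists_coe_eq z
  obtain ⟨D, hD, hDo, hDn, himg⟩ := exists_lift_set hI hIn hz
  have hopen : IsOpen D := by
    rw [hD]
    exact isOpen_Ioo.inter (hIo.preimage continuous_coe)
  have hbb : BddBelow D := ⟨z, fun x hx => by rw [hD] at hx; exact hx.1.1.le⟩
  have hba : BddAbove D := ⟨z + 1, fun x hx => by rw [hD] at hx; exact hx.1.2.le⟩
  have hlow : z ≤ sInf D := le_csInf hDn fun x hx => by rw [hD] at hx; exact hx.1.1.le
  have hup : sSup D ≤ z + 1 := csSup_le hDn fun x hx => by rw [hD] at hx; exact hx.1.2.le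
  have hsub : D ⊆ Set.Ioo (sInf D) (sSup D) := by
    intro x hx
    obtain ⟨ε, hε, hball⟩ := Metric.isOpen_iff.1 hopen x hx
    constructor
    · refine lt_of_le_of_lt (csInf_le hbb (hball (?_ : x - ε / 2 ∈ _))) (by linarith)
      rw [Metric.mem_ball, Real.dist_eq, abs_lt]; constructor <;> linarith
    · refine lt_of_lt_of_le ?_ (le_csSup hba (hball (?_ : x + ε / 2 ∈ _)))
      · linarith
      rw [Metric.mem_ball, Real.dist_eq, abs_lt]; constructor <;> linarith
  have heq : D = Set.Ioo (sInf D) (sSup D) :=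
    hsub.antisymm (IsConnected.Ioo_csInf_csSup_subset ⟨hDn, hDo.isPreconnected⟩ hbb hba)
  obtain ⟨x, hx⟩ := hDn
  refine ⟨sInf D, sSup D, ?_, by linarith, by rw [← heq, himg]⟩
  have := hsub hx
  exact this.1.trans this.2

theorem exists_eq_image_Icc {J : Set S1} (hJ : IsPreconnected J) (hJc : IsClosed J)
    (hJn : J.Nonempty) (hJu : J ≠ Set.univ) :
    ∃ b c : ℝ, b ≤ c ∧ J = ((↑) : ℝ → S1) '' Set.Icc b c := by
  obtain ⟨z, hz⟩ := (Set.ne_univ_iff_exists_notMem _).1 hJu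
  obtain ⟨z, rfl⟩ := exists_coe_eq z
  obtain ⟨D, hD, hDo, hDn, himg⟩ := exists_lift_set hJ hJn hz
  have hz1 : ((z + 1 : ℝ) : S1) ∉ J := by
    have := coe_add_int z 1
    rw [Int.cast_one] at this
    rwa [this]
  have hD' : D = Set.Icc z (z + 1) ∩ ((↑) : ℝ → S1) ⁻¹' J := by
    rw [hD]
    ext x
    constructor
    · exact fun h => ⟨⟨h.1.1.le, h.1.2.le⟩, h.2⟩
    · rintro ⟨h1, h2⟩
      refine ⟨⟨lt_of_le_of_ne h1.1 ?_, lt_of_le_of_ne h1.2 ?_⟩, h2⟩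
      · rintro rfl; exact hz h2
      · rintro rfl; exact hz1 h2
  have hcomp : IsCompact D := by
    rw [hD']
    exact isCompact_Icc.inter_right (hJc.preimage continuous_coe)
  have := eq_Icc_of_connected_compact ⟨hDn, hDo.isPreconnected⟩ hcomp
  refine ⟨sInf D, sSup D, ?_, by rw [← this, himg]⟩
  rw [this] at hDn
  exact Set.nonempty_Icc.1 hDn

theorem coe_notMem_image_Ioo_right {a b : ℝ} (hb : b ≤ a + 1) :
    (b : S1) ∉ ((↑) : ℝ → S1) '' Set.Ioo a b := by
  rintro ⟨d, ⟨h1, h2⟩, h⟩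
  have := coe_injOn_Ico (a := d) le_rfl (by linarith) h2.le (by linarith) h
  linarith

theorem coe_notMem_image_Ioo_left {a b : ℝ} (hb : b ≤ a + 1) :
    (a : S1) ∉ ((↑) : ℝ → S1) '' Set.Ioo a b := by
  rintro ⟨d, ⟨h1, h2⟩, h⟩
  have := coe_injOn_Ico (a := a) h1.le (by linarith) le_rfl (by linarith) h
  linarith

/-- An arc contained in an arc has a lift contained in the lift of the latter. -/
theorem exists_int_of_image_subset {a b a' b' : ℝ} (hb : b ≤ a + 1) (h' : a' < b')
    (h : ((↑) : ℝ → S1) '' Set.Ioo a' b' ⊆ ((↑) : ℝ → S1) '' Set.Ioo a b) :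
    ∃ n : ℤ, a ≤ a' + n ∧ b' + n ≤ b := by
  obtain ⟨m, hm1, hm2⟩ := exists_between h'
  obtain ⟨d, hd, hde⟩ := h ⟨m, ⟨hm1, hm2⟩, rfl⟩
  obtain ⟨n, hn⟩ := coe_eq_coe_iff.1 hde.symm
  refine ⟨n, ?_, ?_⟩
  · by_contra hlt
    push Not at hlt
    refine coe_notMem_image_Ioo_left hb (h ⟨a - n, ⟨by linarith, by linarith [hd.1]⟩, ?_⟩)
    exact coe_eq_coe_iff.2 ⟨n, by ring⟩
  · by_contra hlt
    push Not at hlt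
    refine coe_notMem_image_Ioo_right hb (h ⟨b - n, ⟨by linarith [hd.2], by linarith⟩, ?_⟩)
    exact coe_eq_coe_iff.2 ⟨n, by ring⟩

end PingPong

namespace PingPong

universe u

/-! ### The action on points -/

section Act

variable {G : Type*} [Group G] (ρ : G →* HomeoPlus)

/-- The action of `G` on the points of the circle through `ρ`. -/
def act (g : G) (x : S1) : S1 := (ρ g : S1 ≃ₜ S1) x

theorem act_one (x : S1) : act ρ 1 x = x := by
  simp only [act, map_one]
  rfl

theorem act_mul (g k : G) (x : S1) : act ρ (g * k) x = act ρ g (act ρ k x) := by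
  simp only [act, map_mul]
  rfl

theorem act_inv_act (g : G) (x : S1) : act ρ g⁻¹ (act ρ g x) = x := by
  rw [← act_mul, inv_mul_cancel, act_one]

theorem act_act_inv (g : G) (x : S1) : act ρ g (act ρ g⁻¹ x) = x := by
  rw [← act_mul, mul_inv_cancel, act_one]

theorem act_injective (g : G) : Function.Injective (act ρ g) := fun x y h => by
  rw [← act_inv_act ρ g x, h, act_inv_act]

theorem continuous_act (g : G) : Continuous (act ρ g) := (ρ g : S1 ≃ₜ S1).continuous

theorem mem_img {g : G} {A : Set S1} {x : S1} : x ∈ img ρ g A ↔ ∃ y ∈ A, act ρ g y = x := Iff.rfl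

theorem act_mem_img {g : G} {A : Set S1} {x : S1} (hx : x ∈ A) : act ρ g x ∈ img ρ g A :=
  ⟨x, hx, rfl⟩

theorem act_mem_img_iff {g : G} {A : Set S1} {x : S1} : act ρ g x ∈ img ρ g A ↔ x ∈ A :=
  ⟨fun ⟨_, hy, h⟩ => act_injective ρ g h ▸ hy, act_mem_img ρ⟩

theorem img_one (A : Set S1) : img ρ 1 A = A := by
  ext x
  simp [mem_img, act_one]

theorem img_mul (g k : G) (A : Set S1) : img ρ (g * k) A = img ρ g (img ρ k A) := by
  ext x
  simp [mem_img, act_mul]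

theorem img_mono (g : G) {A B : Set S1} (h : A ⊆ B) : img ρ g A ⊆ img ρ g B :=
  Set.image_mono h

theorem img_ne_univ (g : G) {A : Set S1} (h : A ≠ Set.univ) : img ρ g A ≠ Set.univ := by
  obtain ⟨z, hz⟩ := (Set.ne_univ_iff_exists_notMem _).1 h
  exact (Set.ne_univ_iff_exists_notMem _).2 ⟨act ρ g z, fun h' => hz ((act_mem_img_iff ρ).1 h')⟩

theorem isOpen_img (g : G) {A : Set S1} (h : IsOpen A) : IsOpen (img ρ g A) :=
  (ρ g : S1 ≃ₜ S1).isOpenMap _ h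

theorem isPreconnected_img (g : G) {A : Set S1} (h : IsPreconnected A) :
    IsPreconnected (img ρ g A) :=
  h.image _ (continuous_act ρ g).continuousOn

theorem act_mem_closure_img (g : G) {A : Set S1} {x : S1} (h : x ∈ closure A) :
    act ρ g x ∈ closure (img ρ g A) :=
  image_closure_subset_closure_image (continuous_act ρ g) ⟨x, h, rfl⟩

theorem exists_isLift (g : G) : ∃ F : CircleDeg1Liftˣ, IsLift F (ρ g : S1 ≃ₜ S1) := (ρ g).2

theorem units_strictMono (F : CircleDeg1Liftˣ) : StrictMono F :=
  (CircleDeg1Lift.toOrderIso F).strictMono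

theorem units_lt_iff (F : CircleDeg1Liftˣ) {x y : ℝ} : F x < F y ↔ x < y :=
  (CircleDeg1Lift.toOrderIso F).lt_iff_lt

theorem units_le_iff (F : CircleDeg1Liftˣ) {x y : ℝ} : F x ≤ F y ↔ x ≤ y :=
  (CircleDeg1Lift.toOrderIso F).le_iff_le

variable {ρ}

theorem IsLift.act_coe {F : CircleDeg1Liftˣ} {g : G} (hF : IsLift F (ρ g : S1 ≃ₜ S1)) (x : ℝ) :
    act ρ g (x : S1) = ((F x : ℝ) : S1) := hF x

theorem IsLift.mul {F F' : CircleDeg1Liftˣ} {g g' : G} (hF : IsLift F (ρ g : S1 ≃ₜ S1))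
    (hF' : IsLift F' (ρ g' : S1 ≃ₜ S1)) : IsLift (F * F') (ρ (g * g') : S1 ≃ₜ S1) := fun x =>
  show act ρ (g * g') x = _ by
    rw [act_mul, hF'.act_coe, hF.act_coe]; rfl

theorem IsLift.one : IsLift 1 (ρ 1 : S1 ≃ₜ S1) := fun x =>
  show act ρ 1 x = _ by rw [act_one]; rfl

theorem IsLift.inv {F : CircleDeg1Liftˣ} {g : G} (hF : IsLift F (ρ g : S1 ≃ₜ S1)) :
    IsLift F⁻¹ (ρ g⁻¹ : S1 ≃ₜ S1) := fun x =>
  show act ρ g⁻¹ x = _ by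
    apply act_injective ρ g
    rw [act_act_inv, hF.act_coe]
    congr 1
    exact (CircleDeg1Lift.units_apply_inv_apply F x).symm

theorem IsLift.pow {F : CircleDeg1Liftˣ} {g : G} (hF : IsLift F (ρ g : S1 ≃ₜ S1)) (n : ℕ) :
    IsLift (F ^ n) (ρ (g ^ n) : S1 ≃ₜ S1) := by
  induction n with
  | zero => rw [pow_zero, pow_zero]; exact IsLift.one
  | succ n ih => rw [pow_succ, pow_succ]; exact ih.mul hF

theorem translate_apply' (n : ℤ) (x : ℝ) :
    (CircleDeg1Lift.translate (Multiplicative.ofAdd (n : ℝ)) : CircleDeg1Lift) x = x + n := by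
  rw [CircleDeg1Lift.translate_apply, add_comm]

theorem IsLift.translate_mul {F : CircleDeg1Liftˣ} {g : G} (hF : IsLift F (ρ g : S1 ≃ₜ S1))
    (n : ℤ) :
    IsLift (CircleDeg1Lift.translate (Multiplicative.ofAdd (n : ℝ)) * F) (ρ g : S1 ≃ₜ S1) := by
  intro x
  rw [Units.val_mul, CircleDeg1Lift.mul_apply, translate_apply', coe_add_int]
  exact hF x

/-- The displacement is an integer at every point; monotonicity makes it constant on `[0, 1)`, and
periodicity does the rest. -/
theorem isLift_one_iff {F : CircleDeg1Liftˣ} : IsLift F (ρ 1 : S1 ≃ₜ S1) ↔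
    ∃ n : ℤ, F = CircleDeg1Lift.translate (Multiplicative.ofAdd (n : ℝ)) := by
  constructor
  · intro hF
    have h : ∀ x : ℝ, ∃ n : ℤ, F x = x + n := fun x =>
      coe_eq_coe_iff.1 (by rw [← hF.act_coe, act_one])
    obtain ⟨n, hn⟩ := h 0
    refine ⟨n, ?_⟩
    have key : ∀ x : ℝ, 0 ≤ x → x < 1 → F x = x + n := by
      intro x hx hx'
      obtain ⟨m, hm⟩ := h x
      rcases hx.eq_or_lt with rfl | hx
      · exact hn
      have h1 : F 0 < F x := (units_lt_iff F).2 hx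
      have h2 : F x < F 0 + 1 := by
        have := (units_lt_iff F).2 hx'
        rwa [← zero_add (1 : ℝ), CircleDeg1Lift.map_add_one] at this
      rw [hn, hm] at h1 h2
      have h3 : (n : ℝ) < m + 1 := by linarith
      have h4 : (m : ℝ) < n + 1 := by linarith
      have h5 : n < m + 1 := by exact_mod_cast h3
      have h6 : m < n + 1 := by exact_mod_cast h4
      have : m = n := by omega
      rw [hm, this]
    ext x
    rw [translate_apply']
    have h1 := key (Int.fract x) (Int.fract_nonneg x) (Int.fract_lt_one x)
    have h2 := (F : CircleDeg1Lift).map_add_int (Int.fract x) ⌊x⌋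
    rw [Int.fract_add_floor, h1] at h2
    linarith [Int.fract_add_floor x]
  · rintro ⟨n, rfl⟩
    have := IsLift.translate_mul (IsLift.one (ρ := ρ)) n
    rwa [mul_one] at this

theorem sbtw_act_of_sbtw (g : G) {x y z : S1} (h : sbtw x y z) :
    sbtw (act ρ g x) (act ρ g y) (act ρ g z) := by
  obtain ⟨F, hF⟩ := exists_isLift ρ g
  obtain ⟨a, b, c, h1, h2, h3, rfl, rfl, rfl⟩ := sbtw_iff_exists.1 h
  rw [hF.act_coe, hF.act_coe, hF.act_coe]
  refine sbtw_coe_of_lt ((units_lt_iff F).2 h1) ((units_lt_iff F).2 h2) ?_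
  rw [← CircleDeg1Lift.map_add_one]
  exact (units_lt_iff F).2 h3

theorem sbtw_act (g : G) {x y z : S1} :
    sbtw (act ρ g x) (act ρ g y) (act ρ g z) ↔ sbtw x y z := by
  refine ⟨fun h => ?_, sbtw_act_of_sbtw g⟩
  have := sbtw_act_of_sbtw (ρ := ρ) g⁻¹ h
  rwa [act_inv_act, act_inv_act, act_inv_act] at this

theorem before_img (g : G) {K : Set S1} {x y : S1} :
    Before (img ρ g K) (act ρ g x) (act ρ g y) ↔ Before K x y := by
  constructor
  · rintro ⟨z, hz, h⟩
    refine ⟨act ρ g⁻¹ z, fun h' => hz ?_, ?_⟩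
    · rw [← act_act_inv ρ g z]
      exact act_mem_img ρ h'
    · rw [← sbtw_act (ρ := ρ) g, act_act_inv]
      exact h
  · rintro ⟨z, hz, h⟩
    exact ⟨act ρ g z, fun h' => hz ((act_mem_img_iff ρ).1 h'), (sbtw_act g).2 h⟩

end Act

/-! ### Semi-conjugacies from maps and from orbits -/

/-- The central extension is the group of triples `(g, F₁, F₂)` of lifts intertwined by `h`. Over `g
= 1` both lifts are translations, and since `h` commutes with integer translations they are by the
same integer, so the kernel is `ℤ`. -/
theorem semiConjugate_of_map {G : Type u} [Group G] {ρ₁ ρ₂ : G →* HomeoPlus} (h : CircleDeg1Lift)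
    (H : ∀ g : G, ∃ F₁ F₂ : CircleDeg1Liftˣ, IsLift F₁ (ρ₁ g : S1 ≃ₜ S1) ∧
      IsLift F₂ (ρ₂ g : S1 ≃ₜ S1) ∧ ∀ x : ℝ, h (F₁ x) = F₂ (h x)) :
    SemiConjugate ρ₁ ρ₂ := by
  let K : Subgroup (G × CircleDeg1Liftˣ × CircleDeg1Liftˣ) :=
    { carrier := {k | IsLift k.2.1 (ρ₁ k.1 : S1 ≃ₜ S1) ∧ IsLift k.2.2 (ρ₂ k.1 : S1 ≃ₜ S1) ∧
        ∀ x : ℝ, h (k.2.1 x) = k.2.2 (h x)}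
      one_mem' := ⟨IsLift.one, IsLift.one, fun _ => rfl⟩
      mul_mem' := by
        rintro ⟨g, F₁, F₂⟩ ⟨g', F₁', F₂'⟩ ⟨h1, h2, h3⟩ ⟨h1', h2', h3'⟩
        refine ⟨h1.mul h1', h2.mul h2', fun x => ?_⟩
        show h (F₁ (F₁' x)) = F₂ (F₂' (h x))
        rw [← h3', ← h3]
      inv_mem' := by
        rintro ⟨g, F₁, F₂⟩ ⟨h1, h2, h3⟩
        refine ⟨h1.inv, h2.inv, fun x => ?_⟩
        show h ((F₁⁻¹ : CircleDeg1Liftˣ) x) = (F₂⁻¹ : CircleDeg1Liftˣ) (h x)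
        apply (units_strictMono F₂).injective
        rw [CircleDeg1Lift.units_apply_inv_apply, ← h3, CircleDeg1Lift.units_apply_inv_apply] }
  let τ : Multiplicative ℤ →* CircleDeg1Liftˣ :=
    CircleDeg1Lift.translate.comp (AddMonoidHom.toMultiplicative (Int.castAddHom ℝ))
  have hτ : ∀ n : ℤ, τ (Multiplicative.ofAdd n) =
      CircleDeg1Lift.translate (Multiplicative.ofAdd (n : ℝ)) := fun n => rfl
  let ι : Multiplicative ℤ →* K :=
    (((1 : Multiplicative ℤ →* G).prod (τ.prod τ)).codRestrict K fun n => by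
      refine ⟨isLift_one_iff.2 ⟨n.toAdd, rfl⟩, isLift_one_iff.2 ⟨n.toAdd, rfl⟩, fun x => ?_⟩
      show h ((CircleDeg1Lift.translate (Multiplicative.ofAdd ((n.toAdd : ℤ) : ℝ)) :
        CircleDeg1Lift) x) = (CircleDeg1Lift.translate
          (Multiplicative.ofAdd ((n.toAdd : ℤ) : ℝ)) : CircleDeg1Lift) (h x)
      rw [translate_apply', translate_apply', CircleDeg1Lift.map_add_int])
  let π : K →* G := (MonoidHom.fst _ _).comp K.subtype
  let R₁ : K →* CircleDeg1Liftˣ := ((MonoidHom.fst _ _).comp (MonoidHom.snd _ _)).comp K.subtype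
  let R₂ : K →* CircleDeg1Liftˣ := ((MonoidHom.snd _ _).comp (MonoidHom.snd _ _)).comp K.subtype
  have hιval : ∀ n : ℤ, ((ι (Multiplicative.ofAdd n) : K) : G × CircleDeg1Liftˣ × CircleDeg1Liftˣ) =
      (1, CircleDeg1Lift.translate (Multiplicative.ofAdd (n : ℝ)),
        CircleDeg1Lift.translate (Multiplicative.ofAdd (n : ℝ))) := fun n => rfl
  refine ⟨K, inferInstance, ι, π, R₁, R₂, h, ⟨?_, ?_, ?_, ?_⟩, fun n => rfl, fun n => rfl,
    fun k => k.2.1, fun k => k.2.2.1, fun k => k.2.2.2⟩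
  · intro m n hmn
    have h1 := congrArg (fun k : K => (k.1.2.1 : CircleDeg1Lift) 0) hmn
    change (CircleDeg1Lift.translate (Multiplicative.ofAdd ((m.toAdd : ℤ) : ℝ)) :
      CircleDeg1Lift) 0 = (CircleDeg1Lift.translate
        (Multiplicative.ofAdd ((n.toAdd : ℤ) : ℝ)) : CircleDeg1Lift) 0 at h1
    rw [translate_apply', translate_apply', zero_add, zero_add] at h1
    have h2 : m.toAdd = n.toAdd := by exact_mod_cast h1
    exact Multiplicative.toAdd.injective h2
  · intro g
    obtain ⟨F₁, F₂, h1, h2, h3⟩ := H g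
    exact ⟨⟨(g, F₁, F₂), h1, h2, h3⟩, rfl⟩
  · ext ⟨⟨g, F₁, F₂⟩, h1, h2, h3⟩
    rw [MonoidHom.mem_range, MonoidHom.mem_ker]
    constructor
    · rintro ⟨n, hn⟩
      rw [← hn]; rfl
    · intro hg
      have hg : g = 1 := hg
      subst hg
      obtain ⟨n, rfl⟩ := isLift_one_iff.1 h1
      obtain ⟨m, rfl⟩ := isLift_one_iff.1 h2
      have h4 := h3 0
      simp only [translate_apply', CircleDeg1Lift.map_add_int] at h4
      have h5 : (n : ℝ) = m := by linarith
      have h6 : n = m := by exact_mod_cast h5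
      subst h6
      exact ⟨Multiplicative.ofAdd n, rfl⟩
  · rintro k ⟨n, rfl⟩
    rw [Subgroup.mem_center_iff]
    rintro ⟨⟨g, F₁, F₂⟩, -, -, -⟩
    apply Subtype.ext
    have key : ∀ F : CircleDeg1Liftˣ, F * τ n = τ n * F := by
      intro F
      ext x
      show F ((CircleDeg1Lift.translate (Multiplicative.ofAdd ((n.toAdd : ℤ) : ℝ)) :
        CircleDeg1Lift) x) = (CircleDeg1Lift.translate
          (Multiplicative.ofAdd ((n.toAdd : ℤ) : ℝ)) : CircleDeg1Lift) (F x)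
      rw [translate_apply', translate_apply', CircleDeg1Lift.map_add_int]
    exact Prod.ext (by show g * 1 = 1 * g; simp) (Prod.ext (key F₁) (key F₂))

section Orbit

variable {G : Type u} [Group G] {ρ₁ ρ₂ : G →* HomeoPlus}

/-- The graph of the lift of the map `g • p₁ ↦ g • p₂` between two orbits which sends the lift `a`
of `p₁` to the lift `b` of `p₂`. -/
def orbitGraph (ρ₁ ρ₂ : G →* HomeoPlus) (a b : ℝ) : Set (ℝ × ℝ) :=
  {q | ∃ g : G, (q.1 : S1) = act ρ₁ g a ∧ (q.2 : S1) = act ρ₂ g b ∧ ⌊q.1 - a⌋ = ⌊q.2 - b⌋}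

/-- The equality of floors in `orbitGraph` selects, among the lifts of the image point, the one in
the corresponding period counted from the base points `a` and `b`. -/
theorem orbitGraph_add_int {a b x y : ℝ} (h : (x, y) ∈ orbitGraph ρ₁ ρ₂ a b) (n : ℤ) :
    (x + n, y + n) ∈ orbitGraph ρ₁ ρ₂ a b := by
  obtain ⟨g, h1, h2, h3⟩ := h
  refine ⟨g, by rw [← h1]; exact coe_add_int x n, by rw [← h2]; exact coe_add_int y n, ?_⟩
  simp only at h3 ⊢
  rw [add_sub_right_comm, add_sub_right_comm, Int.floor_add_intCast, Int.floor_add_intCast, h3]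

theorem exists_orbitGraph {a b x : ℝ} {g : G} (hx : (x : S1) = act ρ₁ g a) :
    ∃ y, (x, y) ∈ orbitGraph ρ₁ ρ₂ a b := by
  obtain ⟨y, hy1, hy2, hy⟩ := exists_coe_Ico b (act ρ₂ g b)
  refine ⟨y + ⌊x - a⌋, g, hx, by rw [← hy]; exact coe_add_int _ _, ?_⟩
  have : ⌊y - b⌋ = 0 := Int.floor_eq_zero_iff.2 ⟨by linarith, by linarith⟩
  simp only
  rw [add_sub_right_comm, Int.floor_add_intCast, this, zero_add]

variable {a b : ℝ} (hst : ∀ g : G, act ρ₁ g a = a ↔ act ρ₂ g b = b)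
  (hsb : ∀ g g' : G, sbtw (a : S1) (act ρ₁ g a) (act ρ₁ g' a) →
    sbtw (b : S1) (act ρ₂ g b) (act ρ₂ g' b))

include hst in
theorem orbitGraph_unique {x y y' : ℝ} (h : (x, y) ∈ orbitGraph ρ₁ ρ₂ a b)
    (h' : (x, y') ∈ orbitGraph ρ₁ ρ₂ a b) : y = y' := by
  obtain ⟨g, h1, h2, h3⟩ := h
  obtain ⟨g', h1', h2', h3'⟩ := h'
  simp only at h1 h2 h3 h1' h2' h3'
  have hg : act ρ₁ (g'⁻¹ * g) a = a := by
    rw [act_mul, ← h1, h1', act_inv_act]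
  have hg2 : act ρ₂ g b = act ρ₂ g' b := by
    rw [hst, act_mul] at hg
    rw [← act_act_inv ρ₂ g' (act ρ₂ g b), hg]
  obtain ⟨n, hn⟩ := coe_eq_coe_iff.1 (h2.trans (hg2.trans h2'.symm))
  rw [hn, add_sub_right_comm, Int.floor_add_intCast] at h3'
  have : n = 0 := by omega
  simp [hn, this]

include hst hsb in
-- Points in different periods are compared by their floors. Within one period the comparison is a
-- cyclic order relative to the base point, given by `hsb`; when one point is the base point itself,
-- `hst` replaces it.
theorem orbitGraph_strictMono {x y x' y' : ℝ} (h : (x, y) ∈ orbitGraph ρ₁ ρ₂ a b)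
    (h' : (x', y') ∈ orbitGraph ρ₁ ρ₂ a b) (hx : x < x') : y < y' := by
  have hfl : ⌊x - a⌋ ≤ ⌊x' - a⌋ := Int.floor_le_floor (by linarith)
  obtain ⟨g, h1, h2, h3⟩ := h
  obtain ⟨g', h1', h2', h3'⟩ := h'
  simp only at h1 h2 h3 h1' h2' h3'
  rcases hfl.lt_or_eq with hlt | heq
  · rw [h3, h3'] at hlt
    have : y - b < y' - b := by
      by_contra hn
      exact absurd (Int.floor_le_floor (not_lt.1 hn)) (not_le.2 hlt)
    linarith
  set n := ⌊x - a⌋ with hn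
  have hx1 := Int.floor_le (x - a)
  have hx2 := Int.lt_floor_add_one (x' - a)
  have hy1 := Int.floor_le (y - b)
  have hy2 := Int.lt_floor_add_one (y - b)
  have hy1' := Int.floor_le (y' - b)
  have hy2' := Int.lt_floor_add_one (y' - b)
  rw [← hn] at hx1
  rw [← heq] at hx2
  rw [← h3] at hy1 hy2
  rw [← h3', ← heq] at hy1' hy2'
  have e1 : ((x - n : ℝ) : S1) = act ρ₁ g a := by
    rw [← h1, ← coe_add_int (x - n) n]; congr 1; ring
  have e1' : ((x' - n : ℝ) : S1) = act ρ₁ g' a := by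
    rw [← h1', ← coe_add_int (x' - n) n]; congr 1; ring
  have e2 : ((y - n : ℝ) : S1) = act ρ₂ g b := by
    rw [← h2, ← coe_add_int (y - n) n]; congr 1; ring
  have e2' : ((y' - n : ℝ) : S1) = act ρ₂ g' b := by
    rw [← h2', ← coe_add_int (y' - n) n]; congr 1; ring
  have hax : a ≤ x - n := by linarith
  rcases hax.eq_or_lt with hax | hax
  · have h4 : act ρ₂ g b = b := by rw [← hst, ← e1, ← hax]
    have h5 : y - n = b := by
      refine coe_injOn_Ico (a := b) (by linarith) (by linarith) le_rfl (by linarith) ?_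
      rw [e2, h4]
    have h6 : y' - n ≠ b := by
      intro h6
      have h7 : act ρ₁ g' a = a := by rw [hst, ← e2', h6]
      have h8 : x' - n = a := by
        refine coe_injOn_Ico (a := a) (by linarith) (by linarith) le_rfl (by linarith) ?_
        rw [e1', h7]
      linarith
    have : b < y' - n := lt_of_le_of_ne (by linarith) h6.symm
    linarith
  · have h4 : sbtw (a : S1) (act ρ₁ g a) (act ρ₁ g' a) := by
      rw [← e1, ← e1']
      exact sbtw_coe_of_lt hax (by linarith) (by linarith)
    have h5 := hsb g g' h4
    rw [← e2, ← e2', sbtw_coe_iff (by linarith) (by linarith) (by linarith) (by linarith)] at h5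
    linarith [h5.2]

include hst hsb in
-- The lift `F₂` is normalised by its value at `b`. At another orbit point it agrees with the graph
-- up to an integer, and this integer is zero because both values lie strictly between `F₂ b` and
-- `F₂ b + 1`.
theorem exists_lifts_orbitGraph (g : G) : ∃ F₁ F₂ : CircleDeg1Liftˣ,
    IsLift F₁ (ρ₁ g : S1 ≃ₜ S1) ∧ IsLift F₂ (ρ₂ g : S1 ≃ₜ S1) ∧
      ∀ x y, (x, y) ∈ orbitGraph ρ₁ ρ₂ a b → (F₁ x, F₂ y) ∈ orbitGraph ρ₁ ρ₂ a b := by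
  obtain ⟨F₁, hF₁⟩ := exists_isLift ρ₁ g
  obtain ⟨F, hF⟩ := exists_isLift ρ₂ g
  obtain ⟨y₀, hy₀⟩ := exists_orbitGraph (ρ₁ := ρ₁) (ρ₂ := ρ₂) (a := a) (b := b)
    (x := F₁ a) (g := g) (hF₁.act_coe a).symm
  have hpt : ∀ {k : G} {x y y' : ℝ}, (x : S1) = act ρ₁ k a → (y : S1) = act ρ₂ k b →
      (x, y') ∈ orbitGraph ρ₁ ρ₂ a b → ∃ n : ℤ, y' = y + n := by
    rintro k x y y' h1 h2 h3
    refine coe_eq_coe_iff.1 ?_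
    have : ∃ y'' : ℝ, (x, y'') ∈ orbitGraph ρ₁ ρ₂ a b ∧ (y'' : S1) = act ρ₂ k b := by
      refine ⟨y + (⌊x - a⌋ - ⌊y - b⌋ : ℤ), ⟨k, h1, by rw [← h2]; exact coe_add_int _ _, ?_⟩,
        by rw [← h2]; exact coe_add_int _ _⟩
      simp only
      rw [add_sub_right_comm, Int.floor_add_intCast]
      ring
    obtain ⟨y'', h4, h5⟩ := this
    rw [orbitGraph_unique hst h3 h4, h2, h5]
  obtain ⟨n, hn⟩ := hpt (hF₁.act_coe a).symm (hF.act_coe b).symm hy₀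
  refine ⟨F₁, CircleDeg1Lift.translate (Multiplicative.ofAdd (n : ℝ)) * F, hF₁,
    hF.translate_mul n, ?_⟩
  set F₂ := CircleDeg1Lift.translate (Multiplicative.ofAdd (n : ℝ)) * F with hF₂def
  have hF₂ : IsLift F₂ (ρ₂ g : S1 ≃ₜ S1) := hF.translate_mul n
  have hF₂b : F₂ b = y₀ := by
    rw [hF₂def, Units.val_mul, CircleDeg1Lift.mul_apply, translate_apply', hn]
  have hbase : (F₁ a, F₂ b) ∈ orbitGraph ρ₁ ρ₂ a b := hF₂b ▸ hy₀
  have hab : (a, b) ∈ orbitGraph ρ₁ ρ₂ a b := ⟨1, by rw [act_one], by rw [act_one], by simp⟩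
  have key : ∀ x y, a ≤ x → x < a + 1 → (x, y) ∈ orbitGraph ρ₁ ρ₂ a b →
      (F₁ x, F₂ y) ∈ orbitGraph ρ₁ ρ₂ a b := by
    intro x y hx hx' hxy
    rcases hx.eq_or_lt with rfl | hx
    · rwa [orbitGraph_unique hst hxy hab]
    obtain ⟨k, h1, h2, h3⟩ := id hxy
    simp only at h1 h2
    have e1 : ((F₁ x : ℝ) : S1) = act ρ₁ (g * k) a := by
      rw [act_mul, ← h1, hF₁.act_coe]
    have e2 : ((F₂ y : ℝ) : S1) = act ρ₂ (g * k) b := by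
      rw [act_mul, ← h2, hF₂.act_coe]
    obtain ⟨y₁, hy₁⟩ := exists_orbitGraph (ρ₂ := ρ₂) (b := b) e1
    obtain ⟨j, hj⟩ := hpt e1 e2 hy₁
    have l1 := orbitGraph_strictMono hst hsb hbase hy₁ ((units_lt_iff F₁).2 hx)
    have l2 : y₁ < F₂ b + 1 := by
      have := orbitGraph_add_int hbase 1
      refine orbitGraph_strictMono hst hsb hy₁ (by simpa using this) ?_
      rw [← CircleDeg1Lift.map_add_one]
      exact (units_lt_iff F₁).2 hx'
    have l3 : F₂ b < F₂ y :=
      (units_lt_iff F₂).2 (orbitGraph_strictMono hst hsb hab hxy hx)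
    have l4 : F₂ y < F₂ b + 1 := by
      rw [← CircleDeg1Lift.map_add_one]
      refine (units_lt_iff F₂).2 (orbitGraph_strictMono hst hsb hxy ?_ hx')
      simpa using orbitGraph_add_int hab 1
    rw [hj] at l1 l2
    have l5 : (j : ℝ) < 1 := by linarith
    have l6 : (-1 : ℝ) < j := by linarith
    have l7 : j < 1 := by exact_mod_cast l5
    have l8 : -1 < j := by exact_mod_cast l6
    have : j = 0 := by omega
    rw [this] at hj
    simp only [Int.cast_zero, add_zero] at hj
    rwa [← hj]
  intro x y hxy
  have h1 := Int.floor_le (x - a)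
  have h2 := Int.lt_floor_add_one (x - a)
  have h3 := key (x + ((-⌊x - a⌋ : ℤ) : ℝ)) (y + ((-⌊x - a⌋ : ℤ) : ℝ)) (by push_cast; linarith)
    (by push_cast; linarith) (orbitGraph_add_int hxy _)
  have h4 := orbitGraph_add_int h3 ⌊x - a⌋
  rw [CircleDeg1Lift.map_add_int, CircleDeg1Lift.map_add_int] at h4
  simpa using h4

include hst hsb in
/-- If the map `g • p₁ ↦ g • p₂` between two orbits is a well defined bijection which preserves the
cyclic order then the actions are semi-conjugate. -/
theorem semiConjugate_of_orbit : SemiConjugate ρ₁ ρ₂ := by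
  set Γ := orbitGraph ρ₁ ρ₂ a b
  have hab : (a, b) ∈ Γ := ⟨1, by rw [act_one], by rw [act_one], by simp⟩
  -- The map sought is `x ↦ sSup (S x)`, the supremum of the graph over the orbit points not beyond
  -- `x`.
  let S : ℝ → Set ℝ := fun x => {y | ∃ x', x' ≤ x ∧ (x', y) ∈ Γ}
  have hbase : ∀ n : ℤ, (a + n, b + n) ∈ Γ := orbitGraph_add_int hab
  have hne : ∀ x, (S x).Nonempty := fun x =>
    ⟨b + ⌊x - a⌋, a + ⌊x - a⌋, by linarith [Int.floor_le (x - a)], hbase _⟩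
  have hbdd : ∀ x, BddAbove (S x) := fun x => by
    refine ⟨b + (⌊x - a⌋ + 1 : ℤ), ?_⟩
    rintro y ⟨x', hx', hy⟩
    refine (orbitGraph_strictMono hst hsb hy (hbase (⌊x - a⌋ + 1)) ?_).le
    push_cast
    linarith [Int.lt_floor_add_one (x - a)]
  have hmono : Monotone fun x => sSup (S x) := fun x x' hxx =>
    csSup_le_csSup (hbdd x') (hne x) fun y ⟨t, ht, hty⟩ => ⟨t, ht.trans hxx, hty⟩
  have hle : ∀ x, sSup (S x) + 1 ≤ sSup (S (x + 1)) := by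
    intro x
    rw [← le_sub_iff_add_le]
    refine csSup_le (hne x) ?_
    rintro y ⟨t, ht, hty⟩
    rw [le_sub_iff_add_le]
    refine le_csSup (hbdd _) ⟨t + 1, by linarith, ?_⟩
    simpa using orbitGraph_add_int hty 1
  have hge : ∀ x, sSup (S (x + 1)) ≤ sSup (S x) + 1 := by
    intro x
    refine csSup_le (hne _) ?_
    rintro y ⟨t, ht, hty⟩
    rw [← sub_le_iff_le_add]
    refine le_csSup (hbdd _) ⟨t - 1, by linarith, ?_⟩
    simpa [sub_eq_add_neg] using orbitGraph_add_int hty (-1)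
  let h : CircleDeg1Lift := ⟨⟨fun x => sSup (S x), hmono⟩, fun x => (hge x).antisymm (hle x)⟩
  refine semiConjugate_of_map h fun g => ?_
  obtain ⟨F₁, F₂, hF₁, hF₂, hΓ⟩ := exists_lifts_orbitGraph hst hsb g
  refine ⟨F₁, F₂, hF₁, hF₂, fun x => ?_⟩
  show sSup (S (F₁ x)) = CircleDeg1Lift.toOrderIso F₂ (sSup (S x))
  rw [(CircleDeg1Lift.toOrderIso F₂).map_csSup' (hne x) (hbdd x)]
  congr 1
  -- The lifts are order isomorphisms, so equivariance reduces to `S (F₁ x) = F₂ '' S x`, which is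
  -- the invariance of the graph.
  ext y
  constructor
  · rintro ⟨x', hx', hy⟩
    obtain ⟨k, h1, -, -⟩ := id hy
    have e : (((F₁⁻¹ : CircleDeg1Liftˣ) x' : ℝ) : S1) = act ρ₁ (g⁻¹ * k) a := by
      simp only at h1
      rw [act_mul, ← h1, hF₁.inv.act_coe]
    obtain ⟨y₀, hy₀⟩ := exists_orbitGraph (ρ₂ := ρ₂) (b := b) e
    have h2 := hΓ _ _ hy₀
    rw [CircleDeg1Lift.units_apply_inv_apply] at h2
    refine ⟨y₀, ⟨_, ?_, hy₀⟩, (orbitGraph_unique hst hy h2).symm⟩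
    rw [← units_le_iff F₁, CircleDeg1Lift.units_apply_inv_apply]
    exact hx'
  · rintro ⟨y₀, ⟨t, ht, hty⟩, rfl⟩
    exact ⟨F₁ t, (units_le_iff F₁).2 ht, hΓ _ _ hty⟩

end Orbit

end PingPong

namespace PingPong

/-! ### Systems of disjoint arcs and their gaps -/

/-- A collection of pairwise disjoint, proper, open arcs of the circle. -/
structure IsArcSystem (𝓘 : Set (Set S1)) : Prop where
  isOpen : ∀ I ∈ 𝓘, IsOpen I
  isPreconnected : ∀ I ∈ 𝓘, IsPreconnected I
  nonempty : ∀ I ∈ 𝓘, I.Nonempty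
  ne_univ : ∀ I ∈ 𝓘, I ≠ Set.univ
  eq_of_mem : ∀ I ∈ 𝓘, ∀ J ∈ 𝓘, ∀ x ∈ I, x ∈ J → I = J

namespace IsArcSystem

variable {𝓘 : Set (Set S1)} (h𝓘 : IsArcSystem 𝓘)

include h𝓘

theorem disjoint {I J : Set S1} (hI : I ∈ 𝓘) (hJ : J ∈ 𝓘) (h : I ≠ J) : Disjoint I J :=
  Set.disjoint_left.2 fun x hx hx' => h (h𝓘.eq_of_mem I hI J hJ x hx hx')

theorem isOpen_sUnion : IsOpen (⋃₀ 𝓘) := _root_.isOpen_sUnion h𝓘.isOpen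

end IsArcSystem

theorem gaps_disjoint {𝓘 : Set (Set S1)} {J : Set S1} (hJ : J ∈ gaps 𝓘) {x : S1} (hx : x ∈ J) :
    x ∉ ⋃₀ 𝓘 := by
  obtain ⟨y, hy, rfl⟩ := hJ
  exact connectedComponentIn_subset _ _ hx

theorem gaps_notMem {𝓘 : Set (Set S1)} {I J : Set S1} (hJ : J ∈ gaps 𝓘) (hI : I ∈ 𝓘) {x : S1}
    (hx : x ∈ J) : x ∉ I := fun h => gaps_disjoint hJ hx ⟨I, hI, h⟩

theorem subset_gap {𝓘 : Set (Set S1)} {J P : Set S1} (hJ : J ∈ gaps 𝓘) (hP : IsPreconnected P)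
    (hPI : ∀ x ∈ P, x ∉ ⋃₀ 𝓘) {x : S1} (hxP : x ∈ P) (hxJ : x ∈ J) : P ⊆ J := by
  obtain ⟨y, hy, rfl⟩ := hJ
  rw [connectedComponentIn_eq hxJ]
  exact hP.subset_connectedComponentIn hxP hPI

theorem mem_of_markovUnion {𝓘 : Set (Set S1)} {K : Set S1} {A B : Set (Set S1)}
    (h𝓘 : IsArcSystem 𝓘) (h : MarkovUnion 𝓘 K A B) {I : Set S1} (hI : I ∈ 𝓘) {x : S1}
    (hxI : x ∈ I) (hxK : x ∈ K) : I ∈ A := by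
  rw [h.2.2.2] at hxK
  rcases hxK with ⟨I', hI', hx⟩ | ⟨J, hJ, hx⟩
  · rwa [h𝓘.eq_of_mem I hI I' (h.1 hI') x hxI hx]
  · exact absurd hxI (gaps_notMem (h.2.1 hJ) hI hx)

theorem subset_of_markovUnion {𝓘 : Set (Set S1)} {K : Set S1} {A B : Set (Set S1)}
    (h : MarkovUnion 𝓘 K A B) {I : Set S1} (hI : I ∈ A) : I ⊆ K := by
  rw [h.2.2.2]
  exact fun x hx => Or.inl ⟨I, hI, hx⟩

theorem gap_subset_of_markovUnion {𝓘 : Set (Set S1)} {K : Set S1} {A B : Set (Set S1)}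
    (h : MarkovUnion 𝓘 K A B) {J : Set S1} (hJ : J ∈ B) : J ⊆ K := by
  rw [h.2.2.2]
  exact fun x hx => Or.inr ⟨J, hJ, hx⟩

/-- A gap which follows an arc of the system determines this arc. -/
theorem followedBy_left_end {𝓘 : Set (Set S1)} {I J : Set S1} (hI : I ∈ 𝓘) (hJ : J ∈ gaps 𝓘)
    {a b b' c' : ℝ} (hab : a < b) (hIe : I = (fun x : ℝ => (x : S1)) '' Set.Ioo a b)
    (hJe : J = (fun x : ℝ => (x : S1)) '' Set.Icc b' c') (hb : (b : S1) ∈ J) :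
    ∃ n : ℤ, b' = b + n := by
  have hb2 := hb
  rw [hJe] at hb2
  obtain ⟨β, hβ, hβb⟩ := hb2
  obtain ⟨n, hn⟩ := coe_eq_coe_iff.1 hβb.symm
  refine ⟨n, ?_⟩
  by_contra hne
  have hlt : b' < β := lt_of_le_of_ne hβ.1 fun h => hne (h.trans hn)
  set t := max b' (a + n) with ht
  have h1 : max b' (a + n) < β := max_lt hlt (by linarith)
  obtain ⟨s, hs1, hs2⟩ := exists_between h1
  have hsJ : (s : S1) ∈ J := by
    rw [hJe]
    exact ⟨s, ⟨(le_max_left _ _).trans hs1.le, hs2.le.trans hβ.2⟩, rfl⟩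
  refine gaps_notMem hJ hI hsJ ?_
  rw [hIe]
  refine ⟨s - n, ⟨?_, by linarith⟩, ?_⟩
  · have := (le_max_right b' (a + n)).trans_lt hs1
    linarith
  · exact coe_eq_coe_iff.2 ⟨n, by ring⟩

/-- The left endpoint of the gap is the right endpoint of both arcs, so points just before it belong
to both. -/
theorem eq_of_followedBy {𝓘 : Set (Set S1)} (h𝓘 : IsArcSystem 𝓘) {I I' J : Set S1} (hI : I ∈ 𝓘)
    (hI' : I' ∈ 𝓘) (hJ : J ∈ gaps 𝓘) (h : FollowedBy I J) (h' : FollowedBy I' J) : I = I' := by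
  obtain ⟨a, b, c, hab, hbc, hIe, hJe⟩ := h
  obtain ⟨a', b', c', hab', hbc', hIe', hJe'⟩ := h'
  have hb : (b : S1) ∈ J := by rw [hJe]; exact ⟨b, ⟨le_rfl, hbc⟩, rfl⟩
  obtain ⟨n, hn⟩ := followedBy_left_end hI hJ hab hIe hJe' hb
  obtain ⟨s, hs1, hs2⟩ := exists_between (max_lt hab (show a' - n < b by linarith))
  refine h𝓘.eq_of_mem I hI I' hI' (s : S1) ?_ ?_
  · rw [hIe]
    exact ⟨s, ⟨(le_max_left _ _).trans_lt hs1, hs2⟩, rfl⟩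
  · rw [hIe']
    refine ⟨s + n, ⟨?_, by linarith⟩, coe_add_int s n⟩
    have := (le_max_right a (a' - n)).trans_lt hs1
    linarith

/-! ### The order of the arcs inside a Markovian union. -/

section Markov

variable {𝓘 : Set (Set S1)} (h𝓘 : IsArcSystem 𝓘) {K : Set S1}
  (hKu : K ≠ Set.univ) {A B : Set (Set S1)} (hM : MarkovUnion 𝓘 K A B)

include h𝓘 hKu hM

/-- The arcs of a Markovian union are totally ordered, and there is a last one. -/
theorem exists_last : ∃ L ∈ A, ∀ I ∈ A, I ≠ L → ∀ x ∈ I, ∀ y ∈ L, Before K x y := by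
  obtain ⟨hA, hB, ⟨m, hm, hAm, -⟩, -⟩ := id hM
  have hfin : A.Finite := by
    rw [← Set.encard_lt_top_iff, hAm]
    exact_mod_cast ENat.natCast_lt_top (m + 1)
  have hne : A.Nonempty := by
    rw [← Set.encard_ne_zero, hAm]
    simp
  obtain ⟨z, hz⟩ := (Set.ne_univ_iff_exists_notMem _).1 hKu
  obtain ⟨z, rfl⟩ := exists_coe_eq z
  have hrep : ∀ I : Set S1, ∃ t : ℝ, I ∈ A → z ≤ t ∧ t < z + 1 ∧ (t : S1) ∈ I := by
    intro I
    by_cases hI : I ∈ A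
    · obtain ⟨x, hx⟩ := h𝓘.nonempty I (hA hI)
      obtain ⟨t, h1, h2, rfl⟩ := exists_coe_Ico z x
      exact ⟨t, fun _ => ⟨h1, h2, hx⟩⟩
    · exact ⟨0, fun h => absurd h hI⟩
  choose r hr using hrep
  -- The circle is cut at `z ∉ K`; the last arc is the one with the largest representative in `[z, z
  -- + 1)`.
  obtain ⟨L, hL, hmax⟩ := Set.exists_max_image A r hfin hne
  refine ⟨L, hL, fun I hI hIL x hx y hy => ⟨z, hz, ?_⟩⟩
  have hlt : r I < r L := by
    refine lt_of_le_of_ne (hmax I hI) fun h => hIL ?_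
    refine h𝓘.eq_of_mem I (hA hI) L (hA hL) _ (hr I hI).2.2 ?_
    rw [h]
    exact (hr L hL).2.2
  have hzA : ∀ I ∈ A, (z : S1) ∉ I := fun I hI h => hz (subset_of_markovUnion hM hI h)
  refine sbtw_of_sbtw_right (h𝓘.isPreconnected I (hA hI)) (h𝓘.isPreconnected L (hA hL))
    (h𝓘.disjoint (hA hI) (hA hL) hIL) (hzA I hI) (hzA L hL) (hr I hI).2.2 hx (hr L hL).2.2 hy ?_
  refine sbtw_coe_of_lt (lt_of_le_of_ne (hr I hI).1 ?_) hlt (hr L hL).2.1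
  intro h
  refine hzA I hI ?_
  rw [h]
  exact (hr I hI).2.2

/-- A gap of a Markovian union does not follow the last arc. -/
theorem exists_before_of_followedBy (hKo : IsOpen K) {L J : Set S1} (hL : L ∈ 𝓘) (hJ : J ∈ B)
    (hLJ : FollowedBy L J) :
    L ∈ A ∧ ∃ I ∈ A, I ≠ L ∧ ∃ x ∈ L, ∃ y ∈ I, Before K x y := by
  obtain ⟨a, b, c, hab, hbc, hLe, hJe⟩ := hLJ
  obtain ⟨z, hz⟩ := (Set.ne_univ_iff_exists_notMem _).1 hKu
  have hJK : J ⊆ K := gap_subset_of_markovUnion hM hJ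
  have hJg : J ∈ gaps 𝓘 := hM.2.1 hJ
  have hJmem : ∀ t, b ≤ t → t ≤ c → (t : S1) ∈ J := fun t h1 h2 => by
    rw [hJe]; exact ⟨t, ⟨h1, h2⟩, rfl⟩
  have hLmem : ∀ t, a < t → t < b → (t : S1) ∈ L := fun t h1 h2 => by
    rw [hLe]; exact ⟨t, ⟨h1, h2⟩, rfl⟩
  have hpre : IsOpen (((↑) : ℝ → S1) ⁻¹' K) := hKo.preimage continuous_coe
  -- the arc `L` meets `K`
  have hLA : L ∈ A := by
    obtain ⟨ε, hε, hball⟩ := Metric.isOpen_iff.1 hpre b (hJK (hJmem b le_rfl hbc))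
    obtain ⟨s, hs1, hs2⟩ := exists_between (max_lt hab (show b - ε < b by linarith))
    have h1 := (le_max_left _ _).trans_lt hs1
    have h2 := (le_max_right _ _).trans_lt hs1
    refine mem_of_markovUnion h𝓘 hM hL (hLmem s h1 hs2) (hball ?_)
    rw [Metric.mem_ball, Real.dist_eq, abs_lt]
    constructor <;> linarith
  refine ⟨hLA, ?_⟩
  -- A gap of length at least 1 would cover the circle, whereas `K` misses `z`.
  have hcb : c < b + 1 := by
    by_contra h
    obtain ⟨t, h1, h2, h3⟩ := exists_coe_Ico b z
    exact hz (h3 ▸ hJK (hJmem t h1 (by linarith)))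
  obtain ⟨ε, hε, hball⟩ := Metric.isOpen_iff.1 hpre c (hJK (hJmem c hbc le_rfl))
  have hδ : 0 < min ε (b + 1 - c) := lt_min hε (by linarith)
  set δ := min ε (b + 1 - c) / 2 with hδd
  have hδ1 : δ < ε := by
    have := min_le_left ε (b + 1 - c); rw [hδd]; linarith
  have hδ2 : c + δ < b + 1 := by
    have := min_le_right ε (b + 1 - c); rw [hδd]; linarith
  have hδ0 : 0 < δ := by rw [hδd]; linarith
  have hKmem : ∀ t, c ≤ t → t ≤ c + δ → (t : S1) ∈ K := fun t h1 h2 => by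
    refine hball ?_
    rw [Metric.mem_ball, Real.dist_eq, abs_lt]
    constructor <;> linarith
  -- An arc must occur immediately after `c`, otherwise the gap, a whole component, could be
  -- extended beyond `c`.
  have hex : ∃ t, c < t ∧ t ≤ c + δ ∧ (t : S1) ∈ ⋃₀ 𝓘 := by
    by_contra hn
    push Not at hn
    have hsub := subset_gap (P := ((↑) : ℝ → S1) '' Set.Icc b (c + δ)) hJg
      (isPreconnected_Icc.image _ continuous_coe.continuousOn) ?_
      ⟨b, ⟨le_rfl, by linarith⟩, rfl⟩ (hJmem b le_rfl hbc)
    · have h1 := hsub ⟨c + δ, ⟨by linarith, le_rfl⟩, rfl⟩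
      rw [hJe] at h1
      obtain ⟨d, hd, hde⟩ := h1
      have := coe_injOn_Ico (a := b) hd.1 (by linarith [hd.2]) (by linarith) hδ2 hde
      linarith [hd.2]
    · rintro _ ⟨t, ht, rfl⟩
      rcases le_or_gt t c with h | h
      · exact gaps_disjoint hJg (hJmem t ht.1 h)
      · exact hn t h ht.2
  obtain ⟨u, hu1, hu2, I, hI, huI⟩ := hex
  have hIA : I ∈ A := mem_of_markovUnion h𝓘 hM hI huI (hKmem u hu1.le hu2)
  obtain ⟨s, hs1, hs2⟩ := exists_between hab
  have hall : ∀ t, s ≤ t → t ≤ u → (t : S1) ∈ K := by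
    intro t h1 h2
    rcases lt_or_ge t b with h | h
    · exact subset_of_markovUnion hM hLA (hLmem t (by linarith) h)
    rcases le_or_gt t c with h' | h'
    · exact hJK (hJmem t h h')
    · exact hKmem t h'.le (by linarith)
  have hsu : sbtw (s : S1) (u : S1) z := sbtw_of_arc_subset (by linarith) hall hz
  refine ⟨I, hIA, ?_, s, hLmem s hs1 hs2, u, huI, z, hz, hsu.cyclic_right⟩
  -- If the new arc were `L`, it would contain `s` and `u`, which `b` and `z` separate, while
  -- containing neither `b` nor `z`.
  rintro rfl
  have hbI : (b : S1) ∉ I := gaps_notMem hJg hL (hJmem b le_rfl hbc)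
  have hzI : z ∉ I := fun h => hz (subset_of_markovUnion hM hIA h)
  have h1 : sbtw (s : S1) (b : S1) z :=
    sbtw_of_arc_subset hs2 (fun t h1 h2 => hall t h1 (by linarith)) hz
  have h2 : sbtw (b : S1) (u : S1) z :=
    sbtw_of_arc_subset (by linarith) (fun t h1 h2 => hall t (by linarith) h2) hz
  have h3 := (h𝓘.isPreconnected I hL).subset_cIoo hbI hzI huI h2 _ (hLmem s hs1 hs2)
  exact sbtw_asymm h1 h3.cyclic_right

/-- In a Markovian union, an arc which is not the last one is followed by a gap of the union. -/
theorem exists_followedBy_of_before (hK : IsPreconnected K) {I I' : Set S1} (hI : I ∈ A)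
    (hI' : I' ∈ A) (hne : I ≠ I') {x y : S1} (hx : x ∈ I) (hy : y ∈ I') (hxy : Before K x y) :
    ∃ J ∈ B, FollowedBy I J := by
  have hI𝓘 := hM.1 hI
  obtain ⟨a, b, hab, hba, hIe⟩ := exists_eq_image_Ioo (h𝓘.isPreconnected I hI𝓘)
    (h𝓘.isOpen I hI𝓘) (h𝓘.nonempty I hI𝓘) (h𝓘.ne_univ I hI𝓘)
  have hbI : (b : S1) ∉ I := by rw [hIe]; exact coe_notMem_image_Ioo_right hba
  -- An arc containing `b` is open, hence meets `I` just before `b` and equals it.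
  have hb𝓘 : (b : S1) ∉ ⋃₀ 𝓘 := by
    rintro ⟨I₂, hI₂, hb⟩
    obtain ⟨ε, hε, hball⟩ := Metric.isOpen_iff.1 ((h𝓘.isOpen I₂ hI₂).preimage continuous_coe) b hb
    obtain ⟨s, hs1, hs2⟩ := exists_between (max_lt hab (show b - ε < b by linarith))
    have h1 := (le_max_left _ _).trans_lt hs1
    have h2 := (le_max_right _ _).trans_lt hs1
    have h3 : (s : S1) ∈ I₂ := by
      refine hball ?_
      rw [Metric.mem_ball, Real.dist_eq, abs_lt]
      constructor <;> linarith
    refine hbI ?_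
    rw [h𝓘.eq_of_mem I hI𝓘 I₂ hI₂ s (by rw [hIe]; exact ⟨s, ⟨h1, hs2⟩, rfl⟩) h3]
    exact hb
  -- The part of `K` from `x` to `y` starts inside `I` and ends outside, so it passes through `b`.
  have hbK : (b : S1) ∈ K := by
    obtain ⟨z, hz, h⟩ := hxy
    have hx2 := hx
    rw [hIe] at hx2
    obtain ⟨x₀, hx₀, rfl⟩ := hx2
    obtain ⟨y₀, z₀, h1, h2, h3, rfl, rfl⟩ := exists_lifts_of_sbtw h.cyclic_left
    refine arc_subset_of_lt hK h1 h2 h3 (subset_of_markovUnion hM hI hx)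
      (subset_of_markovUnion hM hI' hy) hz hx₀.2.le ?_
    by_contra hlt
    refine hne (h𝓘.eq_of_mem I hI𝓘 I' (hM.1 hI') y₀ ?_ hy)
    rw [hIe]
    exact ⟨y₀, ⟨hx₀.1.trans h1, not_le.1 hlt⟩, rfl⟩
  have hbB := hbK
  rw [hM.2.2.2] at hbB
  rcases hbB with ⟨I₂, hI₂, hb⟩ | ⟨J, hJ, hb⟩
  · exact absurd ⟨I₂, hM.1 hI₂, hb⟩ hb𝓘
  refine ⟨J, hJ, ?_⟩
  have hJg := hM.2.1 hJ
  have hJK := gap_subset_of_markovUnion hM hJ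
  have hJp : IsPreconnected J := by
    obtain ⟨y, hy, rfl⟩ := id hJg
    exact isPreconnected_connectedComponentIn
  have hJc : IsClosed J := by
    refine isClosed_of_closure_subset (subset_gap hJg hJp.closure (fun x hx => ?_)
      (subset_closure hb) hb)
    exact closure_minimal (fun x hx => gaps_disjoint hJg hx) h𝓘.isOpen_sUnion.isClosed_compl hx
  obtain ⟨b', c', hbc', hJe⟩ := exists_eq_image_Icc hJp hJc ⟨_, hb⟩
    fun h => hKu (Set.eq_univ_of_univ_subset (h ▸ hJK))
  obtain ⟨n, hn⟩ := followedBy_left_end hI𝓘 hJg hab hIe hJe hb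
  refine ⟨a + n, b', c', by linarith, hbc', ?_, hJe⟩
  rw [hIe, hn]
  ext w
  constructor
  · rintro ⟨s, hs, rfl⟩
    exact ⟨s + n, ⟨by linarith [hs.1], by linarith [hs.2]⟩, coe_add_int s n⟩
  · rintro ⟨s, hs, rfl⟩
    exact ⟨s - n, ⟨by linarith [hs.1], by linarith [hs.2]⟩, coe_eq_coe_iff.2 ⟨n, by ring⟩⟩

end Markov

/-- The order of two arcs in a Markovian union is determined by the cyclic order of the arcs and by
the gaps which belong to the union. -/
theorem before_of_markovUnion {𝓘 𝓘' : Set (Set S1)} (h𝓘 : IsArcSystem 𝓘) (h𝓘' : IsArcSystem 𝓘')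
    {θ : Set S1 → Set S1} (hθ : Set.BijOn θ 𝓘 𝓘')
    (hcyc : ∀ I₁ ∈ 𝓘, ∀ I₂ ∈ 𝓘, ∀ I₃ ∈ 𝓘, CyclicallyOrdered I₁ I₂ I₃ →
      CyclicallyOrdered (θ I₁) (θ I₂) (θ I₃))
    {K K' : Set S1} (hK : IsPreconnected K) (hKo : IsOpen K) (hKu : K ≠ Set.univ)
    (hK' : IsPreconnected K') (hKu' : K' ≠ Set.univ) {A B : Set (Set S1)}
    (hM : MarkovUnion 𝓘 K A B) (hM' : MarkovUnion 𝓘' K' (θ '' A) (gapImage 𝓘 𝓘' θ B))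
    {I J : Set S1} (hI : I ∈ A) (hJ : J ∈ A) (hIJ : I ≠ J) {x y x' y' : S1} (hx : x ∈ I)
    (hy : y ∈ J) (hx' : x' ∈ θ I) (hy' : y' ∈ θ J) (h : Before K x y) : Before K' x' y' := by
  have hinj : ∀ I ∈ A, ∀ J ∈ A, I ≠ J → θ I ≠ θ J := fun I hI J hJ hne h =>
    hne (hθ.injOn (hM.1 hI) (hM.1 hJ) h)
  obtain ⟨L, hL, hmax⟩ := exists_last h𝓘 hKu hM
  obtain ⟨_, ⟨L₁, hL₁, rfl⟩, hmax'⟩ := exists_last h𝓘' hKu' hM'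
  -- `θ` maps the last arc to the last arc. Otherwise some gap of the image union follows `θ L`; by
  -- `gapImage` it comes from a gap of the first union following `L`, so `L` would not be last.
  have hLL : L₁ = L := by
    by_contra hne
    obtain ⟨u, hu⟩ := h𝓘'.nonempty _ (hθ.mapsTo (hM.1 hL))
    obtain ⟨v, hv⟩ := h𝓘'.nonempty _ (hθ.mapsTo (hM.1 hL₁))
    have hne' := hinj L hL L₁ hL₁ (Ne.symm hne)
    have hbf := hmax' (θ L) ⟨L, hL, rfl⟩ hne' u hu v hv
    obtain ⟨J', ⟨hJ'g, J₀, hJ₀, I₀, hI₀, hf, hf'⟩, hfL⟩ := exists_followedBy_of_before h𝓘' hKu'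
      hM' hK' ⟨L, hL, rfl⟩ ⟨L₁, hL₁, rfl⟩ hne' hu hv hbf
    have h1 := eq_of_followedBy h𝓘' (hθ.mapsTo hI₀) (hθ.mapsTo (hM.1 hL)) hJ'g hf' hfL
    have h2 := hθ.injOn hI₀ (hM.1 hL) h1
    subst h2
    obtain ⟨-, I₁, hI₁, hne1, x₁, hx₁, y₁, hy₁, hb₁⟩ :=
      exists_before_of_followedBy h𝓘 hKu hM hKo hI₀ hJ₀ hf
    exact Before.asymm hK (subset_of_markovUnion hM hL hx₁) (subset_of_markovUnion hM hI₁ hy₁) hb₁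
      (hmax I₁ hI₁ hne1 y₁ hy₁ x₁ hx₁)
  subst hLL
  have hsub : ∀ I ∈ A, I ⊆ K := fun I hI => subset_of_markovUnion hM hI
  have hsub' : ∀ I ∈ A, θ I ⊆ K' := fun I hI => subset_of_markovUnion hM' ⟨I, hI, rfl⟩
  by_cases hJL : J = L₁
  · subst hJL
    exact hmax' (θ I) ⟨I, hI, rfl⟩ (hinj I hI J hJ hIJ) x' hx' y' hy'
  by_cases hIL : I = L₁
  · subst hIL
    exact absurd h (Before.asymm hK (hsub J hJ hy) (hsub I hI hx)
      (hmax J hJ hJL y hy x hx))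
  obtain ⟨w, hw⟩ := h𝓘.nonempty _ (hM.1 hL)
  obtain ⟨w', hw'⟩ := h𝓘'.nonempty _ (hθ.mapsTo (hM.1 hL))
  obtain ⟨z, hz⟩ := (Set.ne_univ_iff_exists_notMem _).1 hKu
  obtain ⟨z', hz'⟩ := (Set.ne_univ_iff_exists_notMem _).1 hKu'
  have hnez : ∀ {u}, u ∈ K → z ≠ u := fun hu h => hz (h ▸ hu)
  have hnez' : ∀ {u}, u ∈ K' → z' ≠ u := fun hu h => hz' (h ▸ hu)
  -- With a point of the last arc as third point, the linear order of `K` becomes a cyclic order,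
  -- which `θ` preserves.
  have h1 : sbtw x y w := by
    rw [sbtw_iff_of_ne (hnez (hsub I hI hx)) (hnez (hsub J hJ hy)) (hnez (hsub L₁ hL hw))]
    left
    rw [← before_iff hK (hsub I hI hx) (hsub J hJ hy) hz,
      ← before_iff hK (hsub J hJ hy) (hsub L₁ hL hw) hz]
    exact ⟨h, hmax J hJ hJL y hy w hw⟩
  have h2 := cyclicallyOrdered_of_sbtw (h𝓘.isPreconnected I (hM.1 hI))
    (h𝓘.isPreconnected J (hM.1 hJ)) (h𝓘.isPreconnected L₁ (hM.1 hL))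
    (h𝓘.disjoint (hM.1 hI) (hM.1 hJ) hIJ) (h𝓘.disjoint (hM.1 hJ) (hM.1 hL) hJL)
    (h𝓘.disjoint (hM.1 hI) (hM.1 hL) hIL) hx hy hw h1
  have h3 := hcyc I (hM.1 hI) J (hM.1 hJ) L₁ (hM.1 hL) h2 x' hx' y' hy' w' hw'
  rw [sbtw_iff_of_ne (hnez' (hsub' I hI hx')) (hnez' (hsub' J hJ hy')) (hnez' (hsub' L₁ hL hw'))]
    at h3
  have h4 : sbtw z' x' w' := by
    rw [← before_iff hK' (hsub' I hI hx') (hsub' L₁ hL hw') hz']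
    exact hmax' (θ I) ⟨I, hI, rfl⟩ (hinj I hI L₁ hL hIL) x' hx' w' hw'
  rw [before_iff hK' (hsub' I hI hx') (hsub' J hJ hy') hz']
  rcases h3 with h | h | h
  · exact h.1
  · exact absurd h4 (fun h5 => sbtw_asymm h5 h.2.cyclic_left)
  · exact h.2

end PingPong

namespace PingPong

/-! ### Half-trees -/

section HalfTree

variable {X : Type*} (Γ : SimpleGraph X)

/-- The vertices on the side of `b` of the edge `{a, b}`. -/
def halfTree (a b : X) : Set X := {u | (Γ.deleteEdges {s(a, b)}).Reachable b u}

variable {Γ}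

theorem mem_halfTree_self (a b : X) : b ∈ halfTree Γ a b := SimpleGraph.Reachable.refl _

/-- Any other edge survives the deletion, so its ends are on the same side. Combined with boundary
darts, this identifies the edge by which a walk enters or leaves a half-tree. -/
theorem halfTree_cross {a b u u' : X} (h : Γ.Adj u u') (hu : u ∉ halfTree Γ a b)
    (hu' : u' ∈ halfTree Γ a b) : u = a ∧ u' = b := by
  by_cases he : s(u, u') = s(a, b)
  · rcases Sym2.eq_iff.1 he with h1 | ⟨rfl, rfl⟩
    · exact h1
    · exact absurd (mem_halfTree_self _ _) hu
  · refine absurd (SimpleGraph.Reachable.trans hu' (SimpleGraph.Adj.reachable ?_)) hu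
    rw [SimpleGraph.deleteEdges_adj]
    exact ⟨h.symm, by rwa [Set.mem_singleton_iff, Sym2.eq_swap]⟩

theorem left_notMem_halfTree (hΓ : Γ.IsAcyclic) {a b : X} (h : Γ.Adj a b) :
    a ∉ halfTree Γ a b := fun ha =>
  (SimpleGraph.isBridge_iff.1 (SimpleGraph.isAcyclic_iff_forall_adj_isBridge.1 hΓ h)) ha.symm

theorem notMem_halfTree_swap (hΓ : Γ.IsAcyclic) {a b u : X} (h : Γ.Adj a b)
    (hu : u ∈ halfTree Γ a b) : u ∉ halfTree Γ b a := fun hu' => by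
  have hu' : (Γ.deleteEdges {s(b, a)}).Reachable a u := hu'
  rw [Sym2.eq_swap] at hu'
  exact left_notMem_halfTree hΓ h (SimpleGraph.Reachable.trans hu hu'.symm)

theorem mem_halfTree_or (hΓ : Γ.Connected) (a b u : X) :
    u ∈ halfTree Γ a b ∨ u ∈ halfTree Γ b a := by
  obtain ⟨p⟩ := hΓ.preconnected u a
  by_contra h
  push Not at h
  obtain ⟨h1, h2⟩ := h
  obtain ⟨d, -, hd, hd'⟩ := p.exists_boundary_dart
    {u | u ∉ halfTree Γ a b ∧ u ∉ halfTree Γ b a} ⟨h1, h2⟩ (fun h => h.2 (mem_halfTree_self _ _))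
  have hd' : ¬ (d.snd ∉ halfTree Γ a b ∧ d.snd ∉ halfTree Γ b a) := hd'
  rw [not_and_or, not_not, not_not] at hd'
  rcases hd' with h | h
  · obtain ⟨e, -⟩ := halfTree_cross d.adj hd.1 h
    exact hd.2 (e ▸ mem_halfTree_self _ _)
  · obtain ⟨e, -⟩ := halfTree_cross d.adj hd.2 h
    exact hd.1 (e ▸ mem_halfTree_self _ _)

/-- A walk from `y` leaving the larger half-tree would have to pass through `c`, without using the
edge `{v, y}`. -/
theorem halfTree_subset {v y c d : X} (hy : y ∈ halfTree Γ c d) (hc : c ∉ halfTree Γ v y) :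
    halfTree Γ v y ⊆ halfTree Γ c d := by
  rintro u ⟨p⟩
  by_contra hu
  obtain ⟨e, he, hd, hd'⟩ := p.exists_boundary_dart (halfTree Γ c d) hy hu
  have hadj := e.adj
  rw [SimpleGraph.deleteEdges_adj] at hadj
  obtain ⟨e1, -⟩ := halfTree_cross hadj.1.symm hd' hd
  refine hc ?_
  rw [← e1]
  classical
  exact ⟨p.takeUntil e.snd (p.dart_snd_mem_support_of_mem_darts he)⟩

theorem mem_halfTree_of_walk {a b : X} {x u : X} (p : Γ.Walk x u) (hx : x ∈ halfTree Γ a b)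
    (ha : a ∉ p.support) : u ∈ halfTree Γ a b := by
  by_contra hu
  obtain ⟨e, he, hd, hd'⟩ := p.exists_boundary_dart (halfTree Γ a b) hx hu
  obtain ⟨e1, -⟩ := halfTree_cross e.adj.symm hd' hd
  exact ha (e1 ▸ p.dart_snd_mem_support_of_mem_darts he)

end HalfTree

/-! ### Half-trees, the fundamental domain and generation by the preferred elements. -/

namespace TreeMarking

variable {G : Type*} [Group G] {X : Type*} [MulAction G X] (M : TreeMarking G X)

theorem adj_smul_iff (g : G) {x y : X} : M.tree.Adj (g • x) (g • y) ↔ M.tree.Adj x y := by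
  refine ⟨fun h => ?_, M.adj_smul g x y⟩
  have := M.adj_smul g⁻¹ _ _ h
  rwa [inv_smul_smul, inv_smul_smul] at this

/-- The action of an element as an endomorphism of the tree. -/
def smulHom (g : G) : M.tree →g M.tree := ⟨fun x => g • x, fun h => M.adj_smul g _ _ h⟩

theorem smul_mem_halfTree_of_mem (g : G) {a b u : X} (h : u ∈ halfTree M.tree a b) :
    g • u ∈ halfTree M.tree (g • a) (g • b) := by
  refine SimpleGraph.Reachable.map (⟨fun x => g • x, fun {x y} h => ?_⟩ :
    M.tree.deleteEdges {s(a, b)} →g M.tree.deleteEdges {s(g • a, g • b)}) h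
  rw [SimpleGraph.deleteEdges_adj] at h ⊢
  refine ⟨M.adj_smul g _ _ h.1, fun h' => h.2 ?_⟩
  rw [Set.mem_singleton_iff, Sym2.eq_iff] at h' ⊢
  simpa [smul_left_cancel_iff] using h'

theorem smul_mem_halfTree (g : G) {a b u : X} :
    g • u ∈ halfTree M.tree (g • a) (g • b) ↔ u ∈ halfTree M.tree a b := by
  refine ⟨fun h => ?_, M.smul_mem_halfTree_of_mem g⟩
  have := M.smul_mem_halfTree_of_mem g⁻¹ h
  rwa [inv_smul_smul, inv_smul_smul, inv_smul_smul] at this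

theorem mem_halfTree_smul (g : G) {a b u : X} :
    u ∈ halfTree M.tree (g • a) (g • b) ↔ g⁻¹ • u ∈ halfTree M.tree a b := by
  rw [← M.smul_mem_halfTree g (u := g⁻¹ • u), smul_inv_smul]

theorem span_adj_iff {a b : X} :
    M.span.Adj a b ↔ a ≠ b ∧ a ∈ M.verts ∧ b ∈ M.verts ∧ s(a, b) ∈ M.edges := by
  rw [span, SimpleGraph.fromRel_adj]
  constructor
  · rintro ⟨h, h1 | ⟨h1, h2, h3⟩⟩
    · exact ⟨h, h1⟩
    · exact ⟨h, h2, h1, by rwa [Sym2.eq_swap]⟩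
  · exact fun h => ⟨h.1, Or.inl h.2⟩

theorem tree_adj_of_edge {a b : X} (h : s(a, b) ∈ M.edges) : M.tree.Adj a b :=
  (SimpleGraph.mem_edgeSet _).1 (M.edges_subset h)

theorem tree_adj_of_span {a b : X} (h : M.span.Adj a b) : M.tree.Adj a b :=
  M.tree_adj_of_edge (M.span_adj_iff.1 h).2.2.2

theorem span_le : M.span ≤ M.tree := fun _ _ h => M.tree_adj_of_span h

theorem verts_nonempty : M.verts.Nonempty := by
  obtain ⟨x⟩ := M.isTree.connected.nonempty
  obtain ⟨v, hv, -⟩ := M.existsUnique_vert x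
  exact ⟨v, hv.1⟩

theorem eq_of_smul {v w : X} (hv : v ∈ M.verts) (hw : w ∈ M.verts) {g : G} (h : g • v = w) :
    v = w :=
  (M.existsUnique_vert v).unique ⟨hv, 1, one_smul _ _⟩ ⟨hw, g, h⟩

theorem mem_stabilizer_of_smul_mem {v : X} (hv : v ∈ M.verts) {g : G} (h : g • v ∈ M.verts) :
    g ∈ MulAction.stabilizer G v :=
  MulAction.mem_stabilizer_iff.2 (M.eq_of_smul hv h rfl).symm

/-- The edges of the tree separating two vertices of `T` are edges of `T`. -/
theorem span_adj_of_separates {a b v w : X} (hv : v ∈ M.verts) (hw : w ∈ M.verts)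
    (h1 : v ∉ halfTree M.tree a b) (h2 : w ∈ halfTree M.tree a b) : M.span.Adj a b := by
  obtain ⟨p⟩ := M.connected w hw v hv
  obtain ⟨d, -, hd, hd'⟩ := p.exists_boundary_dart (halfTree M.tree a b) h2 h1
  have hadj : M.span.Adj d.fst d.snd := d.adj
  obtain ⟨e1, e2⟩ := halfTree_cross (M.tree_adj_of_span hadj).symm hd' hd
  rw [← e1, ← e2]
  exact hadj.symm

theorem span_adj_of_tree_adj {a b : X} (ha : a ∈ M.verts) (hb : b ∈ M.verts)
    (h : M.tree.Adj a b) : M.span.Adj a b :=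
  M.span_adj_of_separates ha hb (left_notMem_halfTree M.isTree.isAcyclic h)
    (mem_halfTree_self _ _)

/-- An edge in the orbit of an edge of `T` leaving `T` does not join two vertices of `T`. -/
theorem not_edge_of_halfEdge (s : M.HalfEdge) (g : G) {a b : X} (ha : a ∈ M.verts)
    (hb : b ∈ M.verts) (h : s(a, b) = s(g • s.1.1, g • s.1.2)) : False := by
  obtain ⟨h1, h2, h3⟩ := s.2
  have hadj : M.tree.Adj a b := by
    rw [← SimpleGraph.mem_edgeSet, h, SimpleGraph.mem_edgeSet, adj_smul_iff]
    exact M.tree_adj_of_edge h3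
  have h4 := (M.span_adj_iff.1 (M.span_adj_of_tree_adj ha hb hadj)).2.2.2
  have h5 := (M.existsUnique_edge _ (M.edges_subset h3)).unique
    ⟨h3, 1, by simp⟩ ⟨h4, g, by rw [Sym2.map_mk, h]⟩
  have h6 : s.1.2 ∈ s(a, b) := by rw [← h5]; exact Sym2.mem_mk_right _ _
  rcases Sym2.mem_iff.1 h6 with h7 | h7
  · exact h2 (h7 ▸ ha)
  · exact h2 (h7 ▸ hb)

/-- A vertex `v` of `T` which is on the side of the target of `e` satisfies `v ∈ C(e, T)`. -/
theorem beyond_of_mem (e : M.TreeEdge) {v : X} (hv : v ∈ M.verts)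
    (h : v ∈ halfTree M.tree e.1.1 e.1.2) : M.Beyond e v := by
  have he := M.span_adj_iff.1 e.2
  obtain ⟨p, hp⟩ := (M.connected e.1.1 he.2.1 v hv).exists_isPath
  refine ⟨p, hp, ?_⟩
  obtain ⟨d, hd, h1, h2⟩ := p.exists_boundary_dart (halfTree M.tree e.1.1 e.1.2)ᶜ
    (left_notMem_halfTree M.isTree.isAcyclic (M.tree_adj_of_span e.2)) (fun h' => h' h)
  have hadj : M.span.Adj d.fst d.snd := d.adj
  obtain ⟨e1, e2⟩ := halfTree_cross (M.tree_adj_of_span hadj) h1 (not_not.1 h2)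
  exact ⟨d, hd, Prod.ext e1 e2⟩

namespace StableLetters

variable {M} {t : M.StableLetters}

theorem SEdge.ne_bar (s : t.SEdge) : s ≠ s.bar := fun h =>
  by
  have h2 : s.2 = !s.2 := congrArg Prod.snd h
  cases h3 : s.2 <;> rw [h3] at h2 <;> cases h2

theorem SEdge.smul_bar_lift (s : t.SEdge) :
    s.elem • s.bar.lift.1 = s.lift.2 ∧ s.elem • s.bar.lift.2 = s.lift.1 := by
  rcases s with ⟨s, _ | _⟩
  · exact ⟨rfl, rfl⟩
  · exact ⟨smul_inv_smul _ _, smul_inv_smul _ _⟩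

theorem SEdge.lift_fst_mem (s : t.SEdge) : s.lift.1 ∈ M.verts := by
  rcases s with ⟨s, _ | _⟩
  · exact t.inv_smul_mem s
  · exact s.2.1

theorem SEdge.lift_eq (s : t.SEdge) :
    ∃ (f : M.HalfEdge) (g : G), s(s.lift.1, s.lift.2) = s(g • f.1.1, g • f.1.2) := by
  rcases s with ⟨s, _ | _⟩
  · exact ⟨s, (t.letter s)⁻¹, Sym2.eq_swap⟩
  · exact ⟨s, 1, by rw [one_smul, one_smul]; rfl⟩

theorem SEdge.adj (s : t.SEdge) : M.tree.Adj s.lift.1 s.lift.2 := by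
  obtain ⟨f, g, h⟩ := s.lift_eq
  rw [← SimpleGraph.mem_edgeSet, h, SimpleGraph.mem_edgeSet, adj_smul_iff]
  exact M.tree_adj_of_edge f.2.2.2

theorem SEdge.not_edge (s : t.SEdge) (g : G) {a b : X} (ha : a ∈ M.verts) (hb : b ∈ M.verts)
    (h : g • s.lift.1 = a) (h' : g • s.lift.2 = b) : False := by
  obtain ⟨f, k, hf⟩ := s.lift_eq
  refine M.not_edge_of_halfEdge f (g * k) ha hb ?_
  rw [← h, ← h', mul_smul, mul_smul]
  have := congrArg (Sym2.map fun x => g • x) hf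
  rwa [Sym2.map_mk, Sym2.map_mk] at this

theorem SEdge.lift_snd_notMem (s : t.SEdge) : s.lift.2 ∉ M.verts := fun h =>
  s.not_edge 1 s.lift_fst_mem h (one_smul _ _) (one_smul _ _)

/-- Two vertices of `T` are separated only by edges of the spanning tree, and the lift of `s` is not
one of them. -/
theorem SEdge.notMem_halfTree (s : t.SEdge) {v : X} (hv : v ∈ M.verts) :
    v ∉ halfTree M.tree s.lift.1 s.lift.2 := fun h =>
  s.lift_snd_notMem (M.span_adj_iff.1 (M.span_adj_of_separates s.lift_fst_mem hv
    (left_notMem_halfTree M.isTree.isAcyclic s.adj) h)).2.2.1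

variable (t)

/-- Every edge of the tree with origin in `T` is a translate by the stabilizer of its origin of the
lift of an edge of the quotient graph. -/
theorem exists_edge {v y : X} (hv : v ∈ M.verts) (h : M.tree.Adj v y) :
    ∃ g ∈ MulAction.stabilizer G v,
      (∃ e : M.TreeEdge, e.1.1 = v ∧ g • e.1.2 = y) ∨
      (∃ s : t.SEdge, s.lift.1 = v ∧ g • s.lift.2 = y) := by
  obtain ⟨e', ⟨he', g, hg⟩, -⟩ := M.existsUnique_edge s(v, y) h
  rw [Sym2.map_mk] at hg
  subst hg
  by_cases hgv : g • v ∈ M.verts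
  · have hst := M.mem_stabilizer_of_smul_mem hv hgv
    have hgv' : g • v = v := hst
    rw [hgv'] at he'
    refine ⟨g⁻¹, inv_mem hst, ?_⟩
    by_cases hgy : g • y ∈ M.verts
    · exact Or.inl ⟨⟨(v, g • y), M.span_adj_iff.2 ⟨(M.tree_adj_of_edge he').ne, hv, hgy, he'⟩⟩,
        rfl, inv_smul_smul _ _⟩
    · exact Or.inr ⟨(⟨(v, g • y), hv, hgy, he'⟩, true), rfl, inv_smul_smul _ _⟩
  · have hgy : g • y ∈ M.verts := by
      obtain ⟨w, hw, hwe⟩ := M.edge_meets _ he'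
      rcases Sym2.mem_iff.1 hwe with rfl | rfl
      · exact absurd hw hgv
      · exact hw
    -- Here the endpoint inside `T` is the image of `y`, so the edge is a reversed one; its lift
    -- with origin in `T` is obtained with the inverse of the stable letter.
    let f : M.HalfEdge := ⟨(g • y, g • v), hgy, hgv, by rwa [Sym2.eq_swap]⟩
    have h1 : ((t.letter f)⁻¹ * g) • v ∈ M.verts := by
      rw [mul_smul]; exact t.inv_smul_mem f
    have hst := M.mem_stabilizer_of_smul_mem hv h1
    refine ⟨((t.letter f)⁻¹ * g)⁻¹, inv_mem hst, Or.inr ⟨(f, false), ?_, ?_⟩⟩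
    · have : ((t.letter f)⁻¹ * g) • v = v := hst
      rwa [mul_smul] at this
    · show ((t.letter f)⁻¹ * g)⁻¹ • ((t.letter f)⁻¹ • (g • y)) = y
      rw [← mul_smul, ← mul_smul]
      simp

theorem stabilizer_subset_gens {v : X} (hv : v ∈ M.verts) {g : G}
    (hg : g ∈ MulAction.stabilizer G v) : g ∈ t.gens := Or.inl ⟨v, hv, hg⟩

theorem elem_mem_gens (s : t.SEdge) : s.elem ∈ t.gens :=
  Or.inr ⟨s, 1, one_mem _, (one_mul _).symm⟩

/-- Elements of a submonoid containing the vertex groups and the stable letters move `T` over the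
whole tree. -/
theorem mem_submonoid_of_gens (N : Submonoid G)
    (hN : ∀ v ∈ M.verts, ∀ g ∈ MulAction.stabilizer G v, g ∈ N)
    (hN' : ∀ s : t.SEdge, s.elem ∈ N) (g : G) : g ∈ N := by
  obtain ⟨v, hv⟩ := M.verts_nonempty
  -- The vertices lying in translates of `T` by elements of `N` are closed under adjacency, by
  -- `exists_edge`, hence are all the vertices.
  have key : ∀ x y : X, M.tree.Reachable x y → (∃ k ∈ N, k⁻¹ • x ∈ M.verts) →
      ∃ k ∈ N, k⁻¹ • y ∈ M.verts := by
    rintro x y ⟨p⟩ hx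
    by_contra hy
    obtain ⟨d, -, ⟨k, hk, hkv⟩, hd⟩ := p.exists_boundary_dart {x | ∃ k ∈ N, k⁻¹ • x ∈ M.verts} hx hy
    refine hd ?_
    have hadj : M.tree.Adj (k⁻¹ • d.fst) (k⁻¹ • d.snd) := M.adj_smul _ _ _ d.adj
    obtain ⟨h, hh, ⟨e, he, hey⟩ | ⟨s, hs, hsy⟩⟩ := t.exists_edge hkv hadj
    · refine ⟨k * h, mul_mem hk (hN _ hkv _ hh), ?_⟩
      rw [mul_inv_rev, mul_smul, ← hey, inv_smul_smul]
      exact (M.span_adj_iff.1 e.2).2.2.1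
    · refine ⟨k * h * s.elem, mul_mem (mul_mem hk (hN _ hkv _ hh)) (hN' s), ?_⟩
      rw [mul_inv_rev, mul_inv_rev, mul_smul, mul_smul, ← hsy, inv_smul_smul,
        ← (s.smul_bar_lift).1, inv_smul_smul]
      exact s.bar.lift_fst_mem
  obtain ⟨k, hk, hkv⟩ := key v (g • v) (M.isTree.connected.preconnected _ _)
    ⟨1, one_mem _, by simpa using hv⟩
  rw [← mul_smul] at hkv
  have := mul_mem hk (hN v hv _ (M.mem_stabilizer_of_smul_mem hv hkv))
  rwa [mul_inv_cancel_left] at this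

theorem closure_gens : Submonoid.closure t.gens = ⊤ :=
  top_unique fun g _ => t.mem_submonoid_of_gens _
    (fun _ hv _ hg => Submonoid.subset_closure (t.stabilizer_subset_gens hv hg))
    (fun s => Submonoid.subset_closure (t.elem_mem_gens s)) g

end StableLetters

end TreeMarking

end PingPong

namespace PingPong

/-! ### Chains of contractions -/

section Contracts

variable {G : Type*} [Group G]

/-- `g` is a product of elements of `S` which send successively `O` into members of the family `𝓞`,
the last of which is `O'`. -/
inductive Contracts (ρ : G →* HomeoPlus) (S : Set G) (𝓞 : Set (Set S1)) :
    G → Set S1 → Set S1 → Prop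
  | refl (O : Set S1) (hO : O ∈ 𝓞) : Contracts ρ S 𝓞 1 O O
  | step {g : G} {O O' : Set S1} (h : Contracts ρ S 𝓞 g O O') {k : G} (hk : k ∈ S) {O'' : Set S1}
      (hO : O'' ∈ 𝓞) (hsub : img ρ k O' ⊆ O'') : Contracts ρ S 𝓞 (k * g) O O''

variable {ρ : G →* HomeoPlus} {S : Set G} {𝓞 : Set (Set S1)}

theorem Contracts.single {k : G} {O O' : Set S1} (hk : k ∈ S) (hO : O ∈ 𝓞) (hO' : O' ∈ 𝓞)
    (hsub : img ρ k O ⊆ O') : Contracts ρ S 𝓞 k O O' := by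
  have := Contracts.step (Contracts.refl (ρ := ρ) (S := S) O hO) hk hO' hsub
  rwa [mul_one] at this

theorem Contracts.img_subset {g : G} {O O' : Set S1} (h : Contracts ρ S 𝓞 g O O') :
    img ρ g O ⊆ O' := by
  induction h with
  | refl O hO => rw [img_one]
  | step h hk hO hsub ih =>
    rw [img_mul]
    exact (img_mono ρ _ ih).trans hsub

theorem Contracts.mem_right {g : G} {O O' : Set S1} (h : Contracts ρ S 𝓞 g O O') : O' ∈ 𝓞 := by
  cases h with
  | refl O hO => exact hO
  | step h hk hO hsub => exact hO

theorem Contracts.trans {g k : G} {O O' O'' : Set S1} (h : Contracts ρ S 𝓞 g O O')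
    (h' : Contracts ρ S 𝓞 k O' O'') : Contracts ρ S 𝓞 (k * g) O O'' := by
  induction h' with
  | refl O hO => rwa [one_mul]
  | step h' hk hO hsub ih =>
    rw [mul_assoc]
    exact (ih h).step hk hO hsub

theorem Contracts.pow {g : G} {O : Set S1} (hO : O ∈ 𝓞) (h : Contracts ρ S 𝓞 g O O) (n : ℕ) :
    Contracts ρ S 𝓞 (g ^ n) O O := by
  induction n with
  | zero => rw [pow_zero]; exact Contracts.refl O hO
  | succ n ih => rw [pow_succ']; exact ih.trans h

end Contracts

/-! ### Ping-pong along the paths of the tree. -/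

namespace Family

open TreeMarking TreeMarking.StableLetters

variable {G : Type*} [Group G] {X : Type*} [MulAction G X] {M : TreeMarking G X}
  {t : M.StableLetters} (Θ : Family t)

theorem U_mem_atoms (e : t.Edge) : Θ.U e ∈ Θ.atoms := Or.inl ⟨e, rfl⟩

theorem V_mem_atoms (s : t.SEdge) : Θ.V s ∈ Θ.atoms := Or.inr ⟨s, rfl⟩

theorem U_subset_UV {e : t.Edge} {v : X} (h : e.origin = v) : Θ.U e ⊆ Θ.UV v :=
  Set.subset_iUnion (fun e : {e : t.Edge // e.origin = v} => Θ.U e.1) ⟨e, h⟩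

theorem connectedComponentIn_mem_intervals {O : Set S1} (hO : O ∈ Θ.atoms) {x : S1} (hx : x ∈ O) :
    connectedComponentIn O x ∈ Θ.intervals := ⟨O, hO, x, hx, rfl⟩

theorem exists_interval_of_subset_atom {O P : Set S1} (hO : O ∈ Θ.atoms) (hP : IsPreconnected P)
    (hPn : P.Nonempty) (hPO : P ⊆ O) : ∃ I ∈ comps O, I ∈ Θ.intervals ∧ P ⊆ I := by
  obtain ⟨x, hx⟩ := hPn
  exact ⟨_, ⟨x, hPO hx, rfl⟩, Θ.connectedComponentIn_mem_intervals hO (hPO hx),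
    hP.subset_connectedComponentIn hx hPO⟩

variable {Θ} in
/-- A chain of contractions of atoms gives chains of contractions of their components. -/
theorem exists_contracts_intervals {ρ : G →* HomeoPlus} {S : Set G} {g : G} {O O' : Set S1}
    (h : Contracts ρ S Θ.atoms g O O') :
    ∀ I ∈ comps O, ∃ I' ∈ comps O', Contracts ρ S Θ.intervals g I I' := by
  induction h with
  | refl O hO => exact fun I hI => ⟨I, hI, .refl I ⟨O, hO, hI⟩⟩
  | step h hk hO hsub ih =>
    intro I hI
    obtain ⟨I', hI', hc⟩ := ih I hI
    obtain ⟨x, hx, rfl⟩ := hI'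
    obtain ⟨I'', h1, h2, h3⟩ := Θ.exists_interval_of_subset_atom hO
      (isPreconnected_img ρ _ isPreconnected_connectedComponentIn)
      ⟨_, act_mem_img ρ (mem_connectedComponentIn hx)⟩
      ((img_mono ρ _ (connectedComponentIn_subset _ _)).trans hsub)
    exact ⟨I'', h1, hc.step hk h2 h3⟩

/-- The atom `O` is the place where the ping-pong puts the points associated with the vertex `u`
outside of `T`. -/
def Located (O : Set S1) (u : X) : Prop :=
  (∃ s : t.SEdge, O = Θ.V s ∧ u ∈ halfTree M.tree s.lift.1 s.lift.2) ∨
  ∃ e : t.Edge, O = Θ.U e ∧ ∃ g, e.Outer g ∧ u ∈ halfTree M.tree (g • e.lift.1) (g • e.lift.2)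

theorem edge_adj (e : t.Edge) : M.tree.Adj e.lift.1 e.lift.2 := by
  rcases e with e | s
  · exact M.tree_adj_of_span e.2
  · exact s.adj

theorem edge_lift_fst_mem (e : t.Edge) : e.lift.1 ∈ M.verts := by
  rcases e with e | s
  · exact (M.span_adj_iff.1 e.2).2.1
  · exact s.lift_fst_mem

theorem outer_smul_notMem {e : t.Edge} {g : G} (hg : e.Outer g) : g • e.lift.2 ∉ M.verts := by
  intro h
  have hg1 : g • e.lift.1 = e.lift.1 := hg.1
  rcases e with e | s
  · exact hg.2 ⟨hg.1, M.mem_stabilizer_of_smul_mem (M.span_adj_iff.1 e.2).2.2.1 h⟩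
  · exact s.not_edge g s.lift_fst_mem h hg1 rfl

variable {Θ} in
-- Both kinds of location yield an edge leaving `T` with `u` behind it, starting at the vertex to
-- which the atom is attached.
theorem Located.exists_edge {O : Set S1} {u : X} (h : Θ.Located O u) :
    ∃ v ∈ M.verts, ∃ y, y ∉ M.verts ∧ M.tree.Adj v y ∧ u ∈ halfTree M.tree v y ∧
      ((∃ s : t.SEdge, O = Θ.V s ∧ s.lift.1 = v ∧ u ∈ halfTree M.tree s.lift.1 s.lift.2) ∨
        ∃ e : t.Edge, O = Θ.U e ∧ e.origin = v) := by
  rcases h with ⟨s, rfl, hu⟩ | ⟨e, rfl, g, hg, hu⟩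
  · exact ⟨_, s.lift_fst_mem, _, s.lift_snd_notMem, s.adj, hu, Or.inl ⟨s, rfl, rfl, hu⟩⟩
  · have hg1 : g • e.lift.1 = e.lift.1 := hg.1
    rw [hg1] at hu
    refine ⟨_, edge_lift_fst_mem e, _, outer_smul_notMem hg, ?_, hu, Or.inr ⟨e, rfl, rfl⟩⟩
    have := (M.adj_smul_iff g).2 (edge_adj e)
    rwa [hg1] at this

/-- The half-tree behind `y` contains no vertex of `T`, so the spanning edge `e` does not cut it: it
lies entirely on the same side of `e` as `v`. -/
theorem mem_halfTree_of_leaves {v y : X} (hv : v ∈ M.verts) (hy : y ∉ M.verts)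
    (hvy : M.tree.Adj v y) (e : M.TreeEdge) {u : X} (hu : u ∈ halfTree M.tree v y)
    (hue : u ∈ halfTree M.tree e.1.1 e.1.2) : v ∈ halfTree M.tree e.1.1 e.1.2 := by
  have he := M.span_adj_iff.1 e.2
  have hadj := M.tree_adj_of_span e.2
  by_contra hn
  have hy' : y ∉ halfTree M.tree e.1.1 e.1.2 := fun h =>
    hy ((halfTree_cross hvy hn h).2 ▸ he.2.2.1)
  have hsub : halfTree M.tree v y ⊆ halfTree M.tree e.1.2 e.1.1 := by
    refine halfTree_subset ((mem_halfTree_or M.isTree.connected _ _ _).resolve_left hy') fun h => ?_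
    exact hy (M.span_adj_iff.1 (M.span_adj_of_separates hv he.2.2.1
      (left_notMem_halfTree M.isTree.isAcyclic hvy) h)).2.2.1
  exact notMem_halfTree_swap M.isTree.isAcyclic hadj hue (hsub hu)

section PingPong

variable {Θ} {ρ : G →* HomeoPlus} (hΘ : Θ.IsPingPong ρ)

include hΘ

theorem Located.outer_tree {O : Set S1} {u : X} (h : Θ.Located O u) {e : M.TreeEdge}
    (hu : u ∈ halfTree M.tree e.1.1 e.1.2) {g : G} (hg : (t.ofTree e).Outer g) :
    img ρ g O ⊆ Θ.U (t.ofTree e) := by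
  obtain ⟨v, hv, y, hy, hadj, huy, ⟨s, rfl, rfl, -⟩ | ⟨e', rfl, he'⟩⟩ := h.exists_edge
  · exact hΘ.interactive.outer_tree_Z e g hg s
      (M.beyond_of_mem e hv (mem_halfTree_of_leaves hv hy hadj e huy hu))
  · exact (img_mono ρ g (Θ.U_subset_UV he')).trans (hΘ.interactive.outer_tree_P e g hg v hv
      (M.beyond_of_mem e hv (mem_halfTree_of_leaves hv hy hadj e huy hu)))

/-- The set attached to `s.bar` is the only one which `s` need not contract, and `hu` excludes it.
-/
theorem Located.letter {O : Set S1} {u : X} (h : Θ.Located O u) {s : t.SEdge}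
    (hu : u ∉ halfTree M.tree s.bar.lift.1 s.bar.lift.2) : img ρ s.elem O ⊆ Θ.V s := by
  obtain ⟨v, hv, y, hy, hadj, huy, ⟨s', rfl, rfl, hus⟩ | ⟨e', rfl, he'⟩⟩ := h.exists_edge
  · exact hΘ.interactive.letter_Z s s' fun h => hu (h ▸ hus)
  · exact (img_mono ρ _ (Θ.U_subset_UV he')).trans (hΘ.interactive.letter_P s v hv)

/-- Main ping-pong argument: if the elements of the stabilizer of `p` contract `O₀`, then so does
every `k` such that the half-tree `k • halfTree p q` does not contain `T`. -/
theorem exists_contracts_of_path {p q : X} (hp : p ∈ M.verts) (hpq : M.tree.Adj p q)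
    {O₀ : Set S1} {u₀ : X} (hu₀ : u₀ ∈ halfTree M.tree p q)
    (seed : ∀ k ∈ MulAction.stabilizer G p,
      ∃ O, Contracts ρ t.gens Θ.atoms k O₀ O ∧ Θ.Located O (k • u₀)) (n : ℕ) :
    ∀ (k : G) (v z : X) (w : M.tree.Walk v z), w.IsPath → w.length = n → z = k • p →
      v ∈ M.verts → v ∉ halfTree M.tree (k • p) (k • q) →
      ∃ O, Contracts ρ t.gens Θ.atoms k O₀ O ∧ Θ.Located O (k • u₀) := by
  induction n with
  | zero =>
    intro k v z w hw hl hz hv hvk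
    have hvz := SimpleGraph.Walk.eq_of_length_eq_zero hl
    subst hvz
    exact seed k (M.mem_stabilizer_of_smul_mem hp (hz ▸ hv))
  | succ n ih =>
    intro k v z w hw hl hz hv hvk
    by_cases hkp : k • p ∈ M.verts
    · exact seed k (M.mem_stabilizer_of_smul_mem hp hkp)
    cases w with
    | nil => simp at hl
    | @cons _ x _ hvx w' =>
    rw [SimpleGraph.Walk.cons_isPath_iff] at hw
    have hl' : w'.length = n := by simpa using hl
    have hx : x ∉ halfTree M.tree (k • p) (k • q) := fun h =>
      hkp ((halfTree_cross hvx hvk h).1 ▸ hv)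
    -- A step inside `T` only shortens the walk; `k` is unchanged.
    by_cases hxv : x ∈ M.verts
    · exact ih k x z w' hw.1 hl' hz hxv hx
    have hkpx : k • p ∈ halfTree M.tree v x :=
      hz ▸ mem_halfTree_of_walk w' (mem_halfTree_self _ _) hw.2
    have hkqx : k • q ∈ halfTree M.tree v x := by
      by_contra h
      have := (halfTree_cross ((M.adj_smul_iff k).2 hpq).symm h hkpx).1
      exact hvk (this ▸ mem_halfTree_self _ _)
    have hux : k • u₀ ∈ halfTree M.tree v x :=
      halfTree_subset hkqx hvk ((M.smul_mem_halfTree k).2 hu₀)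
    -- The walk leaves `T` by the `h`-translate of a lifted edge. Removing `h`, and the stable
    -- letter if there is one, from the left of `k` brings the rest of the walk back to a start in
    -- `T`, where the induction applies.
    obtain ⟨h, hh, ⟨e, rfl, rfl⟩ | ⟨s, rfl, rfl⟩⟩ := t.exists_edge hv hvx
    · have hh1 : h • e.1.1 = e.1.1 := hh
      have hout : (t.ofTree e).Outer h := ⟨hh, fun h' => hxv (by
        have : h • e.1.2 = e.1.2 := h'.2
        rw [this]
        exact (M.span_adj_iff.1 e.2).2.2.1)⟩
      have hue : (h⁻¹ * k) • u₀ ∈ halfTree M.tree e.1.1 e.1.2 := by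
        rw [mul_smul, ← M.mem_halfTree_smul, hh1]
        exact hux
      obtain ⟨O, hO, hL⟩ := ih (h⁻¹ * k) _ _ (w'.map (M.smulHom h⁻¹))
        (hw.1.map (MulAction.injective h⁻¹))
        (by rw [SimpleGraph.Walk.length_map]; exact hl')
        (by rw [mul_smul, ← hz]; rfl)
        (by
          show h⁻¹ • h • e.1.2 ∈ M.verts
          rw [inv_smul_smul]
          exact (M.span_adj_iff.1 e.2).2.2.1)
        (by
          show h⁻¹ • h • e.1.2 ∉ _
          rw [mul_smul, mul_smul, M.smul_mem_halfTree]
          exact hx)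
      have hc := hO.step (t.stabilizer_subset_gens hv hh) (Θ.U_mem_atoms (t.ofTree e))
        (hL.outer_tree hΘ hue hout)
      rw [mul_inv_cancel_left] at hc
      refine ⟨_, hc, Or.inr ⟨t.ofTree e, rfl, h, hout, ?_⟩⟩
      have : k • u₀ ∈ halfTree M.tree (h • e.1.1) (h • e.1.2) := by rwa [hh1]
      exact this
    · have hh1 : h • s.lift.1 = s.lift.1 := hh
      set k' := s.elem⁻¹ * (h⁻¹ * k) with hk'
      have hus : (h⁻¹ * k) • u₀ ∈ halfTree M.tree s.lift.1 s.lift.2 := by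
        rw [mul_smul, ← M.mem_halfTree_smul, hh1]
        exact hux
      -- The vertex obtained by induction is not behind `s.bar`: there is no cancellation, and `s`
      -- contracts.
      have hus' : k' • u₀ ∉ halfTree M.tree s.bar.lift.1 s.bar.lift.2 := by
        rw [hk', mul_smul, ← M.mem_halfTree_smul, s.smul_bar_lift.1, s.smul_bar_lift.2]
        exact notMem_halfTree_swap M.isTree.isAcyclic s.adj hus
      have hstart : (s.elem⁻¹ * h⁻¹) • h • s.lift.2 = s.bar.lift.1 := by
        rw [mul_smul, inv_smul_smul, ← s.smul_bar_lift.1, inv_smul_smul]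
      obtain ⟨O, hO, hL⟩ := ih k' _ _ (w'.map (M.smulHom (s.elem⁻¹ * h⁻¹)))
        (hw.1.map (MulAction.injective _))
        (by rw [SimpleGraph.Walk.length_map]; exact hl')
        (by rw [hk', ← mul_assoc, mul_smul, ← hz]; rfl)
        (by
          show (s.elem⁻¹ * h⁻¹) • h • s.lift.2 ∈ M.verts
          rw [hstart]
          exact s.bar.lift_fst_mem)
        (by
          show (s.elem⁻¹ * h⁻¹) • h • s.lift.2 ∉ _
          rw [hk', ← mul_assoc, mul_smul _ k, mul_smul _ k, M.smul_mem_halfTree]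
          exact hx)
      have hc := hO.step (t.elem_mem_gens s) (Θ.V_mem_atoms s) (hL.letter hΘ hus')
      by_cases hg : h ∈ s.group
      · have hc' := hc.step (t.stabilizer_subset_gens hv hh) (Θ.V_mem_atoms s)
          (hΘ.interactive.edgeGroup_Z s h hg)
        rw [hk', mul_inv_cancel_left, mul_inv_cancel_left] at hc'
        have hh2 : h • s.lift.2 = s.lift.2 := hg.2
        rw [hh2] at hux
        exact ⟨_, hc', Or.inl ⟨s, rfl, hux⟩⟩
      · have hout : s.toEdge.Outer h := ⟨hh, hg⟩
        have hc' := hc.step (t.stabilizer_subset_gens hv hh) (Θ.U_mem_atoms s.toEdge)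
          (hΘ.outer_V s h hout)
        rw [hk', mul_inv_cancel_left, mul_inv_cancel_left] at hc'
        refine ⟨_, hc', Or.inr ⟨s.toEdge, rfl, h, hout, ?_⟩⟩
        have : k • u₀ ∈ halfTree M.tree (h • s.lift.1) (h • s.lift.2) := by rwa [hh1]
        exact this

theorem exists_contracts {p q : X} (hp : p ∈ M.verts) (hpq : M.tree.Adj p q)
    {O₀ : Set S1} {u₀ : X} (hu₀ : u₀ ∈ halfTree M.tree p q)
    (seed : ∀ k ∈ MulAction.stabilizer G p,
      ∃ O, Contracts ρ t.gens Θ.atoms k O₀ O ∧ Θ.Located O (k • u₀)) (k : G) {v : X}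
    (hv : v ∈ M.verts) (hvk : v ∉ halfTree M.tree (k • p) (k • q)) :
    ∃ O, Contracts ρ t.gens Θ.atoms k O₀ O := by
  obtain ⟨w, hw⟩ := (M.isTree.connected.preconnected v (k • p)).exists_isPath
  obtain ⟨O, hO, -⟩ := exists_contracts_of_path hΘ hp hpq hu₀ seed _ k v _ w hw rfl rfl hv hvk
  exact ⟨O, hO⟩

end PingPong

end Family

end PingPong

/-! ### Existence of an element contracting an arc. -/

namespace PingPong

theorem halfTree_disjoint {X : Type*} {Γ : SimpleGraph X} (hΓ : Γ.IsTree) {b y y' u : X}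
    (h : Γ.Adj b y) (h' : Γ.Adj b y') (hne : y ≠ y') (hu : u ∈ halfTree Γ b y) :
    u ∉ halfTree Γ b y' := by
  have h1 : y ∉ halfTree Γ b y' := fun hy =>
    hne (halfTree_cross h (left_notMem_halfTree hΓ.isAcyclic h') hy).2
  have h2 : y' ∉ halfTree Γ b y := fun hy =>
    hne (halfTree_cross h' (left_notMem_halfTree hΓ.isAcyclic h) hy).2.symm
  have h3 := halfTree_subset ((mem_halfTree_or hΓ.connected b y' y).resolve_left h1) h2
  exact fun hu' => notMem_halfTree_swap hΓ.isAcyclic h' hu' (h3 hu)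

namespace TreeMarking

variable {G : Type*} [Group G] {X : Type*} [MulAction G X] (M : TreeMarking G X)

section Nested

variable {M} {p q : X} (hpq : M.tree.Adj p q) {w : G} (hw : w • p ∈ halfTree M.tree p q)
  (hw' : p ∉ halfTree M.tree (w • p) (w • q))

include hpq hw hw'

/-- The hypotheses on `w` mean that it maps the half-tree behind `(p, q)` into itself, so the
translates by powers are nested. -/
theorem nested_pow (n : ℕ) :
    halfTree M.tree (w ^ n • p) (w ^ n • q) ⊆ halfTree M.tree p q := by
  induction n with
  | zero => rw [pow_zero, one_smul, one_smul]
  | succ n ih =>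
    refine Set.Subset.trans (fun u hu => ?_) ih
    rw [pow_succ, mul_smul, mul_smul, M.mem_halfTree_smul] at hu
    rw [M.mem_halfTree_smul]
    refine halfTree_subset ?_ hw' hu
    by_contra h
    have := (halfTree_cross ((M.adj_smul_iff w).2 hpq).symm h hw).1
    exact hw' (this ▸ mem_halfTree_self _ _)

/-- A walk enters the half-tree of index `n + 1` through its vertex `w ^ (n + 1) • p`, which is
already in the half-tree of index `n`; each level costs at least one step. -/
theorem lt_length_of_nested (n : ℕ) : ∀ (z : X) (W : M.tree.Walk p z),
    z ∈ halfTree M.tree (w ^ n • p) (w ^ n • q) → n < W.length := by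
  classical
  have hac := M.isTree.isAcyclic
  induction n with
  | zero =>
    intro z W hz
    rw [pow_zero, one_smul, one_smul] at hz
    by_contra h
    have := SimpleGraph.Walk.eq_of_length_eq_zero (p := W) (by omega)
    exact left_notMem_halfTree hac hpq (this ▸ hz)
  | succ n ih =>
    intro z W hz
    have hadj := (M.adj_smul_iff (w ^ (n + 1))).2 hpq
    obtain ⟨d, hd, h1, h2⟩ := W.exists_boundary_dart
      (halfTree M.tree (w ^ (n + 1) • p) (w ^ (n + 1) • q))ᶜ
      (fun h => left_notMem_halfTree hac hpq (nested_pow hpq hw hw' _ h)) (fun h => h hz)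
    obtain ⟨e1, -⟩ := halfTree_cross d.adj h1 (not_not.1 h2)
    have hmem := W.dart_fst_mem_support_of_mem_darts hd
    rw [e1] at hmem
    have h3 := ih _ (W.takeUntil _ hmem) (by
      rw [pow_succ, mul_smul]
      exact (M.smul_mem_halfTree _).2 hw)
    have h4 := W.length_takeUntil_lt_length hmem (fun h => left_notMem_halfTree hac hadj (by
      rw [h] at hadj
      have hz' := hz
      rw [← h] at hz'
      exact hz'))
    omega

end Nested

/-- Two vertex groups of the spanning tree which are both larger than the groups of the first edges
of the path between the two vertices. -/
structure VertexPair where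
  e : M.TreeEdge
  f : M.TreeEdge
  memE : f.1.1 ∈ halfTree M.tree e.1.1 e.1.2
  memF : e.1.1 ∈ halfTree M.tree f.1.1 f.1.2
  h : G
  k : G
  h_smul : h • e.1.1 = e.1.1
  h_smul' : h • e.1.2 ≠ e.1.2
  k_smul : k • f.1.1 = f.1.1
  k_smul' : k • f.1.2 ≠ f.1.2

/-- If no pair exists, every path in the spanning tree has an end whose group fixes the first edge.
Then a vertex group of maximal order contains all the others, and since there are no stable letters
it is the whole of `G`, which is finite. -/
theorem exists_vertexPair [IsEmpty M.HalfEdge] (t : M.StableLetters) (hG : ¬ VirtuallyCyclic G) :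
    Nonempty M.VertexPair := by
  by_contra hno
  have hpair : ∀ e f : M.TreeEdge, f.1.1 ∈ halfTree M.tree e.1.1 e.1.2 →
      e.1.1 ∈ halfTree M.tree f.1.1 f.1.2 →
      (∀ h : G, h • e.1.1 = e.1.1 → h • e.1.2 = e.1.2) ∨
      (∀ h : G, h • f.1.1 = f.1.1 → h • f.1.2 = f.1.2) := by
    intro e f h1 h2
    by_contra h
    push Not at h
    obtain ⟨⟨h, h3, h4⟩, k, h5, h6⟩ := h
    exact hno ⟨⟨e, f, h1, h2, h, k, h3, h4, h5, h6⟩⟩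
  have := M.finite_stabilizer
  obtain ⟨c, hc, hmax⟩ := Set.exists_max_image M.verts
    (fun v => Nat.card (MulAction.stabilizer G v)) M.cocompact M.verts_nonempty
  -- The path is shortened at an end whose group fixes its first edge. At `c`, maximality turns the
  -- inclusion into an equality, so that the next vertex replaces `c`; at `b`, the inclusion goes in
  -- the needed direction.
  have hle : ∀ (n : ℕ) (c b : X) (W : M.span.Walk c b), W.IsPath → W.length = n → c ∈ M.verts →
      (∀ v ∈ M.verts, Nat.card (MulAction.stabilizer G v) ≤
        Nat.card (MulAction.stabilizer G c)) →
      MulAction.stabilizer G b ≤ MulAction.stabilizer G c := by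
    intro n
    induction n with
    | zero =>
      intro c b W _ hl _ _
      rw [SimpleGraph.Walk.eq_of_length_eq_zero hl]
    | succ n ih =>
      intro c b W hW hl hc hmax
      have hacyc := M.isTree.isAcyclic
      have hend : ∀ {c b : X} (W : M.span.Walk c b), W.IsPath → W.length = n + 1 →
          ∃ c₁, ∃ (_ : M.span.Adj c c₁) (W₁ : M.span.Walk c₁ b), W₁.IsPath ∧ W₁.length = n ∧
            b ∈ halfTree M.tree c c₁ := by
        intro c b W hW hl
        cases W with
        | nil => simp at hl
        | @cons _ x _ hadj q =>
          rw [SimpleGraph.Walk.cons_isPath_iff] at hW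
          refine ⟨x, hadj, q, hW.1, by simpa using hl, ?_⟩
          refine mem_halfTree_of_walk (q.mapLe M.span_le) (mem_halfTree_self _ _) ?_
          rw [SimpleGraph.Walk.support_mapLe_eq_support]
          exact hW.2
      obtain ⟨c₁, hcc₁, W₁, hW₁, hl₁, hb⟩ := hend W hW hl
      obtain ⟨b₁, hbb₁, W₂, hW₂, hl₂, hc'⟩ := hend W.reverse hW.reverse
        (by rw [SimpleGraph.Walk.length_reverse, hl])
      rcases hpair ⟨(c, c₁), hcc₁⟩ ⟨(b, b₁), hbb₁⟩ hb hc' with h | h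
      · have h1 : MulAction.stabilizer G c ≤ MulAction.stabilizer G c₁ := fun g hg => h g hg
        have hc₁ := (M.span_adj_iff.1 hcc₁).2.2.1
        have h2 : MulAction.stabilizer G c = MulAction.stabilizer G c₁ :=
          Subgroup.eq_of_le_of_card_ge h1 (hmax c₁ hc₁)
        rw [h2]
        exact ih c₁ b W₁ hW₁ hl₁ hc₁ (h2 ▸ hmax)
      · have h1 : MulAction.stabilizer G b ≤ MulAction.stabilizer G b₁ := fun g hg => h g hg
        exact h1.trans (ih c b₁ W₂.reverse hW₂.reverse
          (by rw [SimpleGraph.Walk.length_reverse, hl₂]) hc hmax)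
  have hall : ∀ g : G, g ∈ MulAction.stabilizer G c := fun g =>
    t.mem_submonoid_of_gens (MulAction.stabilizer G c).toSubmonoid
      (fun v hv g hg => by
        have hr : M.span.Reachable c v := M.connected c hc v hv
        obtain ⟨W, hW⟩ := hr.exists_isPath
        exact hle _ c v W hW rfl hc hmax hg)
      (fun s => isEmptyElim s.1) g
  have : Finite G := by
    have := M.finite_stabilizer c
    exact Finite.of_injective (fun g => (⟨g, hall g⟩ : MulAction.stabilizer G c))
      fun a b h => congrArg Subtype.val h
  exact hG ⟨⊥, inferInstance, inferInstance⟩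

end TreeMarking

namespace Family

open TreeMarking TreeMarking.StableLetters

variable {G : Type*} [Group G] {X : Type*} [MulAction G X] {M : TreeMarking G X}
  {t : M.StableLetters} {Θ : Family t} {ρ : G →* HomeoPlus} (hΘ : Θ.IsPingPong ρ)

theorem edge_origin_mem (e : t.Edge) : e.origin ∈ M.verts := edge_lift_fst_mem e

include hΘ

theorem atoms_eq_of_mem {O O' : Set S1} (hO : O ∈ Θ.atoms) (hO' : O' ∈ Θ.atoms) {x : S1}
    (hx : x ∈ O) (hx' : x ∈ O') : O = O' := by
  have hUV : ∀ (e : t.Edge) (s : t.SEdge), x ∈ Θ.U e → x ∈ Θ.V s → False := fun e s h h' =>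
    Set.disjoint_left.1 (hΘ.interactive.disjoint_PZ _ (edge_origin_mem e) s)
      (Θ.U_subset_UV rfl h) h'
  rcases hO with ⟨e, rfl⟩ | ⟨s, rfl⟩ <;> rcases hO' with ⟨e', rfl⟩ | ⟨s', rfl⟩
  · by_cases ho : e.origin = e'.origin
    · by_contra hne
      exact Set.disjoint_left.1 (hΘ.disjoint_U e e' ho fun h => hne (h ▸ rfl)) hx hx'
    · exact absurd (Θ.U_subset_UV rfl hx') (Set.disjoint_left.1 (hΘ.interactive.disjoint_PP _
        (edge_origin_mem e) _ (edge_origin_mem e') ho) (Θ.U_subset_UV rfl hx))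
  · exact (hUV e s' hx hx').elim
  · exact (hUV e' s hx' hx).elim
  · by_contra hne
    exact Set.disjoint_left.1 (hΘ.interactive.disjoint_ZZ s s' fun h => hne (h ▸ rfl)) hx hx'

/-- Atoms that meet are equal, so components are disjoint; two disjoint non-empty atoms prevent a
component from being the whole circle. -/
theorem isArcSystem_of_disjoint {O₁ O₂ : Set S1} (h₁ : O₁ ∈ Θ.atoms)
    (hn₁ : O₁.Nonempty) (hn₂ : O₂.Nonempty) (hd : Disjoint O₁ O₂) :
    IsArcSystem Θ.intervals where
  isOpen := by
    rintro _ ⟨O, hO, x, hx, rfl⟩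
    have := (isOpenMap_coe.isQuotientMap continuous_coe
      exists_coe_eq).locallyPathConnectedSpace
    exact (hΘ.isOpen O hO).connectedComponentIn
  isPreconnected := by
    rintro _ ⟨O, hO, x, hx, rfl⟩
    exact isPreconnected_connectedComponentIn
  nonempty := by
    rintro _ ⟨O, hO, x, hx, rfl⟩
    exact ⟨x, mem_connectedComponentIn hx⟩
  ne_univ := by
    rintro _ ⟨O, hO, x, hx, rfl⟩ h
    obtain ⟨y₁, hy₁⟩ := hn₁
    obtain ⟨y₂, hy₂⟩ := hn₂
    have hu : ∀ y, y ∈ O := fun y =>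
      connectedComponentIn_subset O x (h ▸ Set.mem_univ y)
    have e1 := atoms_eq_of_mem hΘ hO h₁ (hu y₁) hy₁
    exact Set.disjoint_left.1 hd (e1 ▸ hu y₂) hy₂
  eq_of_mem := by
    rintro _ ⟨O, hO, x, hx, rfl⟩ _ ⟨O', hO', x', hx', rfl⟩ y hy hy'
    have h := atoms_eq_of_mem hΘ hO hO' (connectedComponentIn_subset _ _ hy)
      (connectedComponentIn_subset _ _ hy')
    subst h
    rw [connectedComponentIn_eq hy, connectedComponentIn_eq hy']

/-- A contraction of an atom into itself has a power which contracts a component into itself. -/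
theorem exists_contracting_interval {p q : X} (hp : p ∈ M.verts) (hpq : M.tree.Adj p q)
    {O₀ : Set S1} (hO₀ : O₀ ∈ Θ.atoms) (hn : O₀.Nonempty) {u₀ : X}
    (hu₀ : u₀ ∈ halfTree M.tree p q)
    (seed : ∀ k ∈ MulAction.stabilizer G p,
      ∃ O, Contracts ρ t.gens Θ.atoms k O₀ O ∧ Θ.Located O (k • u₀))
    {w : G} (hc : Contracts ρ t.gens Θ.atoms w O₀ O₀) (hw : w • p ∈ halfTree M.tree p q)
    (hw' : p ∉ halfTree M.tree (w • p) (w • q)) :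
    ∃ (w : G) (I : Set S1), I ∈ Θ.intervals ∧ Contracts ρ t.gens Θ.intervals w I I ∧
      ∀ g : G, ∃ (n : ℕ) (I' : Set S1), Contracts ρ t.gens Θ.intervals (g * w ^ n) I I' := by
  have hσ : ∀ I : comps O₀, ∃ I' : comps O₀, Contracts ρ t.gens Θ.intervals w I I' := fun I => by
    obtain ⟨I', h1, h2⟩ := exists_contracts_intervals hc I I.2
    exact ⟨⟨I', h1⟩, h2⟩
  -- `w` induces a self-map of a finite set of components; a component on a cycle is contracted into
  -- itself by a power of `w`.
  choose σ hσ using hσ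
  have hσn : ∀ (I : comps O₀) (n : ℕ), Contracts ρ t.gens Θ.intervals (w ^ n) I (σ^[n] I) := by
    intro I n
    induction n with
    | zero => rw [pow_zero]; exact .refl _ ⟨O₀, hO₀, I.2⟩
    | succ n ih =>
      rw [pow_succ', Function.iterate_succ_apply']
      exact ih.trans (hσ _)
  obtain ⟨x, hx⟩ := hn
  let J : comps O₀ := ⟨_, x, hx, rfl⟩
  have : Finite (comps O₀) := hΘ.finite_comps O₀ hO₀
  obtain ⟨m, n, hmn, hJ⟩ : ∃ m n : ℕ, m < n ∧ σ^[m] J = σ^[n] J := by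
    obtain ⟨m, n, hne, h⟩ := Finite.exists_ne_map_eq_of_infinite fun n : ℕ => σ^[n] J
    rcases lt_or_gt_of_ne hne with h' | h'
    · exact ⟨m, n, h', h⟩
    · exact ⟨n, m, h', h.symm⟩
  obtain ⟨r, rfl⟩ := Nat.exists_eq_add_of_lt hmn
  set I := σ^[m] J with hI
  have hII : Contracts ρ t.gens Θ.intervals (w ^ (r + 1)) I I := by
    have := hσn I (r + 1)
    rwa [hI, ← Function.iterate_add_apply, show r + 1 + m = m + r + 1 by ring, ← hJ] at this
  refine ⟨w ^ (r + 1), I, ⟨O₀, hO₀, I.2⟩, hII, fun g => ?_⟩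
  -- The length of a walk from `p` to `g⁻¹ • p` bounds the number of nested half-trees containing
  -- `g⁻¹ • p`; with that exponent the translate by `g` avoids `p`.
  obtain ⟨W⟩ := M.isTree.connected.preconnected p (g⁻¹ • p)
  obtain ⟨O, hO⟩ := exists_contracts hΘ hp hpq hu₀ seed (g * w ^ ((r + 1) * W.length)) hp (by
    rw [mul_smul, mul_smul, M.mem_halfTree_smul]
    intro h
    have := lt_length_of_nested hpq hw hw' _ _ W h
    nlinarith)
  obtain ⟨I', -, hI'⟩ := exists_contracts_intervals hO I I.2
  exact ⟨W.length, I', by rwa [← pow_mul]⟩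

section SCase

theorem isArcSystem_of_sEdge (s : t.SEdge) : IsArcSystem Θ.intervals := by
  refine isArcSystem_of_disjoint hΘ (Θ.V_mem_atoms s)
    (hΘ.interactive.nonempty_Z s) (hΘ.interactive.nonempty_Z s.bar)
    (hΘ.interactive.disjoint_ZZ s s.bar s.ne_bar)

/-- The base edge is the lift of `s`. The stable letter contracts `V_s` into itself and moves the
half-tree behind this edge into itself. -/
theorem exists_contracting_interval_of_sEdge (s : t.SEdge) :
    ∃ (w : G) (I : Set S1), I ∈ Θ.intervals ∧ Contracts ρ t.gens Θ.intervals w I I ∧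
      ∀ g : G, ∃ (n : ℕ) (I' : Set S1), Contracts ρ t.gens Θ.intervals (g * w ^ n) I I' := by
  refine exists_contracting_interval hΘ s.lift_fst_mem s.adj (Θ.V_mem_atoms s)
    (hΘ.interactive.nonempty_Z s) (mem_halfTree_self s.lift.1 s.lift.2) ?_ (w := s.elem)
    (.single (t.elem_mem_gens s) (Θ.V_mem_atoms s) (Θ.V_mem_atoms s)
      (hΘ.interactive.letter_Z s s s.ne_bar)) ?_ ?_
  · intro k hk
    have hgen := t.stabilizer_subset_gens s.lift_fst_mem hk
    by_cases hg : k ∈ s.group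
    · refine ⟨_, .single hgen (Θ.V_mem_atoms s) (Θ.V_mem_atoms s)
        (hΘ.interactive.edgeGroup_Z s k hg), Or.inl ⟨s, rfl, ?_⟩⟩
      have h2 : k • s.lift.2 = s.lift.2 := hg.2
      rw [h2]
      exact mem_halfTree_self _ _
    · exact ⟨_, .single hgen (Θ.V_mem_atoms s) (Θ.U_mem_atoms s.toEdge)
        (hΘ.outer_V s k ⟨hk, hg⟩), Or.inr ⟨s.toEdge, rfl, k, ⟨hk, hg⟩, mem_halfTree_self _ _⟩⟩
  · rw [← s.smul_bar_lift.1, ← (s.smul_bar_lift).2, M.smul_mem_halfTree, s.smul_bar_lift.2]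
    exact (mem_halfTree_or M.isTree.connected _ _ _).resolve_left
      (s.bar.notMem_halfTree s.lift_fst_mem)
  · rw [M.mem_halfTree_smul, ← (s.smul_bar_lift).2, inv_smul_smul, s.smul_bar_lift.2]
    intro h
    obtain ⟨e1, e2⟩ := halfTree_cross s.bar.adj (s.notMem_halfTree s.bar.lift_fst_mem) h
    -- Otherwise the lifts of `s` and `s.bar` coincide and the stable letter exchanges their two
    -- ends.
    refine M.no_inversion s.elem _ _ s.adj ⟨?_, ?_⟩
    · rw [← e1, s.smul_bar_lift.1]
    · rw [← e2, s.smul_bar_lift.2]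

end SCase

section VertexPairCase

omit hΘ in
theorem outer_of_treeEdge {e : M.TreeEdge} {g : G} (h1 : g • e.1.1 = e.1.1)
    (h2 : g • e.1.2 ≠ e.1.2) : (t.ofTree e).Outer g := ⟨h1, fun h => h2 h.2⟩

omit hΘ in
-- The translated edge leaves `T` at the origin of `e`, so no vertex of `T` is behind it, in
-- particular not the origin of `f`; and its own origin is already beyond `f`.
theorem halfTree_outer_subset (t : M.StableLetters) {e f : M.TreeEdge}
    (hf : e.1.1 ∈ halfTree M.tree f.1.1 f.1.2) {g : G} (h1 : g • e.1.1 = e.1.1)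
    (h2 : g • e.1.2 ≠ e.1.2) :
    halfTree M.tree (g • e.1.1) (g • e.1.2) ⊆ halfTree M.tree f.1.1 f.1.2 := by
  have hn : g • e.1.2 ∉ M.verts := outer_smul_notMem (outer_of_treeEdge (t := t) h1 h2)
  have hadj : M.tree.Adj (g • e.1.1) (g • e.1.2) :=
    (M.adj_smul_iff g).2 (M.tree_adj_of_span e.2)
  rw [h1] at hadj ⊢
  have hfv := (M.span_adj_iff.1 f.2).2.1
  refine halfTree_subset ?_ fun h => ?_
  · by_contra h
    exact hn ((halfTree_cross hadj.symm h hf).1 ▸ hfv)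
  · exact hn (M.span_adj_iff.1 (M.span_adj_of_separates (M.span_adj_iff.1 e.2).2.1 hfv
      (left_notMem_halfTree M.isTree.isAcyclic hadj) h)).2.2.1

theorem nonempty_of_treeEdge {e : M.TreeEdge} {g : G} (h1 : g • e.1.1 = e.1.1)
    (h2 : g • e.1.2 ≠ e.1.2) : (Θ.U (t.ofTree e)).Nonempty := by
  refine (hΘ.interactive.Q_subset e fun h => ?_).1
  have h3 : g ∈ MulAction.stabilizer G (t.ofTree e).origin := h1
  rw [h] at h3
  exact h2 h3.2

theorem isArcSystem_of_vertexPair (P : M.VertexPair) : IsArcSystem Θ.intervals := by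
  refine isArcSystem_of_disjoint hΘ (Θ.U_mem_atoms (t.ofTree P.e))
    (nonempty_of_treeEdge hΘ P.h_smul P.h_smul') (nonempty_of_treeEdge hΘ P.k_smul P.k_smul') ?_
  refine (hΘ.interactive.disjoint_PP P.e.1.1 (M.span_adj_iff.1 P.e.2).2.1 P.f.1.1
    (M.span_adj_iff.1 P.f.2).2.1 fun h => ?_).mono (Θ.U_subset_UV rfl) (Θ.U_subset_UV rfl)
  exact left_notMem_halfTree M.isTree.isAcyclic (M.tree_adj_of_span P.e.2) (h ▸ P.memE)

/-- This is the seed for `exists_contracts`. The path is followed towards the origin of `P.e` as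
long as `k` fixes the next vertex. At the first vertex moved, `k` is outer for the edge reached and
the interaction along that edge applies; if none is moved, `k` lies in the edge group of `P.e` and
preserves its set. -/
theorem contracts_of_path (P : M.VertexPair) {v z : X} (W : M.span.Walk v z) (hW : W.IsPath) (hz : z = P.e.1.1)
    (hv : v ∈ halfTree M.tree P.e.1.1 P.e.1.2) {k : G} (hk : k • v = v) :
    ∃ O, Contracts ρ t.gens Θ.atoms k (Θ.U (t.ofTree P.e)) O ∧ Θ.Located O (k • P.h • P.f.1.1) := by
  have hadjE := M.tree_adj_of_span P.e.2
  have hnot := left_notMem_halfTree M.isTree.isAcyclic hadjE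
  induction W with
  | nil => exact absurd (hz ▸ hv) hnot
  | @cons v x z hvx W' ih =>
    rw [SimpleGraph.Walk.cons_isPath_iff] at hW
    have hvT := (M.span_adj_iff.1 hvx).2.1
    have hgen := t.stabilizer_subset_gens hvT (MulAction.mem_stabilizer_iff.2 hk)
    have hax : P.e.1.1 ∈ halfTree M.tree v x := by
      rw [← hz]
      refine mem_halfTree_of_walk (W'.mapLe M.span_le) (mem_halfTree_self _ _) ?_
      rw [SimpleGraph.Walk.support_mapLe_eq_support]
      exact hW.2
    by_cases hkx : k • x = x
    · by_cases hxa : x = P.e.1.1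
      · subst hxa
        obtain ⟨-, rfl⟩ := halfTree_cross (M.tree_adj_of_span hvx).symm hnot hv
        refine ⟨_, .single hgen (Θ.U_mem_atoms _) (Θ.U_mem_atoms _)
          (hΘ.interactive.edgeGroup_Q P.e k ⟨hkx, hk⟩), Or.inr ⟨t.ofTree P.e, rfl, k * P.h,
            outer_of_treeEdge (by rw [mul_smul, P.h_smul, hkx]) ?_, ?_⟩⟩
        · intro h
          rw [mul_smul] at h
          exact P.h_smul' (smul_left_cancel k (h.trans hk.symm))
        · rw [← mul_smul, M.smul_mem_halfTree]
          exact P.memE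
      · refine ih hW.1 hz ?_ hkx
        by_contra hx
        exact hxa (halfTree_cross (M.tree_adj_of_span hvx).symm hx hv).1
    · let e' : M.TreeEdge := ⟨(v, x), hvx⟩
      have hout : (t.ofTree e').Outer k := outer_of_treeEdge (e := e') hk hkx
      refine ⟨_, .single hgen (Θ.U_mem_atoms _) (Θ.U_mem_atoms (t.ofTree e')) ?_,
        Or.inr ⟨t.ofTree e', rfl, k, hout, ?_⟩⟩
      · have haT := (M.span_adj_iff.1 P.e.2).2.1
        exact (img_mono ρ k (Θ.U_subset_UV rfl)).trans
          (hΘ.interactive.outer_tree_P e' k hout P.e.1.1 haT (M.beyond_of_mem e' haT hax))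
      · rw [M.smul_mem_halfTree]
        exact halfTree_outer_subset t (f := e') hax P.h_smul P.h_smul'
          ((M.smul_mem_halfTree P.h).2 P.memE)

/-- Ping-pong between the two facing vertices: `P.k` sends the set of `P.e` into that of `P.f`, and
`P.h` sends it back. The base edge is `P.f`. -/
theorem exists_contracting_interval_of_vertexPair (P : M.VertexPair) :
    ∃ (w : G) (I : Set S1), I ∈ Θ.intervals ∧ Contracts ρ t.gens Θ.intervals w I I ∧
      ∀ g : G, ∃ (n : ℕ) (I' : Set S1), Contracts ρ t.gens Θ.intervals (g * w ^ n) I I' := by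
  have haT := (M.span_adj_iff.1 P.e.2).2.1
  have hbT := (M.span_adj_iff.1 P.f.2).2.1
  have hadjF := M.tree_adj_of_span P.f.2
  have hfar : ∀ g : G, g • P.e.1.1 = P.e.1.1 → g • P.e.1.2 ≠ P.e.1.2 →
      g • P.f.1.1 ∈ halfTree M.tree P.f.1.1 P.f.1.2 := fun g h1 h2 =>
    halfTree_outer_subset t P.memF h1 h2 ((M.smul_mem_halfTree g).2 P.memE)
  have houtE : (t.ofTree P.e).Outer P.h := outer_of_treeEdge P.h_smul P.h_smul'
  have houtF : (t.ofTree P.f).Outer P.k := outer_of_treeEdge P.k_smul P.k_smul'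
  have hc1 : Contracts ρ t.gens Θ.atoms P.k (Θ.U (t.ofTree P.e)) (Θ.U (t.ofTree P.f)) :=
    .single (t.stabilizer_subset_gens hbT P.k_smul) (Θ.U_mem_atoms _) (Θ.U_mem_atoms _)
      ((img_mono ρ P.k (Θ.U_subset_UV rfl)).trans
        (hΘ.interactive.outer_tree_P P.f P.k houtF P.e.1.1 haT (M.beyond_of_mem P.f haT P.memF)))
  have hc2 : Contracts ρ t.gens Θ.atoms P.h (Θ.U (t.ofTree P.f)) (Θ.U (t.ofTree P.e)) :=
    .single (t.stabilizer_subset_gens haT P.h_smul) (Θ.U_mem_atoms _) (Θ.U_mem_atoms _)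
      ((img_mono ρ P.h (Θ.U_subset_UV rfl)).trans
        (hΘ.interactive.outer_tree_P P.e P.h houtE P.f.1.1 hbT (M.beyond_of_mem P.e hbT P.memE)))
  refine exists_contracting_interval hΘ hbT hadjF (Θ.U_mem_atoms (t.ofTree P.e))
    (nonempty_of_treeEdge hΘ P.h_smul P.h_smul') (hfar P.h P.h_smul P.h_smul') ?_
    (w := P.h * P.k) (hc1.trans hc2) ?_ ?_
  · intro k hk
    have hr : M.span.Reachable P.f.1.1 P.e.1.1 := M.connected _ hbT _ haT
    obtain ⟨W, hW⟩ := hr.exists_isPath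
    exact contracts_of_path hΘ P W hW rfl P.memE hk
  · rw [mul_smul, P.k_smul]
    exact hfar P.h P.h_smul P.h_smul'
  · rw [M.mem_halfTree_smul, mul_inv_rev, mul_smul]
    have h1 : P.h⁻¹ • P.e.1.1 = P.e.1.1 := inv_smul_eq_iff.2 P.h_smul.symm
    have h2 : P.h⁻¹ • P.e.1.2 ≠ P.e.1.2 := fun h => P.h_smul' (inv_smul_eq_iff.1 h).symm
    have h3 : P.k⁻¹ • P.f.1.1 = P.f.1.1 := inv_smul_eq_iff.2 P.k_smul.symm
    have h4 : P.k⁻¹ • P.f.1.2 ≠ P.f.1.2 := fun h => P.k_smul' (inv_smul_eq_iff.1 h).symm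
    have h5 := (M.smul_mem_halfTree P.k⁻¹).2 (hfar P.h⁻¹ h1 h2)
    rw [h3] at h5
    -- `P.k⁻¹` moves the edge `P.f`, and half-trees behind distinct edges at a vertex are disjoint.
    refine halfTree_disjoint M.isTree ?_ hadjF h4 h5
    have := (M.adj_smul_iff P.k⁻¹).2 hadjF
    rwa [h3] at this

end VertexPairCase

end Family

end PingPong

namespace PingPong

universe u

/-! ### A point attached to a contracted arc -/

theorem img_image_Ioo {G : Type*} [Group G] {ρ : G →* HomeoPlus} {F : CircleDeg1Liftˣ} {g : G}
    (hF : IsLift F (ρ g : S1 ≃ₜ S1)) (a b : ℝ) :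
    img ρ g (((↑) : ℝ → S1) '' Set.Ioo a b) = ((↑) : ℝ → S1) '' Set.Ioo (F a) (F b) := by
  have h : Set.Ioo (F a) (F b) = F '' Set.Ioo a b :=
    ((CircleDeg1Lift.toOrderIso F).image_Ioo a b).symm
  rw [h, Set.image_image, img, Set.image_image]
  exact Set.image_congr fun x _ => hF x

theorem int_eq_zero_of_arcs {a b u v : ℝ} {j : ℤ} (hab : b ≤ a + 1) (huv : u < v) (h1 : a ≤ u)
    (h2 : v ≤ b) (h3 : a ≤ u + j) (h4 : v + j ≤ b) : j = 0 := by
  have h5 : (j : ℝ) < 1 := by linarith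
  have h6 : (-1 : ℝ) < j := by linarith
  have h7 : j < 1 := by exact_mod_cast h5
  have h8 : -1 < j := by exact_mod_cast h6
  omega

/-- If `w` contracts the arc `I`, the limit `p` of the left endpoints of the arcs `wⁿ(I)` is fixed
by the elements preserving the family of arcs, and moved by the elements making them disjoint from
their image. -/
theorem exists_limit_point {G : Type*} [Group G] (ρ : G →* HomeoPlus) {I : Set S1}
    (hI : IsPreconnected I) (hIo : IsOpen I) (hIn : I.Nonempty) (hIu : I ≠ Set.univ) {w : G}
    (hw : img ρ w I ⊆ I) :
    ∃ p : ℝ, (∀ n : ℕ, (p : S1) ∈ closure (img ρ (w ^ n) I)) ∧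
      (∀ g : G, (∀ n : ℕ, ∃ m : ℕ, img ρ (g * w ^ m) I ⊆ img ρ (w ^ n) I) →
        (∀ n : ℕ, ∃ m : ℕ, img ρ (w ^ m) I ⊆ img ρ (g * w ^ n) I) → act ρ g p = p) ∧
      ∀ g : G, act ρ g p = p → ∀ n : ℕ, ¬ Disjoint (img ρ (g * w ^ n) I) (img ρ (w ^ n) I) := by
  obtain ⟨a, b, hab, hba, rfl⟩ := exists_eq_image_Ioo hI hIo hIn hIu
  -- The lift of `w` is chosen to map `[a, b]` into itself, so that the lifted endpoints `A n` and
  -- `B n` are monotone sequences of reals.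
  obtain ⟨W, hW, haW, hWb⟩ : ∃ W : CircleDeg1Liftˣ, IsLift W (ρ w : S1 ≃ₜ S1) ∧
      a ≤ W a ∧ W b ≤ b := by
    obtain ⟨W₀, hW₀⟩ := exists_isLift ρ w
    rw [img_image_Ioo hW₀] at hw
    obtain ⟨j, hj1, hj2⟩ := exists_int_of_image_subset hba ((units_lt_iff W₀).2 hab) hw
    refine ⟨_, hW₀.translate_mul j, ?_, ?_⟩ <;>
      rwa [Units.val_mul, CircleDeg1Lift.mul_apply, translate_apply']
  set A : ℕ → ℝ := fun n => (W ^ n : CircleDeg1Liftˣ) a with hA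
  set B : ℕ → ℝ := fun n => (W ^ n : CircleDeg1Liftˣ) b with hB
  have himg : ∀ n, img ρ (w ^ n) (((↑) : ℝ → S1) '' Set.Ioo a b) =
      ((↑) : ℝ → S1) '' Set.Ioo (A n) (B n) := fun n => img_image_Ioo (hW.pow n) a b
  have hAB : ∀ n, A n < B n := fun n => (units_lt_iff (W ^ n)).2 hab
  have hAm : Monotone A := monotone_nat_of_le_succ fun n => by
    have h : A (n + 1) = (W ^ n : CircleDeg1Liftˣ) (W a) := by
      rw [hA]; simp only; rw [pow_succ, Units.val_mul, CircleDeg1Lift.mul_apply]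
    rw [h]
    exact (units_le_iff (W ^ n)).2 haW
  have hBm : Antitone B := antitone_nat_of_succ_le fun n => by
    have h : B (n + 1) = (W ^ n : CircleDeg1Liftˣ) (W b) := by
      rw [hB]; simp only; rw [pow_succ, Units.val_mul, CircleDeg1Lift.mul_apply]
    rw [h]
    exact (units_le_iff (W ^ n)).2 hWb
  have hA0 : A 0 = a := by simp [hA]
  have hB0 : B 0 = b := by simp [hB]
  have haA : ∀ n, a ≤ A n := fun n => hA0 ▸ hAm (Nat.zero_le n)
  have hBb : ∀ n, B n ≤ b := fun n => hB0 ▸ hBm (Nat.zero_le n)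
  have hcross : ∀ n m, A n ≤ B m := fun n m =>
    (hAm (le_max_left n m)).trans ((hAB _).le.trans (hBm (le_max_right n m)))
  have hbdd : BddAbove (Set.range A) := ⟨B 0, by rintro _ ⟨n, rfl⟩; exact hcross n 0⟩
  set p := ⨆ n, A n with hp
  have hAp : ∀ n, A n ≤ p := fun n => le_ciSup hbdd n
  have hpB : ∀ n, p ≤ B n := fun n => ciSup_le fun m => hcross m n
  refine ⟨p, fun n => ?_, fun g h1 h2 => ?_, fun g hg n hd => ?_⟩
  · rw [himg]
    refine image_closure_subset_closure_image continuous_coe ⟨p, ?_, rfl⟩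
    rw [closure_Ioo (hAB n).ne]
    exact ⟨hAp n, hpB n⟩
  · obtain ⟨F₀, hF₀⟩ := exists_isLift ρ g
    obtain ⟨m₀, hm₀⟩ := h1 0
    have himg' : ∀ {F : CircleDeg1Liftˣ} (_ : IsLift F (ρ g : S1 ≃ₜ S1)) (n : ℕ),
        img ρ (g * w ^ n) (((↑) : ℝ → S1) '' Set.Ioo a b) =
          ((↑) : ℝ → S1) '' Set.Ioo (F (A n)) (F (B n)) := fun hF n => by
      rw [img_mul, himg, img_image_Ioo hF]
    rw [himg' hF₀, himg, hA0, hB0] at hm₀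
    obtain ⟨j, hj1, hj2⟩ := exists_int_of_image_subset hba ((units_lt_iff F₀).2 (hAB _)) hm₀
    -- The lift of `g` is normalised so that the relevant images remain in `[a, b]`; as its length
    -- is at most 1, the integer ambiguities below vanish.
    obtain ⟨F, hF, hFa, hFb⟩ : ∃ F : CircleDeg1Liftˣ, IsLift F (ρ g : S1 ≃ₜ S1) ∧
        a ≤ F (A m₀) ∧ F (B m₀) ≤ b := by
      refine ⟨_, hF₀.translate_mul j, ?_, ?_⟩ <;>
        rwa [Units.val_mul, CircleDeg1Lift.mul_apply, translate_apply']
    have hFa' : ∀ n, m₀ ≤ n → a ≤ F (A n) := fun n hn =>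
      hFa.trans ((units_le_iff F).2 (hAm hn))
    have hFb' : ∀ n, m₀ ≤ n → F (B n) ≤ b := fun n hn =>
      ((units_le_iff F).2 (hBm hn)).trans hFb
    rw [hF.act_coe]
    congr 1
    apply le_antisymm
    · have h3 : ∀ n, m₀ ≤ n → F (A n) ≤ p := by
        intro n hn
        obtain ⟨m, hm⟩ := h2 n
        rw [himg' hF, himg] at hm
        have hle : F (B n) ≤ F (A n) + 1 := by
          rw [← CircleDeg1Lift.map_add_one]
          refine (units_le_iff F).2 ?_
          linarith [hBb n, haA n]
        obtain ⟨i, hi1, hi2⟩ := exists_int_of_image_subset hle (hAB m) hm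
        have hi : i = 0 := int_eq_zero_of_arcs hba (hAB m) (haA m) (hBb m)
          ((hFa' n hn).trans hi1) (hi2.trans (hFb' n hn))
        rw [hi, Int.cast_zero, add_zero] at hi1
        exact hi1.trans (hAp m)
      have h4 : p ≤ (F⁻¹ : CircleDeg1Liftˣ) p := ciSup_le fun n => by
        refine (hAm (le_max_left n m₀)).trans ?_
        rw [← units_le_iff F, CircleDeg1Lift.units_apply_inv_apply]
        exact h3 _ (le_max_right n m₀)
      have h5 := (units_le_iff F).2 h4
      rwa [CircleDeg1Lift.units_apply_inv_apply] at h5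
    · refine ciSup_le fun n => ?_
      obtain ⟨m, hm⟩ := h1 n
      rw [himg' hF, himg] at hm
      have hle : B n ≤ A n + 1 := by linarith [hBb n, haA n]
      obtain ⟨i, hi1, hi2⟩ := exists_int_of_image_subset hle ((units_lt_iff F).2 (hAB m)) hm
      have h3 : F (A m) ≤ F (A (max m m₀)) := (units_le_iff F).2 (hAm (le_max_left _ _))
      have h4 : F (B (max m m₀)) ≤ F (B m) := (units_le_iff F).2 (hBm (le_max_left _ _))
      have hi : i = 0 := int_eq_zero_of_arcs hba ((units_lt_iff F).2 (hAB (max m m₀)))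
        (hFa' _ (le_max_right _ _)) (hFb' _ (le_max_right _ _)) (by linarith [haA n])
        (by linarith [hBb n])
      rw [hi, Int.cast_zero, add_zero] at hi1
      exact hi1.trans ((units_le_iff F).2 (hAp m))
  · obtain ⟨F₀, hF₀⟩ := exists_isLift ρ g
    obtain ⟨j, hj⟩ := coe_eq_coe_iff.1 ((hF₀.act_coe p).symm.trans hg)
    obtain ⟨F, hF, hFp⟩ : ∃ F : CircleDeg1Liftˣ, IsLift F (ρ g : S1 ≃ₜ S1) ∧ F p = p := by
      refine ⟨_, hF₀.translate_mul j, ?_⟩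
      rw [Units.val_mul, CircleDeg1Lift.mul_apply, translate_apply', ← hj]
    rw [img_mul, himg, img_image_Ioo hF] at hd
    -- Both closed intervals contain `p`. If their interiors were disjoint, `p` would be the left
    -- end of one and the right end of the other, which is impossible for an increasing `F` fixing
    -- `p`.
    have h1 : F (A n) ≤ p := by rw [← hFp]; exact (units_le_iff F).2 (hAp n)
    have h2 : p ≤ F (B n) := by rw [← hFp]; exact (units_le_iff F).2 (hpB n)
    have h3 : F (A n) < F (B n) := (units_lt_iff F).2 (hAB n)
    by_cases h : max (A n) (F (A n)) < min (B n) (F (B n))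
    · obtain ⟨s, hs1, hs2⟩ := exists_between h
      rw [max_lt_iff] at hs1
      rw [lt_min_iff] at hs2
      exact Set.disjoint_left.1 hd ⟨s, ⟨hs1.2, hs2.2⟩, rfl⟩ ⟨s, ⟨hs1.1, hs2.1⟩, rfl⟩
    · rw [max_lt_iff, lt_min_iff, lt_min_iff] at h
      rcases lt_or_ge (F (A n)) (B n) with h4 | h4
      · rcases lt_or_ge (A n) (F (B n)) with h5 | h5
        · exact h ⟨⟨hAB n, h5⟩, h4, h3⟩
        · have h6 : A n = p := le_antisymm (hAp n) (h2.trans h5)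
          rw [h6, hFp] at h3
          linarith
      · have h5 : F (A n) = p := le_antisymm h1 ((hpB n).trans h4)
        have h6 : A n = p := (units_strictMono F).injective (h5.trans hFp.symm)
        have := hAB n
        linarith [hpB n]

/-! ### Equivalent arc systems -/

/-- `θ` is a bijection between two systems of arcs which preserves the cyclic order and the
combinatorics of the action of the elements of `S`. -/
structure ArcEquivalence {G : Type*} [Group G] (ρ₁ ρ₂ : G →* HomeoPlus) (S : Set G)
    (𝓘₁ 𝓘₂ : Set (Set S1)) (θ : Set S1 → Set S1) : Prop where
  closure_eq_top : Submonoid.closure S = ⊤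
  left : IsArcSystem 𝓘₁
  right : IsArcSystem 𝓘₂
  bijOn : Set.BijOn θ 𝓘₁ 𝓘₂
  cyclic : ∀ I₁ ∈ 𝓘₁, ∀ I₂ ∈ 𝓘₁, ∀ I₃ ∈ 𝓘₁,
    CyclicallyOrdered I₁ I₂ I₃ → CyclicallyOrdered (θ I₁) (θ I₂) (θ I₃)
  inclusion : ∀ k ∈ S, ∀ I ∈ 𝓘₁, ∀ I' ∈ 𝓘₁, img ρ₁ k I ⊆ I' → img ρ₂ k (θ I) ⊆ θ I'
  markov : ∀ k ∈ S, ∀ I ∈ 𝓘₁, (∃ I' ∈ 𝓘₁, img ρ₁ k I ⊆ I') ∨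
    ∃ A B, MarkovUnion 𝓘₁ (img ρ₁ k I) A B ∧
      MarkovUnion 𝓘₂ (img ρ₂ k (θ I)) (θ '' A) (gapImage 𝓘₁ 𝓘₂ θ B)

namespace ArcEquivalence

variable {G : Type u} [Group G] {ρ₁ ρ₂ : G →* HomeoPlus} {S : Set G}
  {𝓘₁ 𝓘₂ : Set (Set S1)} {θ : Set S1 → Set S1} (E : ArcEquivalence ρ₁ ρ₂ S 𝓘₁ 𝓘₂ θ)

include E

theorem mapsTo {I : Set S1} (hI : I ∈ 𝓘₁) : θ I ∈ 𝓘₂ := E.bijOn.mapsTo hI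

theorem contracts {g : G} {I I' : Set S1} (hI : I ∈ 𝓘₁) (h : Contracts ρ₁ S 𝓘₁ g I I') :
    Contracts ρ₂ S 𝓘₂ g (θ I) (θ I') := by
  induction h with
  | refl I _ => exact .refl _ (E.mapsTo hI)
  | step h hk hO hsub ih =>
    exact (ih hI).step hk (E.mapsTo hO) (E.inclusion _ hk _ h.mem_right _ hO hsub)

/-- While two points stay in the same arcs, an element of `S` preserves their order. -/
theorem before_act_iff {k : G} (hk : k ∈ S) {I J : Set S1} (hI : I ∈ 𝓘₁) (hJ : J ∈ 𝓘₁)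
    {x y x' y' : S1} (hx : x ∈ I) (hy : y ∈ I) (hx' : x' ∈ θ I) (hy' : y' ∈ θ I)
    (hkx : act ρ₁ k x ∈ J) (hky : act ρ₁ k y ∈ J) (hkx' : act ρ₂ k x' ∈ θ J)
    (hky' : act ρ₂ k y' ∈ θ J) :
    (Before I x y ↔ Before J (act ρ₁ k x) (act ρ₁ k y)) ∧
      (Before (θ I) x' y' ↔ Before (θ J) (act ρ₂ k x') (act ρ₂ k y')) := by
  have hIp := isPreconnected_img ρ₁ k (E.left.isPreconnected I hI)
  have hIp' := isPreconnected_img ρ₂ k (E.right.isPreconnected _ (E.mapsTo hI))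
  have hJp := E.left.isPreconnected J hJ
  have hJp' := E.right.isPreconnected _ (E.mapsTo hJ)
  rw [← before_img (ρ := ρ₁) k (K := I) (x := x) (y := y),
      ← before_img (ρ := ρ₂) k (K := θ I) (x := x') (y := y')]
  -- Either the image of `I` lies in `J` or it contains `J`; the order of the smaller arc is the
  -- restriction of that of the larger, for both actions.
  rcases E.markov k hk I hI with ⟨I', hI', hsub⟩ | ⟨A, B, hM, hM'⟩
  · obtain rfl := E.left.eq_of_mem I' hI' J hJ _ (hsub (act_mem_img ρ₁ hx)) hkx
    exact ⟨Before.mono hIp hJp (E.left.ne_univ _ hJ) hsub (act_mem_img ρ₁ hx)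
        (act_mem_img ρ₁ hy),
      Before.mono hIp' hJp' (E.right.ne_univ _ (E.mapsTo hJ)) (E.inclusion k hk I hI _ hJ hsub)
        (act_mem_img ρ₂ hx') (act_mem_img ρ₂ hy')⟩
  · have hJA := mem_of_markovUnion E.left hM hJ hkx (act_mem_img ρ₁ hx)
    exact ⟨(Before.mono hJp hIp (img_ne_univ ρ₁ k (E.left.ne_univ _ hI))
        (subset_of_markovUnion hM hJA) hkx hky).symm,
      (Before.mono hJp' hIp' (img_ne_univ ρ₂ k (E.right.ne_univ _ (E.mapsTo hI)))
        (subset_of_markovUnion hM' ⟨J, hJA, rfl⟩) hkx' hky').symm⟩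

/-- When two points are sent to different arcs by an element of `S`, their order is determined. -/
theorem before_of_ne {k : G} (hk : k ∈ S) {I J J' : Set S1} (hI : I ∈ 𝓘₁) (hJ : J ∈ 𝓘₁)
    (hJ' : J' ∈ 𝓘₁) (hne : J ≠ J') {x y x' y' : S1} (hx : x ∈ I) (hy : y ∈ I)
    (hkx : act ρ₁ k x ∈ J) (hky : act ρ₁ k y ∈ J') (hkx' : act ρ₂ k x' ∈ θ J)
    (hky' : act ρ₂ k y' ∈ θ J') (h : Before I x y) : Before (θ I) x' y' := by
  rcases E.markov k hk I hI with ⟨I', hI', hsub⟩ | ⟨A, B, hM, hM'⟩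
  · refine absurd ?_ hne
    rw [← E.left.eq_of_mem I' hI' J hJ _ (hsub (act_mem_img ρ₁ hx)) hkx,
      ← E.left.eq_of_mem I' hI' J' hJ' _ (hsub (act_mem_img ρ₁ hy)) hky]
  · rw [← before_img (ρ := ρ₂) k]
    exact before_of_markovUnion E.left E.right E.bijOn E.cyclic
      (isPreconnected_img ρ₁ k (E.left.isPreconnected I hI)) (isOpen_img ρ₁ k (E.left.isOpen I hI))
      (img_ne_univ ρ₁ k (E.left.ne_univ _ hI))
      (isPreconnected_img ρ₂ k (E.right.isPreconnected _ (E.mapsTo hI)))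
      (img_ne_univ ρ₂ k (E.right.ne_univ _ (E.mapsTo hI))) hM hM'
      (mem_of_markovUnion E.left hM hJ hkx (act_mem_img ρ₁ hx))
      (mem_of_markovUnion E.left hM hJ' hky (act_mem_img ρ₁ hy)) hne hkx hky hkx' hky'
      ((before_img k).2 h)

section Itinerary

open Filter

variable {w : G} {I₀ : Set S1} {c : G → Set S1}
  (hc : ∀ g, c g ∈ 𝓘₁ ∧ ∀ᶠ n in atTop, img ρ₁ (g * w ^ n) I₀ ⊆ c g ∧
    img ρ₂ (g * w ^ n) (θ I₀) ⊆ θ (c g))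

include hc

/-- Induction on `k` as a product of generators, peeling off the one that acts first. If it sends
the two families into different arcs, `before_of_ne` decides their order; otherwise it preserves the
order and the shorter product separates their images. -/
theorem eventually_before_of_separated (k : G) : ∀ g g' : G, c (k * g) ≠ c (k * g') →
    c g = c g' → ∀ᶠ n in atTop, ∀ x ∈ img ρ₁ (g * w ^ n) I₀, ∀ y ∈ img ρ₁ (g' * w ^ n) I₀,
      ∀ x' ∈ img ρ₂ (g * w ^ n) (θ I₀), ∀ y' ∈ img ρ₂ (g' * w ^ n) (θ I₀),
        Before (c g) x y → Before (θ (c g)) x' y' := by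
  have hk : k ∈ Submonoid.closure S := by rw [E.closure_eq_top]; trivial
  induction hk using Submonoid.closure_induction_right with
  | one =>
    intro g g' h h'
    rw [one_mul, one_mul] at h
    exact absurd h' h
  | mul_right k _ s hs ih =>
    intro g g' h h'
    have hmem : ∀ {ρ : G →* HomeoPlus} {g : G} {n : ℕ} {I : Set S1} {x : S1},
        x ∈ img ρ (g * w ^ n) I → act ρ s x ∈ img ρ (s * g * w ^ n) I := fun {ρ g n I x} hx => by
      rw [mul_assoc, img_mul]
      exact act_mem_img ρ hx
    by_cases hne : c (s * g) = c (s * g')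
    · have h1 := ih (s * g) (s * g') (by rwa [← mul_assoc, ← mul_assoc]) hne
      filter_upwards [h1, (hc g).2, (hc g').2, (hc (s * g)).2, (hc (s * g')).2] with n h1 h2 h3 h4 h5
      intro x hx y hy x' hx' y' hy'
      rw [← h'] at h3
      rw [← hne] at h5
      obtain ⟨e1, e2⟩ := E.before_act_iff hs (hc g).1 (hc (s * g)).1 (h2.1 hx) (h3.1 hy) (h2.2 hx')
        (h3.2 hy') (h4.1 (hmem hx)) (h5.1 (hmem hy)) (h4.2 (hmem hx')) (h5.2 (hmem hy'))
      rw [e1, e2]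
      exact h1 _ (hmem hx) _ (hmem hy) _ (hmem hx') _ (hmem hy')
    · filter_upwards [(hc g).2, (hc g').2, (hc (s * g)).2, (hc (s * g')).2] with n h2 h3 h4 h5
      intro x hx y hy x' hx' y' hy'
      rw [← h'] at h3
      exact E.before_of_ne hs (hc g).1 (hc (s * g)).1 (hc (s * g')).1 hne (h2.1 hx) (h3.1 hy)
        (h4.1 (hmem hx)) (h5.1 (hmem hy)) (h4.2 (hmem hx')) (h5.2 (hmem hy'))

/-- The cyclic order of three arcs with different itineraries is the same for both actions. -/
theorem eventually_sbtw {g₁ g₂ g₃ : G} (h₁₂ : ∃ k, c (k * g₁) ≠ c (k * g₂))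
    (h₂₃ : ∃ k, c (k * g₂) ≠ c (k * g₃)) (h₃₁ : ∃ k, c (k * g₃) ≠ c (k * g₁)) :
    ∀ᶠ n in atTop, ∀ x₁ ∈ img ρ₁ (g₁ * w ^ n) I₀, ∀ x₂ ∈ img ρ₁ (g₂ * w ^ n) I₀,
      ∀ x₃ ∈ img ρ₁ (g₃ * w ^ n) I₀, ∀ y₁ ∈ img ρ₂ (g₁ * w ^ n) (θ I₀),
      ∀ y₂ ∈ img ρ₂ (g₂ * w ^ n) (θ I₀), ∀ y₃ ∈ img ρ₂ (g₃ * w ^ n) (θ I₀),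
        sbtw x₁ x₂ x₃ → sbtw y₁ y₂ y₃ := by
  have pair : ∀ {g g' : G}, (∃ k, c (k * g) ≠ c (k * g')) → ∀ᶠ n in atTop, c g = c g' →
      ∀ x ∈ img ρ₁ (g * w ^ n) I₀, ∀ y ∈ img ρ₁ (g' * w ^ n) I₀,
      ∀ x' ∈ img ρ₂ (g * w ^ n) (θ I₀), ∀ y' ∈ img ρ₂ (g' * w ^ n) (θ I₀),
        Before (c g) x y → Before (θ (c g)) x' y' := by
    rintro g g' ⟨k, hk⟩
    by_cases h : c g = c g'
    · filter_upwards [E.eventually_before_of_separated hc k g g' hk h] with n hn _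
      exact hn
    · exact Eventually.of_forall fun n h' => absurd h' h
  have hL := fun g => E.left.isPreconnected _ (hc g).1
  have hR := fun g => E.right.isPreconnected _ (E.mapsTo (hc g).1)
  have hne : ∀ {g g'}, c g ≠ c g' → ∀ y ∈ θ (c g'), y ∉ θ (c g) := fun {g g'} h y hy hy' =>
    h (E.bijOn.injOn (hc g).1 (hc g').1 (E.right.eq_of_mem _ (E.mapsTo (hc g).1) _
      (E.mapsTo (hc g').1) y hy' hy))
  have hne₁ : ∀ {g g'}, c g ≠ c g' → ∀ y ∈ c g', y ∉ c g := fun {g g'} h y hy hy' =>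
    h (E.left.eq_of_mem _ (hc g).1 _ (hc g').1 y hy' hy)
  filter_upwards [(hc g₁).2, (hc g₂).2, (hc g₃).2, pair h₁₂, pair h₂₃, pair h₃₁] with
    n m1 m2 m3 p12 p23 p31
  intro x₁ hx₁ x₂ hx₂ x₃ hx₃ y₁ hy₁ y₂ hy₂ y₃ hy₃ h
  have a1 := m1.1 hx₁
  have a2 := m2.1 hx₂
  have a3 := m3.1 hx₃
  have b1 := m1.2 hy₁
  have b2 := m2.2 hy₂
  have b3 := m3.2 hy₃
  -- If all three arcs coincide, the linear order in that arc decides; if two coincide, the third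
  -- supplies the cut point; if none do, `θ` preserves their cyclic order.
  by_cases e12 : c g₁ = c g₂
  · have p12 := p12 e12 x₁ hx₁ x₂ hx₂ y₁ hy₁ y₂ hy₂
    rw [← e12] at a2 b2
    by_cases e23 : c g₂ = c g₃
    · have e13 := e12.trans e23
      have p23 := p23 e23 x₂ hx₂ x₃ hx₃ y₂ hy₂ y₃ hy₃
      have p31 := p31 e13.symm x₃ hx₃ x₁ hx₁ y₃ hy₃ y₁ hy₁
      rw [← e13] at a3 b3
      rw [← e12] at p23
      rw [← e13] at p31
      obtain ⟨z, hz⟩ := (Set.ne_univ_iff_exists_notMem _).1 (E.left.ne_univ _ (hc g₁).1)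
      obtain ⟨z', hz'⟩ := (Set.ne_univ_iff_exists_notMem _).1
        (E.right.ne_univ _ (E.mapsTo (hc g₁).1))
      rw [before_iff (hL g₁) a1 a2 hz, before_iff (hR g₁) b1 b2 hz'] at p12
      rw [before_iff (hL g₁) a2 a3 hz, before_iff (hR g₁) b2 b3 hz'] at p23
      rw [before_iff (hL g₁) a3 a1 hz, before_iff (hR g₁) b3 b1 hz'] at p31
      rw [sbtw_iff_of_ne (z := z') (fun h => hz' (h ▸ b1)) (fun h => hz' (h ▸ b2))
        (fun h => hz' (h ▸ b3))]
      rw [sbtw_iff_of_ne (z := z) (fun h => hz (h ▸ a1)) (fun h => hz (h ▸ a2))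
        (fun h => hz (h ▸ a3))] at h
      rcases h with ⟨h1, h2⟩ | ⟨h1, h2⟩ | ⟨h1, h2⟩
      · exact Or.inl ⟨p12 h1, p23 h2⟩
      · exact Or.inr (Or.inl ⟨p23 h1, p31 h2⟩)
      · exact Or.inr (Or.inr ⟨p31 h1, p12 h2⟩)
    · have e13 : c g₁ ≠ c g₃ := fun h => e23 (e12.symm.trans h)
      rw [before_iff (hL g₁) a1 a2 (hne₁ e13 _ a3), before_iff (hR g₁) b1 b2 (hne e13 _ b3)] at p12
      exact (p12 h.cyclic_right).cyclic_left
  · by_cases e23 : c g₂ = c g₃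
    · have p23 := p23 e23 x₂ hx₂ x₃ hx₃ y₂ hy₂ y₃ hy₃
      rw [← e23] at a3 b3
      rw [before_iff (hL g₂) a2 a3 (hne₁ (Ne.symm e12) _ a1),
        before_iff (hR g₂) b2 b3 (hne (Ne.symm e12) _ b1)] at p23
      exact p23 h
    · by_cases e31 : c g₃ = c g₁
      · have p31 := p31 e31 x₃ hx₃ x₁ hx₁ y₃ hy₃ y₁ hy₁
        rw [← e31] at a1 b1
        rw [before_iff (hL g₃) a3 a1 (hne₁ (Ne.symm e23) _ a2),
          before_iff (hR g₃) b3 b1 (hne (Ne.symm e23) _ b2)] at p31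
        exact (p31 h.cyclic_left).cyclic_right
      · exact E.cyclic _ (hc g₁).1 _ (hc g₂).1 _ (hc g₃).1
          (cyclicallyOrdered_of_sbtw (hL g₁) (hL g₂) (hL g₃)
            (E.left.disjoint (hc g₁).1 (hc g₂).1 e12) (E.left.disjoint (hc g₂).1 (hc g₃).1 e23)
            (E.left.disjoint (hc g₁).1 (hc g₃).1 (Ne.symm e31)) a1 a2 a3 h)
          y₁ b1 y₂ b2 y₃ b3

end Itinerary

/-- Two actions with equivalent arc systems are semi-conjugate as soon as some element contracts an
arc, in such a way that the images of the contracted arc under the group shrink into arcs. -/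
theorem semiConjugate {w : G} {I₀ : Set S1} (hI₀ : I₀ ∈ 𝓘₁) (hw : Contracts ρ₁ S 𝓘₁ w I₀ I₀)
    (hall : ∀ g : G, ∃ (n : ℕ) (I' : Set S1), Contracts ρ₁ S 𝓘₁ (g * w ^ n) I₀ I') :
    SemiConjugate ρ₁ ρ₂ := by
  -- `c g` contains the images of `I₀` under `g * w ^ n` for all `n ≥ N g`, since further powers of
  -- `w` first contract `I₀` into itself.
  choose N c hNc using hall
  have hc : ∀ g, c g ∈ 𝓘₁ ∧ ∀ᶠ n in Filter.atTop, img ρ₁ (g * w ^ n) I₀ ⊆ c g ∧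
      img ρ₂ (g * w ^ n) (θ I₀) ⊆ θ (c g) := by
    intro g
    refine ⟨(hNc g).mem_right, Filter.eventually_atTop.2 ⟨N g, fun n hn => ?_⟩⟩
    obtain ⟨m, rfl⟩ := Nat.exists_eq_add_of_le hn
    have h := (hw.pow hI₀ m).trans (hNc g)
    rw [mul_assoc, ← pow_add] at h
    exact ⟨h.img_subset, (E.contracts hI₀ h).img_subset⟩
  have hθI₀ := E.mapsTo hI₀
  have hw₂ := E.contracts hI₀ hw
  obtain ⟨p₁, hp₁, hfix₁, hmove₁⟩ := exists_limit_point ρ₁ (E.left.isPreconnected _ hI₀)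
    (E.left.isOpen _ hI₀) (E.left.nonempty _ hI₀) (E.left.ne_univ _ hI₀) hw.img_subset
  obtain ⟨p₂, hp₂, hfix₂, hmove₂⟩ := exists_limit_point ρ₂ (E.right.isPreconnected _ hθI₀)
    (E.right.isOpen _ hθI₀) (E.right.nonempty _ hθI₀) (E.right.ne_univ _ hθI₀) hw₂.img_subset
  have hcw : ∀ n : ℕ, c (w ^ n)⁻¹ = I₀ := by
    intro n
    obtain ⟨m, hm⟩ := (((hc (w ^ n)⁻¹).2).and (Filter.eventually_ge_atTop n)).exists
    obtain ⟨r, rfl⟩ := Nat.exists_eq_add_of_le hm.2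
    obtain ⟨x, hx⟩ := E.left.nonempty _ hI₀
    have h1 := hm.1.1 (act_mem_img ρ₁ hx)
    rw [pow_add, inv_mul_cancel_left] at h1
    exact E.left.eq_of_mem _ (hc _).1 _ hI₀ _ h1
      ((hw.pow hI₀ r).img_subset (act_mem_img ρ₁ hx))
  -- the elements which preserve the itinerary
  have hshift : ∀ (n : ℕ) (g : G), c ((w ^ n)⁻¹ * g) = I₀ → ∃ m : ℕ,
      img ρ₁ (g * w ^ m) I₀ ⊆ img ρ₁ (w ^ n) I₀ ∧
        img ρ₂ (g * w ^ m) (θ I₀) ⊆ img ρ₂ (w ^ n) (θ I₀) := by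
    intro n g hg
    obtain ⟨m, h1, h2⟩ := ((hc ((w ^ n)⁻¹ * g)).2).exists
    rw [hg] at h1 h2
    refine ⟨m, ?_, ?_⟩
    · have := img_mono ρ₁ (w ^ n) h1
      rwa [← img_mul, mul_assoc, mul_inv_cancel_left] at this
    · have := img_mono ρ₂ (w ^ n) h2
      rwa [← img_mul, mul_assoc, mul_inv_cancel_left] at this
  have hshift' : ∀ (n : ℕ) (g : G), c ((w ^ n)⁻¹ * g⁻¹) = I₀ → ∃ m : ℕ,
      img ρ₁ (w ^ m) I₀ ⊆ img ρ₁ (g * w ^ n) I₀ ∧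
        img ρ₂ (w ^ m) (θ I₀) ⊆ img ρ₂ (g * w ^ n) (θ I₀) := by
    intro n g hg
    obtain ⟨m, h1, h2⟩ := hshift n g⁻¹ hg
    refine ⟨m, ?_, ?_⟩
    · have := img_mono ρ₁ g h1
      rwa [← img_mul, ← img_mul, mul_inv_cancel_left] at this
    · have := img_mono ρ₂ g h2
      rwa [← img_mul, ← img_mul, mul_inv_cancel_left] at this
  -- With the itinerary of the identity, the arcs `g wⁿ(I₀)` and `wⁿ(I₀)` are cofinal in each other,
  -- so their limit point is fixed, for both actions.
  have hsame : ∀ g : G, (∀ k, c (k * g) = c k) → act ρ₁ g p₁ = p₁ ∧ act ρ₂ g p₂ = p₂ := by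
    intro g hg
    have hg' : ∀ k, c (k * g⁻¹) = c k := fun k => by rw [← hg (k * g⁻¹), inv_mul_cancel_right]
    have s1 := fun n => hshift n g ((hg _).trans (hcw n))
    have s2 := fun n => hshift' n g ((hg' _).trans (hcw n))
    exact ⟨hfix₁ g (fun n => (s1 n).imp fun m h => h.1) (fun n => (s2 n).imp fun m h => h.1),
      hfix₂ g (fun n => (s1 n).imp fun m h => h.2) (fun n => (s2 n).imp fun m h => h.2)⟩
  -- With another itinerary, some `k` sends the two families eventually into disjoint arcs, for both
  -- actions.
  have hdiff : ∀ g : G, (∃ k, c (k * g) ≠ c k) → act ρ₁ g p₁ ≠ p₁ ∧ act ρ₂ g p₂ ≠ p₂ := by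
    rintro g ⟨k, hk⟩
    obtain ⟨n, ⟨h1, h2⟩, h3, h4⟩ := ((hc (k * g)).2.and (hc k).2).exists
    have hk' : θ (c (k * g)) ≠ θ (c k) := fun h => hk (E.bijOn.injOn (hc _).1 (hc _).1 h)
    refine ⟨fun h => hmove₁ g h n ?_, fun h => hmove₂ g h n ?_⟩
    · refine Set.disjoint_left.2 fun x hx hx' => ?_
      have i1 := act_mem_img ρ₁ (g := k) hx
      have i2 := act_mem_img ρ₁ (g := k) hx'
      rw [← img_mul] at i1 i2
      rw [← mul_assoc] at i1
      exact hk (E.left.eq_of_mem _ (hc _).1 _ (hc _).1 _ (h1 i1) (h3 i2))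
    · refine Set.disjoint_left.2 fun x hx hx' => ?_
      have i1 := act_mem_img ρ₂ (g := k) hx
      have i2 := act_mem_img ρ₂ (g := k) hx'
      rw [← img_mul] at i1 i2
      rw [← mul_assoc] at i1
      exact hk' (E.right.eq_of_mem _ (E.mapsTo (hc _).1) _ (E.mapsTo (hc _).1) _ (h2 i1) (h4 i2))
  have hst : ∀ g : G, act ρ₁ g p₁ = p₁ ↔ act ρ₂ g p₂ = p₂ := by
    intro g
    by_cases h : ∃ k, c (k * g) ≠ c k
    · exact iff_of_false (hdiff g h).1 (hdiff g h).2
    · push Not at h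
      exact iff_of_true (hsame g h).1 (hsame g h).2
  have hsep : ∀ g g' : G, act ρ₁ g p₁ ≠ act ρ₁ g' p₁ →
      (∃ k, c (k * g) ≠ c (k * g')) ∧ act ρ₂ g p₂ ≠ act ρ₂ g' p₂ := by
    intro g g' h
    have key : ∀ {ρ : G →* HomeoPlus} {p : ℝ}, act ρ (g⁻¹ * g') p = p ↔
        act ρ g p = act ρ g' p := fun {ρ p} => by
      rw [act_mul, ← (act_injective ρ g).eq_iff, act_act_inv]
      exact eq_comm
    refine ⟨?_, fun h' => h (key.1 ((hst _).2 (key.2 h')))⟩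
    by_contra hk
    push Not at hk
    refine h (key.1 (hsame _ fun k => ?_).1)
    have := hk (k * g⁻¹)
    rw [inv_mul_cancel_right] at this
    rw [← mul_assoc, ← this]
  refine semiConjugate_of_orbit hst fun g g' h => ?_
  have h1 : sbtw (act ρ₁ 1 p₁) (act ρ₁ g p₁) (act ρ₁ g' p₁) := by rwa [act_one]
  obtain ⟨n1, n2, n3⟩ := sbtw_ne h1
  obtain ⟨k1, d1⟩ := hsep _ _ n1
  obtain ⟨k2, d2⟩ := hsep _ _ n2
  obtain ⟨k3, d3⟩ := hsep _ _ n3.symm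
  obtain ⟨n, hn⟩ := (E.eventually_sbtw hc k1 k2 k3).exists
  have hcl : ∀ g : G, act ρ₁ g p₁ ∈ closure (img ρ₁ (g * w ^ n) I₀) := fun g => by
    rw [img_mul]; exact act_mem_closure_img ρ₁ g (hp₁ n)
  have hcl₂ : ∀ g : G, act ρ₂ g p₂ ∈ closure (img ρ₂ (g * w ^ n) (θ I₀)) := fun g => by
    rw [img_mul]; exact act_mem_closure_img ρ₂ g (hp₂ n)
  obtain ⟨x₁, hx₁, x₂, hx₂, x₃, hx₃, hx⟩ := exists_sbtw_of_mem_closure (hcl 1) (hcl g) (hcl g') h1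
  have h2 : sbtw (act ρ₂ 1 p₂) (act ρ₂ g p₂) (act ρ₂ g' p₂) := by
    -- The opposite cyclic order is an open condition, so it would be realised by points of the arcs
    -- themselves, against `hn`.
    rcases sbtw_or_of_ne d1 d2 d3.symm with h2 | h2
    · exact h2
    · obtain ⟨y₁, hy₁, y₃, hy₃, y₂, hy₂, hy⟩ :=
        exists_sbtw_of_mem_closure (hcl₂ 1) (hcl₂ g') (hcl₂ g) h2
      exact absurd hy.cyclic_left (sbtw_asymm (hn x₁ hx₁ x₂ hx₂ x₃ hx₃ y₁ hy₁ y₂ hy₂ y₃ hy₃ hx))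
  rwa [act_one] at h2

end ArcEquivalence

/-- An equivalence of ping-pong partitions is an equivalence of systems of arcs. -/
theorem Family.IsEquivalence.arcEquivalence {G : Type*} [Group G] {X : Type*} [MulAction G X]
    {M : TreeMarking G X} {t : M.StableLetters} {ρ₁ ρ₂ : G →* HomeoPlus} {Θ₁ Θ₂ : Family t}
    {θ : Set S1 → Set S1} (h : IsEquivalence ρ₁ ρ₂ Θ₁ Θ₂ θ) (h₁ : Θ₁.IsPingPong ρ₁)
    (hA₁ : IsArcSystem Θ₁.intervals) (hA₂ : IsArcSystem Θ₂.intervals) :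
    ArcEquivalence ρ₁ ρ₂ t.gens Θ₁.intervals Θ₂.intervals θ where
  closure_eq_top := t.closure_gens
  left := hA₁
  right := hA₂
  bijOn := h.bijOn
  cyclic := h.cyclic
  inclusion := h.inclusion
  markov := by
    intro k hk I hI
    rcases h₁.markov k hk I hI with ⟨O, hO, hsub⟩ | ⟨A, B, hM⟩
    · obtain ⟨x, hx⟩ := hA₁.nonempty I hI
      obtain ⟨I', -, hI', h'⟩ := Θ₁.exists_interval_of_subset_atom hO
        (isPreconnected_img ρ₁ k (hA₁.isPreconnected I hI)) ⟨_, act_mem_img ρ₁ hx⟩ hsub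
      exact Or.inl ⟨I', hI', h'⟩
    · exact Or.inr ⟨A, B, hM, h.markov k hk I hI A B hM⟩

end PingPong

theorem theoremB {G : Type*} [Group G] [Group.FG G]
    (hfree : PingPong.VirtuallyFree G) (hcyc : ¬ PingPong.VirtuallyCyclic G)
    {X : Type*} [MulAction G X] (M : PingPong.TreeMarking G X) (t : M.StableLetters)
    (ρ₁ ρ₂ : G →* PingPong.HomeoPlus) (Θ₁ Θ₂ : PingPong.Family t)
    (h₁ : Θ₁.IsProperPingPong ρ₁) (h₂ : Θ₂.IsProperPingPong ρ₂)
    (hequiv : ∃ θ : Set PingPong.S1 → Set PingPong.S1,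
      PingPong.Family.IsEquivalence ρ₁ ρ₂ Θ₁ Θ₂ θ) :
    PingPong.SemiConjugate ρ₁ ρ₂ := by
  obtain ⟨θ, hθ⟩ := hequiv
  -- Without edges outside the spanning tree, a facing pair of vertices exists because `G` is not
  -- virtually cyclic; otherwise a stable letter is available.
  rcases isEmpty_or_nonempty M.HalfEdge with hS | ⟨⟨f⟩⟩
  · obtain ⟨P⟩ := M.exists_vertexPair t hcyc
    obtain ⟨w, I, hI, hw, hall⟩ :=
      PingPong.Family.exists_contracting_interval_of_vertexPair h₁.isPingPong P
    exact (hθ.arcEquivalence h₁.isPingPong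
      (PingPong.Family.isArcSystem_of_vertexPair h₁.isPingPong P)
      (PingPong.Family.isArcSystem_of_vertexPair h₂.isPingPong P)).semiConjugate hI hw hall
  · let s : t.SEdge := (f, true)
    obtain ⟨w, I, hI, hw, hall⟩ :=
      PingPong.Family.exists_contracting_interval_of_sEdge h₁.isPingPong s
    exact (hθ.arcEquivalence h₁.isPingPong
      (PingPong.Family.isArcSystem_of_sEdge h₁.isPingPong s)
      (PingPong.Family.isArcSystem_of_sEdge h₂.isPingPong s)).semiConjugate hI hw hall
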